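/- \textbf{Definitions.} Let $w$ be a string, $k\ge 1$, and let $gc=(C_1,\dots,C_{k-1})$ be a tuple of gap constraints, i.e. of sets of strings. An embedding satisfying $gc$ with respect to $w$ is a strictly increasing map $e:[k]\to[|w|]$ such that for every $j\in[k-1]$ the gap $w[e(j)+1..e(j+1)-1]$ belongs to $C_j$; it induces the string $w[e(1)]\cdots w[e(k)]$. For a string $p$ of length $k$ let $\Psi_{gc}(w)[p]$ be the number of embeddings that satisfy $gc$ with respect to $w$ and induce $p$. Strings are over an integer alphabet. Let $(C_i)_{i\in I}$ be a family of gap constraints, each $C_i$ presented to the algorithm by a given name (a finite sequence of natural numbers, for instance an index or an automaton for $C_i$). The \emph{equivalence problem with multiplicities} for this family asks, given (the names of) a tuple $gc=(C_{i_1},\dots,C_{i_{k-1}})$ of constraints of the family, with $k\ge 1$ part of the input, and strings $w,w'$, whether $\Psi_{gc}(w)[p]=\Psi_{gc}(w')[p]$ for every string $p$ of length $k$. Polynomial time refers to the unit-cost RAM with logarithmic word size: the input is a sequence of natural numbers, one per memory cell; the number of steps is bounded by a polynomial in the binary length of the input; and throughout the computation every memory cell holds a number at most $(n+2)^{d}$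 for a constant $d$, where $n$ is the maximum of the number of input words and the largest input word. \textbf{Theorem.} If the gap constraints can be decided in polynomial time, i.e. there is a polynomial-time algorithm that, given the name of $C_i$ and a string $u$, decides whether $u\in C_i$, then the equivalence problem with multiplicities can be solved in polynomial time. -/

import Mathlib

/-! ### Subsequences with gap constraints, counted with multiplicity -/

namespace GapSubseq

/-- The `j`-th gap of `w` induced by `e`: the factor of `w` strictly between the
positions `e j` and `e (j+1)`. -/
def gap {α : Type*} {l : ℕ} (w : List α) (e : Fin (l + 1) → Fin w.length) (j : Fin l) : List α :=
  (w.take (e j.succ : ℕ)).drop ((e j.castSucc : ℕ) + 1)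

/-- `e` is an embedding (strictly increasing map from the `k = l + 1` positions of a string of
length `k` to the positions of `w`) and satisfies the `(k-1)`-tuple `gc` with respect to `w`. -/
def IsGapEmbedding {α : Type*} {l : ℕ} (gc : Fin l → Language α) (w : List α)
    (e : Fin (l + 1) → Fin w.length) : Prop :=
  StrictMono e ∧ ∀ j : Fin l, gap w e j ∈ gc j

/-- The number of embeddings that satisfy `gc` with respect to `w` and induce the string `p`
of length `k = l + 1`. -/
noncomputable def embeddingCount {α : Type*} {l : ℕ} (gc : Fin l → Language α) (w : List α)
    (p : Fin (l + 1) → α) : ℕ :=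
  Nat.card {e : Fin (l + 1) → Fin w.length // IsGapEmbedding gc w e ∧ ∀ i, w.get (e i) = p i}

/-- Equivalence with multiplicities: every string of length `k` has the same number of
`gc`-satisfying embeddings in `w` as in `w'`. -/
def EquivWithMultiplicities {α : Type*} {l : ℕ} (gc : Fin l → Language α) (w w' : List α) : Prop :=
  ∀ p : Fin (l + 1) → α, embeddingCount gc w p = embeddingCount gc w' p

end GapSubseq

/-! ### The unit-cost random access machine with logarithmic word size -/

namespace RAM

/-- An operand: a constant, the content of a cell, or the content of the cell whose address is
stored in a cell (indirect addressing). -/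
inductive Operand where
  | const (n : ℕ)
  | direct (a : ℕ)
  | indirect (a : ℕ)

/-- A destination: a cell, or the cell whose address is stored in a cell. -/
inductive Dest where
  | direct (a : ℕ)
  | indirect (a : ℕ)

/-- The arithmetic and bitwise operations on words (`sub` is truncated subtraction). -/
inductive BinOp where
  | add | sub | mul | div | mod | land | lor | xor | shiftLeft | shiftRight

/-- An instruction: `compute d o x y` writes `x o y` to `d`, `jumpIfZero x q` jumps to the
instruction number `q` if `x` is zero. -/
inductive Instr where
  | compute (d : Dest) (o : BinOp) (x y : Operand)
  | jumpIfZero (x : Operand) (q : ℕ)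

/-- A program is a finite list of instructions, numbered from 0. -/
abbrev Program := List Instr

/-- A configuration: the instruction counter and the contents of the memory cells. -/
structure Config where
  pc : ℕ
  mem : ℕ → ℕ

def Operand.eval (m : ℕ → ℕ) : Operand → ℕ
  | .const n => n
  | .direct a => m a
  | .indirect a => m (m a)

def Dest.addr (m : ℕ → ℕ) : Dest → ℕ
  | .direct a => a
  | .indirect a => m a

def BinOp.eval : BinOp → ℕ → ℕ → ℕ
  | .add, x, y => x + y
  | .sub, x, y => x - y
  | .mul, x, y => x * y
  | .div, x, y => x / y
  | .mod, x, y => x % y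
  | .land, x, y => x &&& y
  | .lor, x, y => x ||| y
  | .xor, x, y => x ^^^ y
  | .shiftLeft, x, y => x <<< y
  | .shiftRight, x, y => x >>> y

/-- The effect of one instruction. -/
def Instr.exec (c : Config) : Instr → Config
  | .compute d o x y =>
      ⟨c.pc + 1, Function.update c.mem (d.addr c.mem) (o.eval (x.eval c.mem) (y.eval c.mem))⟩
  | .jumpIfZero x q => ⟨if x.eval c.mem = 0 then q else c.pc + 1, c.mem⟩

/-- One step of the program. The machine has halted when the instruction counter is
not the number of an instruction of the program; then nothing changes any more. -/
def step (prog : Program) (c : Config) : Config :=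
  match prog[c.pc]? with
  | some i => i.exec c
  | none => c

/-- The initial configuration on the input `x`: cell `0` holds the number of input words,
the cells `1, …, x.length` hold the input words, and all other cells hold `0`. -/
def initial (x : List ℕ) : Config := ⟨0, fun a => (x.length :: x).getD a 0⟩

/-- The configuration after `t` steps on the input `x`. -/
def run (prog : Program) (x : List ℕ) (t : ℕ) : Config := (step prog)^[t] (initial x)

/-- The size of an input: its total length when the input words are written in binary, with
one separator each. -/
def inputSize (x : List ℕ) : ℕ := (x.map fun a => Nat.size a + 1).sum

/-- The larger of the number of input words and the largest input word. For strings over an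
integer alphabet `{1, …, σ}` with `σ` at most the input length `n` this is at most `n`. -/
def wordRange (x : List ℕ) : ℕ := max x.length (x.foldr max 0)

/-- The (promise) problem with instances `a : I`, given to the machine as `enc a`, and with
yes-instances those satisfying `P`, is decidable in polynomial time: some program halts on every
instance after a number of unit-cost steps that is polynomial in the input size, with cell `0`
holding `1` on yes-instances and `0` on no-instances, and it uses only words of
`O(log n)` bits, that is, during the whole computation every memory cell holds a number of size at
most `(n + 2) ^ d`, where `n` is `wordRange` of the input and `d` is a constant. -/
def PolyTimeDecidable {I : Type*} (enc : I → List ℕ) (P : I → Prop) : Prop :=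
  ∃ (prog : Program) (time : Polynomial ℕ) (d : ℕ), ∀ a : I,
    ∃ t ≤ time.eval (inputSize (enc a)),
      prog.length ≤ (run prog (enc a) t).pc ∧
      (P a → (run prog (enc a) t).mem 0 = 1) ∧
      (¬ P a → (run prog (enc a) t).mem 0 = 0) ∧
      ∀ s ≤ t, ∀ b : ℕ, (run prog (enc a) s).mem b ≤ (wordRange (enc a) + 2) ^ d

end RAM

/-! ### The two decision problems, strings over an integer alphabet -/

namespace GapSubseq

/-- A list of numbers, preceded by its length. -/
def block (x : List ℕ) : List ℕ := x.length :: x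

/-- The gap constraints `C i` of the family `C`, where `C i` is presented by `name i`, can be
decided in polynomial time: given `name i` and a string `u`, decide whether `u ∈ C i`. -/
def ConstraintsInPolyTime {ι : Type*} (C : ι → Language ℕ) (name : ι → List ℕ) : Prop :=
  RAM.PolyTimeDecidable (I := ι × List ℕ)
    (fun a => block (name a.1) ++ block a.2)
    (fun a => a.2 ∈ C a.1)

/-- The equivalence problem with multiplicities for tuples of gap constraints from the family `C`
can be decided in polynomial time: given a tuple `gc` (as the list of the names of its
constraints, preceded by their number `k - 1`) and strings `w` and `w'`, decide whether `w` and
`w'` are equivalent with multiplicities with respect to `gc`. -/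
def EquivalenceInPolyTime {ι : Type*} (C : ι → Language ℕ) (name : ι → List ℕ) : Prop :=
  RAM.PolyTimeDecidable (I := List ι × List ℕ × List ℕ)
    (fun a => a.1.length :: (a.1.flatMap fun i => block (name i)) ++ block a.2.1 ++ block a.2.2)
    (fun a => EquivWithMultiplicities (fun j => C (a.1.get j)) a.2.1 a.2.2)

end GapSubseq

/-! Mathematics. Let `z` be `w`, a separator at position `s`, then `w'`. A sequence of `l + 1`
positions of `z` gets weight `1` if it is a `gc`-embedding inside `w`, `-1` if it is one inside
`w'`, and `0` otherwise. The weights of the sequences inducing `p` add up to the difference of the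
two multiplicities of `p` (`sum_weight_eq`). There are exponentially many `p`, but all these
differences vanish if and only if the sum of their squares does. That sum is a sum over pairs of
sequences inducing the same string (`sum_fiber_pairs_eq_zero_iff`). Weights and equality of letters
are both checked step by step, so it is a weighted count of walks of length `l` on the `|z|^2` pairs
of positions (`sum_mul_pathSum`, `sum_pairSum`), computable layer by layer.

The count does not fit into a word, so it is computed modulo small numbers. Its absolute value is at
most `4 ^ k` with `k = |z| (l + 1)`, and such a number divisible by `1, …, 4k + 8` is zero: it would
be a multiple of a central binomial coefficient that is too large (`eq_zero_of_forall_dvd`). Hence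
`equivWithMultiplicities_iff`: polynomially many residues decide equivalence.

Machine. Programs are written in a small structured language whose store consists of arrays. The
compiler interleaves the arrays in memory, so that each has unbounded length while all addresses
stay polynomial in the word range (`Exec.reach`, `polyTimeDecidable_of_exec`). The given decider for
the constraints is simulated once for every constraint and pair of positions, each time in an array
of its own (`HostOk.exec_simulate`, `exec_query`). The residues are then computed by filling one
array in which every entry needs boundedly many operations on earlier entries (`exec_table`), and
their sum is tested for zero (`exec_result`). -/

namespace RAM

/-! ### Runs of a program with bounded cells -/

/-- The program goes from `c` to `c'` in `t` steps, and all cells stay bounded by `B`. -/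
def Reach (prog : Program) (B : ℕ) (c : Config) (t : ℕ) (c' : Config) : Prop :=
  (step prog)^[t] c = c' ∧ ∀ s ≤ t, ∀ b, ((step prog)^[s] c).mem b ≤ B

variable {prog : Program} {B : ℕ}

theorem Reach.refl {c : Config} (h : ∀ b, c.mem b ≤ B) : Reach prog B c 0 c :=
  ⟨rfl, fun s hs => by obtain rfl : s = 0 := by omega
                       exact h⟩

theorem Reach.trans {c c' c'' : Config} {t t' : ℕ} (h : Reach prog B c t c')
    (h' : Reach prog B c' t' c'') : Reach prog B c (t + t') c'' := by
  refine ⟨by rw [add_comm, Function.iterate_add_apply, h.1, h'.1], fun s hs => ?_⟩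
  rcases le_total s t with hst | hst
  · exact h.2 s hst
  · obtain ⟨r, rfl⟩ := Nat.exists_eq_add_of_le hst
    rw [add_comm t r, Function.iterate_add_apply, h.1]
    exact h'.2 r (by omega)

theorem Reach.bounded {c c' : Config} {t : ℕ} (h : Reach prog B c t c') (b : ℕ) :
    c'.mem b ≤ B := by
  rw [← h.1]; exact h.2 t le_rfl b

theorem Reach.single {c c' : Config} (hs : step prog c = c') (h : ∀ b, c.mem b ≤ B)
    (h' : ∀ b, c'.mem b ≤ B) : Reach prog B c 1 c' := by
  refine ⟨hs, fun s hs' => ?_⟩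
  interval_cases s
  · exact h
  · simpa [hs] using h'

/-- The instructions `code` stand in `prog` from the instruction number `pc` on. -/
def CodeAt (prog : Program) : ℕ → List Instr → Prop
  | _, [] => True
  | pc, i :: code => prog[pc]? = some i ∧ CodeAt prog (pc + 1) code

@[simp] theorem codeAt_nil (pc : ℕ) : CodeAt prog pc [] := trivial

@[simp] theorem codeAt_cons (pc : ℕ) (i : Instr) (code : List Instr) :
    CodeAt prog pc (i :: code) ↔ prog[pc]? = some i ∧ CodeAt prog (pc + 1) code := Iff.rfl

theorem codeAt_append (pc : ℕ) (a b : List Instr) :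
    CodeAt prog pc (a ++ b) ↔ CodeAt prog pc a ∧ CodeAt prog (pc + a.length) b := by
  induction a generalizing pc with
  | nil => simp
  | cons i a ih =>
    simp only [List.cons_append, codeAt_cons, ih, List.length_cons, and_assoc]
    rw [show pc + 1 + a.length = pc + (a.length + 1) by ring]

theorem codeAt_length_append (pre code : List Instr) : CodeAt (pre ++ code) pre.length code := by
  induction code generalizing pre with
  | nil => simp
  | cons i code ih =>
    refine ⟨by simp, ?_⟩
    simpa using ih (pre ++ [i])

theorem codeAt_self (code : List Instr) : CodeAt code 0 code := codeAt_length_append [] code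

theorem update_le {m : ℕ → ℕ} (hm : ∀ b, m b ≤ B) (a : ℕ) {v : ℕ} (hv : v ≤ B) (b : ℕ) :
    Function.update m a v b ≤ B := by
  by_cases h : b = a
  · subst h; simpa using hv
  · simpa [h] using hm b

theorem reach_compute {pc : ℕ} {m : ℕ → ℕ} {d : Dest} {o : BinOp} {x y : Operand}
    (h : prog[pc]? = some (.compute d o x y)) (hm : ∀ b, m b ≤ B)
    (hv : o.eval (x.eval m) (y.eval m) ≤ B) :
    Reach prog B ⟨pc, m⟩ 1
      ⟨pc + 1, Function.update m (d.addr m) (o.eval (x.eval m) (y.eval m))⟩ :=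
  Reach.single (by simp [step, h, Instr.exec]) hm (update_le hm _ hv)

theorem reach_jumpIfZero {pc : ℕ} {m : ℕ → ℕ} {x : Operand} {q : ℕ}
    (h : prog[pc]? = some (.jumpIfZero x q)) (hm : ∀ b, m b ≤ B) :
    Reach prog B ⟨pc, m⟩ 1 ⟨if x.eval m = 0 then q else pc + 1, m⟩ :=
  Reach.single (by simp [step, h, Instr.exec]) hm hm

/-! ### A structured language over a two-dimensional store -/

/-- The store of the structured language: arrays numbered by natural numbers. -/
abbrev Store := ℕ → ℕ → ℕ

/-- Array numbers are expressions too, because each query to the constraint decider runs in an array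
whose number is computed at run time. -/
inductive Expr where
  | const (n : ℕ)
  | bin (o : BinOp) (x y : Expr)
  | load (c a : Expr)

inductive Stmt where
  | skip
  | store (c a v : Expr)
  | seq (s s' : Stmt)
  | ifz (e : Expr) (s s' : Stmt)
  | loop (e : Expr) (s : Stmt)

/-- Write `v` to the index `a` of the array `c`. -/
def Store.set (A : Store) (c a v : ℕ) : Store :=
  Function.update A c (Function.update (A c) a v)

def Expr.val (A : Store) : Expr → ℕ
  | .const n => n
  | .bin o x y => o.eval (x.val A) (y.val A)
  | .load c a => A (c.val A) (a.val A)

/-- All intermediate values are at most `B` and all accessed arrays have numbers below `I`. -/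
def Expr.Ok (I B : ℕ) (A : Store) : Expr → Prop
  | .const n => n ≤ B
  | .bin o x y => x.Ok I B A ∧ y.Ok I B A ∧ o.eval (x.val A) (y.val A) ≤ B
  | .load c a => c.Ok I B A ∧ a.Ok I B A ∧ c.val A < I ∧ A (c.val A) (a.val A) ≤ B

theorem Expr.Ok.val_le {I B : ℕ} {A : Store} {e : Expr} (h : e.Ok I B A) : e.val A ≤ B := by
  cases e with
  | const n => exact h
  | bin o x y => exact h.2.2
  | load c a => exact h.2.2.2

/-- The number of machine steps for evaluating an expression. -/
def Expr.cost : Expr → ℕ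
  | .const _ => 1
  | .bin _ x y => x.cost + y.cost + 1
  | .load c a => c.cost + a.cost + 4

/-- The number of scratch cells for evaluating an expression. -/
def Expr.depth : Expr → ℕ
  | .const _ => 1
  | .bin _ x y => max x.depth (y.depth + 1)
  | .load c a => max c.depth (a.depth + 1)

/-- Turn the array number in cell `d` and the index in cell `d + 1` into an address, in cell
`d + 1`. -/
def addressCode (d : ℕ) : List Instr :=
  [.compute (.direct (d + 1)) .mul (.direct (d + 1)) (.direct 0),
   .compute (.direct (d + 1)) .add (.direct (d + 1)) (.direct 1),
   .compute (.direct (d + 1)) .add (.direct (d + 1)) (.direct d)]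

def Expr.code : Expr → ℕ → List Instr
  | .const n, d => [.compute (.direct d) .add (.const n) (.const 0)]
  | .bin o x y, d =>
      x.code d ++ (y.code (d + 1) ++ [.compute (.direct d) o (.direct d) (.direct (d + 1))])
  | .load c a, d =>
      c.code d ++ (a.code (d + 1) ++ (addressCode d ++
        [.compute (.direct d) .add (.indirect (d + 1)) (.const 0)]))

theorem Expr.code_length (e : Expr) (d : ℕ) : (e.code d).length = e.cost := by
  induction e generalizing d with
  | const n => rfl
  | bin o x y hx hy => simp [code, cost, hx, hy, add_assoc]
  | load c a hc ha => simp [code, cost, hc, ha, addressCode, add_assoc]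

theorem Expr.depth_pos (e : Expr) : 1 ≤ e.depth := by
  induction e with
  | const n => simp [depth]
  | bin o x y hx hy => simp [depth]
  | load c a hc ha => simp [depth]

/-- Big-step semantics: `s` leads from `A` to `A'` with `t` machine steps, all values being at
most `B` and all accessed arrays having numbers below `I`. -/
inductive Exec (I B : ℕ) : Stmt → Store → Store → ℕ → Prop where
  | skip (A : Store) : Exec I B .skip A A 0
  | store {A : Store} {c a v : Expr} : c.Ok I B A → a.Ok I B A → v.Ok I B A → c.val A < I →
      Exec I B (.store c a v) A (A.set (c.val A) (a.val A) (v.val A))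
        (c.cost + a.cost + v.cost + 4)
  | seq {A A' A'' : Store} {s s' : Stmt} {t t' : ℕ} : Exec I B s A A' t → Exec I B s' A' A'' t' →
      Exec I B (.seq s s') A A'' (t + t')
  | ifz_zero {A A' : Store} {e : Expr} {s s' : Stmt} {t : ℕ} : e.Ok I B A → e.val A = 0 →
      Exec I B s A A' t → Exec I B (.ifz e s s') A A' (e.cost + 1 + t)
  -- In the code the nonzero branch stands first, so it pays one more step for jumping over the zero
  -- branch.
  | ifz_ne {A A' : Store} {e : Expr} {s s' : Stmt} {t : ℕ} : e.Ok I B A → e.val A ≠ 0 →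
      Exec I B s' A A' t → Exec I B (.ifz e s s') A A' (e.cost + 1 + (t + 1))
  | loop_zero {A : Store} {e : Expr} {s : Stmt} : e.Ok I B A → e.val A = 0 →
      Exec I B (.loop e s) A A (e.cost + 1)
  | loop_ne {A A' A'' : Store} {e : Expr} {s : Stmt} {t t' : ℕ} : e.Ok I B A → e.val A ≠ 0 →
      Exec I B s A A' t → Exec I B (.loop e s) A' A'' t' →
      Exec I B (.loop e s) A A'' (e.cost + 1 + (t + (1 + t')))

/-- The length of the code of a statement. -/
def Stmt.size : Stmt → ℕ
  | .skip => 0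
  | .store c a v => c.cost + a.cost + v.cost + 4
  | .seq s s' => s.size + s'.size
  | .ifz e s s' => e.cost + s.size + s'.size + 2
  | .loop e s => e.cost + s.size + 2

def Stmt.depth : Stmt → ℕ
  | .skip => 0
  | .store c a v => max c.depth (max (a.depth + 1) (v.depth + 2))
  | .seq s s' => max s.depth s'.depth
  | .ifz e s s' => max e.depth (max s.depth s'.depth)
  | .loop e s => max e.depth s.depth

/-- The code of a statement that starts at the instruction number `pc`. -/
def Stmt.code : Stmt → ℕ → List Instr
  | .skip, _ => []
  | .store c a v, _ =>
      c.code 2 ++ (a.code 3 ++ (v.code 4 ++ (addressCode 2 ++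
        [.compute (.indirect 3) .add (.direct 4) (.const 0)])))
  | .seq s s', pc => s.code pc ++ s'.code (pc + s.size)
  | .ifz e s s', pc =>
      e.code 2 ++ (.jumpIfZero (.direct 2) (pc + e.cost + 1 + s'.size + 1) ::
        (s'.code (pc + e.cost + 1) ++
          (.jumpIfZero (.const 0) (pc + e.cost + 1 + s'.size + 1 + s.size) ::
            s.code (pc + e.cost + 1 + s'.size + 1))))
  | .loop e s, pc =>
      e.code 2 ++ (.jumpIfZero (.direct 2) (pc + e.cost + 1 + s.size + 1) ::
        (s.code (pc + e.cost + 1) ++ [.jumpIfZero (.const 0) pc]))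

theorem Stmt.code_length (s : Stmt) (pc : ℕ) : (s.code pc).length = s.size := by
  induction s generalizing pc with
  | skip => rfl
  | store c a v => simp [code, size, Expr.code_length, addressCode]; ring
  | seq s s' h h' => simp [code, size, h, h']
  | ifz e s s' h h' => simp [code, size, h, h', Expr.code_length]; ring
  | loop e s h => simp [code, size, h, Expr.code_length]; ring

/-! ### Memory layout and correctness of the compiler -/

/-- The memory `m` represents the store `A`: the cells `0` and `1` hold `M` and `off`, and the
index `a` of the array `c < I` is kept in the cell `a * M + off + c`. -/
structure Represents (M off I : ℕ) (A : Store) (m : ℕ → ℕ) : Prop where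
  zero : m 0 = M
  one : m 1 = off
  cell : ∀ c < I, ∀ a, m (a * M + off + c) = A c a

/-- The parameters of the memory layout: the cells below `K` are for scratch. -/
structure Layout (M off I B K Bd : ℕ) : Prop where
  scratch : K ≤ off
  width : off + I ≤ M
  bound : (B + 1) * M ≤ Bd

/-- Evaluation writes only to scratch cells from `2` to `K - 1`. They lie below `off`, hence outside
all arrays. -/
theorem Represents.congr {M off I : ℕ} {A : Store} {m m' : ℕ → ℕ} {K : ℕ}
    (h : Represents M off I A m) (hK : K ≤ off) (h0 : m' 0 = m 0) (h1 : m' 1 = m 1)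
    (hm : ∀ b, K ≤ b → m' b = m b) : Represents M off I A m' :=
  ⟨h0.trans h.zero, h1.trans h.one, fun c hc a => by rw [hm _ (by omega), h.cell c hc a]⟩

variable {M off I K Bd : ℕ}

theorem address_le (hL : Layout M off I B K Bd) {a c : ℕ} (ha : a ≤ B) (hc : c < I) :
    a * M + off + c ≤ Bd := by
  have h1 := hL.width
  have h2 := hL.bound
  have h3 : a * M ≤ B * M := Nat.mul_le_mul_right _ ha
  have h4 : (B + 1) * M = B * M + M := by ring
  omega

theorem Layout.le_bound (hL : Layout M off I B K Bd) (hI : 0 < I) {v : ℕ} (hv : v ≤ B) :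
    v ≤ Bd := by
  have h1 := hL.width
  have h2 := hL.bound
  have h3 : v * 1 ≤ (B + 1) * M := Nat.mul_le_mul (by omega) (by omega)
  omega

theorem reach_addressCode (hL : Layout M off I B K Bd) {m : ℕ → ℕ} {pc d a c : ℕ}
    (hd : 2 ≤ d) (h0 : m 0 = M) (h1 : m 1 = off) (hc : m d = c) (ha : m (d + 1) = a)
    (hcI : c < I) (haB : a ≤ B) (hm : ∀ b, m b ≤ Bd) (hcode : CodeAt prog pc (addressCode d)) :
    Reach prog Bd ⟨pc, m⟩ 3 ⟨pc + 3, Function.update m (d + 1) (a * M + off + c)⟩ := by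
  obtain ⟨e1, e2, e3, -⟩ := hcode
  have hle := address_le hL haB hcI
  have n2 : d ≠ 0 := by omega
  have r1 := reach_compute (B := Bd) e1 hm (by
    simp only [BinOp.eval, Operand.eval, ha, h0]; omega)
  have r2 := reach_compute (B := Bd) e2 r1.bounded (by
    simp [BinOp.eval, Operand.eval, Dest.addr, ha, h0, h1, n2]; omega)
  have r3 := reach_compute (B := Bd) e3 r2.bounded (by
    simp [BinOp.eval, Operand.eval, Dest.addr, ha, h0, h1, n2, hc]; omega)
  have r := (r1.trans r2).trans r3
  simpa [BinOp.eval, Operand.eval, Dest.addr, ha, h0, h1, n2, hc] using r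

/-- The scratch cells form a stack. The frame condition below `d` protects the results of earlier
subexpressions and the two layout parameters; the one from `K` on protects the represented store.
The induction needs both. -/
theorem Expr.reach_code (hL : Layout M off I B K Bd) (hI : 0 < I) {A : Store} (e : Expr)
    {m : ℕ → ℕ} {pc d : ℕ} (hA : Represents M off I A m) (hok : e.Ok I B A) (hd : 2 ≤ d)
    (hK : d + e.depth ≤ K) (hm : ∀ b, m b ≤ Bd) (hcode : CodeAt prog pc (e.code d)) :
    ∃ m', Reach prog Bd ⟨pc, m⟩ e.cost ⟨pc + e.cost, m'⟩ ∧ m' d = e.val A ∧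
      (∀ b < d, m' b = m b) ∧ (∀ b, K ≤ b → m' b = m b) := by
  induction e generalizing m pc d with
  | const n =>
    have r := reach_compute (B := Bd) hcode.1 hm (by
      simpa [BinOp.eval, Operand.eval] using hL.le_bound hI hok)
    refine ⟨_, r, by simp [BinOp.eval, Operand.eval, Dest.addr, val], fun b hb => ?_,
      fun b hb => ?_⟩
    · simp [Dest.addr, hb.ne]
    · have := hK
      simp only [depth] at this
      simp [Dest.addr, show b ≠ d by omega]
  | bin o x y hx hy =>
    simp only [code, codeAt_append, code_length] at hcode
    simp only [depth] at hK
    obtain ⟨m1, r1, v1, l1, u1⟩ := hx hA hok.1 hd (by omega) hm hcode.1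
    have hA1 : Represents M off I A m1 :=
      hA.congr hL.scratch (l1 0 (by omega)) (l1 1 (by omega)) u1
    obtain ⟨m2, r2, v2, l2, u2⟩ := hy hA1 hok.2.1 (by omega : 2 ≤ d + 1) (by omega) r1.bounded
      hcode.2.1
    have e1 : m2 d = x.val A := by rw [l2 d (by omega), v1]
    have r3 := reach_compute (B := Bd) hcode.2.2.1 r2.bounded (by
      simpa [Operand.eval, e1, v2] using hL.le_bound hI hok.2.2)
    have r := (r1.trans r2).trans r3
    rw [show pc + x.cost + y.cost + 1 = pc + (bin o x y).cost by simp only [cost]; ring] at r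
    refine ⟨_, r, ?_, fun b hb => ?_, fun b hb => ?_⟩
    · simp [Operand.eval, Dest.addr, e1, v2, val]
    · simp [Dest.addr, hb.ne, l2 b (by omega), l1 b hb]
    · simp [Dest.addr, show b ≠ d by omega, u2 b hb, u1 b hb]
  | load c a hc ha =>
    simp only [code, codeAt_append, code_length] at hcode
    simp only [depth] at hK
    obtain ⟨m1, r1, v1, l1, u1⟩ := hc hA hok.1 hd (by omega) hm hcode.1
    have hA1 : Represents M off I A m1 :=
      hA.congr hL.scratch (l1 0 (by omega)) (l1 1 (by omega)) u1
    obtain ⟨m2, r2, v2, l2, u2⟩ := ha hA1 hok.2.1 (by omega : 2 ≤ d + 1) (by omega) r1.bounded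
      hcode.2.1
    have e1 : m2 d = c.val A := by rw [l2 d (by omega), v1]
    have hA2 : Represents M off I A m2 :=
      hA1.congr hL.scratch (l2 0 (by omega)) (l2 1 (by omega)) u2
    have r3 := reach_addressCode hL hd hA2.zero hA2.one e1 v2 hok.2.2.1 hok.2.1.val_le
      r2.bounded hcode.2.2.1
    have hdep := a.depth_pos
    have hw := hL.scratch
    -- The cell to be read is not the scratch cell that now holds its address.
    have n1 : a.val A * M + off + c.val A ≠ d + 1 := by omega
    have e2 := hA2.cell _ hok.2.2.1 (a.val A)
    have r4 := reach_compute (B := Bd) hcode.2.2.2.1 r3.bounded (by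
      simpa [BinOp.eval, Operand.eval, n1, e2] using hL.le_bound hI hok.2.2.2)
    have r := ((r1.trans r2).trans r3).trans r4
    rw [show pc + c.cost + a.cost + (addressCode d).length + 1 = pc + (load c a).cost by
      simp only [cost, addressCode, List.length_cons, List.length_nil]; ring] at r
    refine ⟨_, r, ?_, fun b hb => ?_, fun b hb => ?_⟩
    · simp [BinOp.eval, Operand.eval, Dest.addr, val, n1, e2]
    · simp [Dest.addr, hb.ne, show b ≠ d + 1 by omega, l2 b (by omega), l1 b hb]
    · simp [Dest.addr, show b ≠ d by omega, show b ≠ d + 1 by omega, u2 b hb, u1 b hb]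

/-- As `off + I ≤ M`, the residue of an address modulo `M` determines the array and the quotient the
index. So a write changes one entry only, and it misses the cells `0` and `1`, which lie below
`off`. -/
theorem Represents.set (hL : Layout M off I B K Bd) {A : Store} {m : ℕ → ℕ}
    (hA : Represents M off I A m) (hK : 2 ≤ K) {c a : ℕ} (hc : c < I) (v : ℕ) :
    Represents M off I (A.set c a v) (Function.update m (a * M + off + c) v) := by
  have h1 := hL.scratch
  have h2 := hL.width
  refine ⟨by rw [Function.update_of_ne (by omega), hA.zero],
    by rw [Function.update_of_ne (by omega), hA.one], fun c' hc' a' => ?_⟩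
  by_cases h : a' = a ∧ c' = c
  · obtain ⟨rfl, rfl⟩ := h
    simp [Store.set]
  · have hne : a' * M + off + c' ≠ a * M + off + c := by
      intro heq
      have heq' : off + c' + M * a' = off + c + M * a := by linarith
      have hmod := congrArg (· % M) heq'
      simp only [Nat.add_mul_mod_self_left] at hmod
      rw [Nat.mod_eq_of_lt (by omega), Nat.mod_eq_of_lt (by omega)] at hmod
      have hcc : c' = c := by omega
      subst hcc
      have : M * a' = M * a := by omega
      exact h ⟨Nat.eq_of_mul_eq_mul_left (by omega) this, rfl⟩
    rw [Function.update_of_ne hne, hA.cell c' hc' a']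
    simp only [Store.set, Function.update_apply]
    by_cases h3 : c' = c
    · subst h3
      simp [show a' ≠ a from fun h4 => h ⟨h4, rfl⟩]
    · simp [h3]

/-- Correctness of the compilation of statements. -/
theorem Exec.reach (hL : Layout M off I B K Bd) (hI : 0 < I) (hK : 2 ≤ K) {s : Stmt}
    {A A' : Store} {t : ℕ} (h : Exec I B s A A' t) {m : ℕ → ℕ} {pc : ℕ} (hs : 2 + s.depth ≤ K)
    (hA : Represents M off I A m) (hm : ∀ b, m b ≤ Bd) (hcode : CodeAt prog pc (s.code pc)) :
    ∃ m', Reach prog Bd ⟨pc, m⟩ t ⟨pc + s.size, m'⟩ ∧ Represents M off I A' m' := by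
  induction h generalizing m pc with
  | skip A => exact ⟨m, Reach.refl hm, hA⟩
  | @store A c a v hc ha hv hcI =>
    simp only [Stmt.code, codeAt_append, Expr.code_length] at hcode
    simp only [Stmt.depth] at hs
    obtain ⟨m1, r1, v1, l1, u1⟩ := c.reach_code hL hI hA hc le_rfl (by omega) hm hcode.1
    have hA1 : Represents M off I A m1 :=
      hA.congr hL.scratch (l1 0 (by omega)) (l1 1 (by omega)) u1
    obtain ⟨m2, r2, v2, l2, u2⟩ := a.reach_code hL hI hA1 ha (by omega : 2 ≤ 3) (by omega)
      r1.bounded hcode.2.1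
    have hA2 : Represents M off I A m2 :=
      hA1.congr hL.scratch (l2 0 (by omega)) (l2 1 (by omega)) u2
    obtain ⟨m3, r3, v3, l3, u3⟩ := v.reach_code hL hI hA2 hv (by omega : 2 ≤ 4) (by omega)
      r2.bounded hcode.2.2.1
    have hA3 : Represents M off I A m3 :=
      hA2.congr hL.scratch (l3 0 (by omega)) (l3 1 (by omega)) u3
    have e1 : m3 2 = c.val A := by rw [l3 2 (by omega), l2 2 (by omega), v1]
    have e2 : m3 (2 + 1) = a.val A := by rw [l3 3 (by omega), v2]
    have r4 := reach_addressCode hL le_rfl hA3.zero hA3.one e1 e2 hcI ha.val_le r3.bounded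
      hcode.2.2.2.1
    have r5 := reach_compute (B := Bd) hcode.2.2.2.2.1 r4.bounded (by
      simpa [BinOp.eval, Operand.eval, v3] using hL.le_bound hI hv.val_le)
    have r := (((r1.trans r2).trans r3).trans r4).trans r5
    simp [BinOp.eval, Operand.eval, Dest.addr, v3] at r
    refine ⟨_, ?_, Represents.set hL (K := K) (m := Function.update m3 3
      (a.val A * M + off + c.val A)) ?_ hK hcI _⟩
    · simp only [Stmt.size]
      convert r using 2
      simp only [addressCode, List.length_cons, List.length_nil]; ring
    · have := v.depth_pos
      exact hA3.congr hL.scratch (by simp) (by simp) fun b hb => by simp [show b ≠ 3 by omega]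
  | @seq A A' A'' s s' t t' _ _ ih ih' =>
    simp only [Stmt.code, codeAt_append, Stmt.code_length] at hcode
    simp only [Stmt.depth] at hs
    obtain ⟨m1, r1, hA1⟩ := ih (by omega) hA hm hcode.1
    obtain ⟨m2, r2, hA2⟩ := ih' (by omega) hA1 r1.bounded hcode.2
    exact ⟨m2, by simpa [Stmt.size, add_assoc] using r1.trans r2, hA2⟩
  | @ifz_zero A A' e s s' t hok he _ ih =>
    simp only [Stmt.code, codeAt_append, Expr.code_length, codeAt_cons, Stmt.code_length] at hcode
    simp only [Stmt.depth] at hs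
    obtain ⟨m1, r1, v1, l1, u1⟩ := e.reach_code hL hI hA hok le_rfl (by omega) hm hcode.1
    have hA1 : Represents M off I A m1 :=
      hA.congr hL.scratch (l1 0 (by omega)) (l1 1 (by omega)) u1
    have r2 := reach_jumpIfZero hcode.2.1 r1.bounded
    simp only [Operand.eval, v1, he, if_true] at r2
    obtain ⟨m2, r3, hA2⟩ := ih (by omega) hA1 r1.bounded hcode.2.2.2.2
    refine ⟨m2, ?_, hA2⟩
    have r := (r1.trans r2).trans r3
    simp only [Stmt.size]
    convert r using 2; ring
  | @ifz_ne A A' e s s' t hok he _ ih =>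
    simp only [Stmt.code, codeAt_append, Expr.code_length, codeAt_cons, Stmt.code_length] at hcode
    simp only [Stmt.depth] at hs
    obtain ⟨m1, r1, v1, l1, u1⟩ := e.reach_code hL hI hA hok le_rfl (by omega) hm hcode.1
    have hA1 : Represents M off I A m1 :=
      hA.congr hL.scratch (l1 0 (by omega)) (l1 1 (by omega)) u1
    have r2 := reach_jumpIfZero hcode.2.1 r1.bounded
    simp only [Operand.eval, v1, he, if_false] at r2
    obtain ⟨m2, r3, hA2⟩ := ih (by omega) hA1 r1.bounded hcode.2.2.1
    have r4 := reach_jumpIfZero hcode.2.2.2.1 r3.bounded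
    simp only [Operand.eval, if_true] at r4
    refine ⟨m2, ?_, hA2⟩
    have r := (r1.trans r2).trans (r3.trans r4)
    simp only [Stmt.size]
    convert r using 2; ring
  | @loop_zero A e s hok he =>
    simp only [Stmt.code, codeAt_append, Expr.code_length, codeAt_cons, Stmt.code_length] at hcode
    simp only [Stmt.depth] at hs
    obtain ⟨m1, r1, v1, l1, u1⟩ := e.reach_code hL hI hA hok le_rfl (by omega) hm hcode.1
    have hA1 : Represents M off I A m1 :=
      hA.congr hL.scratch (l1 0 (by omega)) (l1 1 (by omega)) u1
    have r2 := reach_jumpIfZero hcode.2.1 r1.bounded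
    simp only [Operand.eval, v1, he, if_true] at r2
    refine ⟨m1, ?_, hA1⟩
    have r := r1.trans r2
    simp only [Stmt.size]
    convert r using 2; ring
  | @loop_ne A A' A'' e s t t' hok he _ _ ih ih' =>
    -- The remaining iterations start again at the same instruction number, with the same code.
    have hcode' := hcode
    simp only [Stmt.code, codeAt_append, Expr.code_length, codeAt_cons, Stmt.code_length] at hcode
    have hs' := hs
    simp only [Stmt.depth] at hs
    obtain ⟨m1, r1, v1, l1, u1⟩ := e.reach_code hL hI hA hok le_rfl (by omega) hm hcode.1
    have hA1 : Represents M off I A m1 :=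
      hA.congr hL.scratch (l1 0 (by omega)) (l1 1 (by omega)) u1
    have r2 := reach_jumpIfZero hcode.2.1 r1.bounded
    simp only [Operand.eval, v1, he, if_false] at r2
    obtain ⟨m2, r3, hA2⟩ := ih (by omega) hA1 r1.bounded hcode.2.2.1
    have r4 := reach_jumpIfZero hcode.2.2.2.1 r3.bounded
    simp only [Operand.eval, if_true] at r4
    obtain ⟨m3, r5, hA3⟩ := ih' hs' hA2 r4.bounded hcode'
    exact ⟨m3, (r1.trans r2).trans (r3.trans (r4.trans r5)), hA3⟩

end RAM

namespace RAM

/-! ### Moving the input, and compilation of a whole program -/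

section

variable {prog : Program} {B M off I K Bd : ℕ}

theorem reach_update {pc : ℕ} {m : ℕ → ℕ} {d : Dest} {o : BinOp} {x y : Operand} (a v : ℕ)
    (h : prog[pc]? = some (.compute d o x y)) (hm : ∀ b, m b ≤ B) (ha : d.addr m = a)
    (hv : o.eval (x.eval m) (y.eval m) = v) (hle : v ≤ B) :
    Reach prog B ⟨pc, m⟩ 1 ⟨pc + 1, Function.update m a v⟩ := by
  subst ha hv
  exact reach_compute h hm hle

/-- The memory on the input `x`. -/
def inputMem (x : List ℕ) (a : ℕ) : ℕ := (x.length :: x).getD a 0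

@[simp] theorem inputMem_zero (x : List ℕ) : inputMem x 0 = x.length := rfl

theorem inputMem_of_gt {x : List ℕ} {a : ℕ} (h : x.length < a) : inputMem x a = 0 := by
  unfold inputMem
  rw [List.getD_eq_default]
  simpa using h

theorem le_foldr_max {x : List ℕ} {a : ℕ} (h : a ∈ x) : a ≤ x.foldr max 0 := by
  induction x with
  | nil => simp at h
  | cons b x ih =>
    rcases List.mem_cons.1 h with rfl | h
    · simp
    · exact (ih h).trans (by simp)

theorem le_wordRange {x : List ℕ} {a : ℕ} (h : a ∈ x) : a ≤ wordRange x :=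
  (le_foldr_max h).trans (le_max_right _ _)

theorem length_le_wordRange (x : List ℕ) : x.length ≤ wordRange x := le_max_left _ _

theorem inputMem_le (x : List ℕ) (a : ℕ) : inputMem x a ≤ wordRange x := by
  cases a with
  | zero => exact le_max_left _ _
  | succ a =>
    simp only [inputMem, List.getD_cons_succ]
    by_cases h : a < x.length
    · rw [List.getD_eq_getElem _ _ h]
      exact le_wordRange (List.getElem_mem h)
    · rw [List.getD_eq_default _ _ (by omega)]
      exact Nat.zero_le _

/-- Copy the cells `i + 1, …, i + k` behind the address in cell `0`. -/
def saveCode : ℕ → ℕ → List Instr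
  | _, 0 => []
  | i, k + 1 =>
      .compute (.direct 0) .add (.direct 0) (.const 1) ::
      .compute (.indirect 0) .add (.direct (i + 1)) (.const 0) :: saveCode (i + 1) k

theorem saveCode_length (i k : ℕ) : (saveCode i k).length = 2 * k := by
  induction k generalizing i with
  | zero => rfl
  | succ k ih => simp [saveCode, ih]; ring

/-- The memory after the first cells `0, …, i` were copied to the addresses `n + K, …`. -/
def savedMem (x : List ℕ) (K i b : ℕ) : ℕ :=
  if b = 0 then x.length + K + i
  else if x.length + K ≤ b ∧ b ≤ x.length + K + i then inputMem x (b - (x.length + K))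
  else inputMem x b

theorem reach_saveCode (x : List ℕ) (hBd : x.length + 2 * K ≤ Bd) (hx : wordRange x ≤ Bd)
    {i k : ℕ} (hik : i + k = K) {pc : ℕ} (hm : ∀ b, savedMem x K i b ≤ Bd)
    (hcode : CodeAt prog pc (saveCode i k)) :
    Reach prog Bd ⟨pc, savedMem x K i⟩ (2 * k) ⟨pc + 2 * k, savedMem x K K⟩ := by
  induction k generalizing i pc with
  | zero =>
    obtain rfl : i = K := by omega
    exact Reach.refl hm
  | succ k ih =>
    obtain ⟨e1, e2, e3⟩ := hcode
    have r1 := reach_update (B := Bd) 0 (x.length + K + i + 1) e1 hm rfl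
      (by simp [BinOp.eval, Operand.eval, savedMem]) (by omega)
    have r2 := reach_update (B := Bd) (x.length + K + i + 1) (inputMem x (i + 1)) e2 r1.bounded
      (by simp [Dest.addr]) (by
        simp only [BinOp.eval, Operand.eval]
        rw [Function.update_of_ne (by omega)]
        rw [savedMem, if_neg (by omega), add_zero]
        -- The source cell has been overwritten by a saved copy only if the input is empty and `i +
        -- 1 = K`; then both contents are `0`.
        split_ifs with hc
        · rw [show i + 1 - (x.length + K) = 0 by omega, inputMem_zero,
            inputMem_of_gt (by omega)]
          omega
        · rfl) ((inputMem_le _ _).trans hx)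
    have e : Function.update (Function.update (savedMem x K i) 0 (x.length + K + i + 1))
        (x.length + K + i + 1) (inputMem x (i + 1)) = savedMem x K (i + 1) := by
      funext b
      by_cases h1 : b = x.length + K + i + 1
      · subst h1
        simp only [Function.update_self, savedMem]
        rw [if_neg (by omega), if_pos (by omega)]
        congr 1; omega
      · rw [Function.update_of_ne h1]
        by_cases h0 : b = 0
        · subst h0; simp [savedMem]; ring
        · rw [Function.update_of_ne h0]
          simp only [savedMem, if_neg h0]
          by_cases h2 : x.length + K ≤ b ∧ b ≤ x.length + K + i
          · rw [if_pos h2, if_pos (by omega)]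
          · rw [if_neg h2, if_neg (by omega)]
    simp only [] at r2
    rw [e] at r2
    have r3 := ih (by omega) r2.bounded e3
    have r := (r1.trans r2).trans r3
    rw [show 1 + 1 + 2 * k = 2 * (k + 1) by ring,
      show pc + 1 + 1 + 2 * k = pc + 2 * (k + 1) by ring] at r
    exact r

/-- Compute the parameters of the memory layout. -/
def layoutCode (K : ℕ) : List Instr :=
  [.compute (.direct 1) .add (.direct 0) (.const 1),
   .compute (.direct 2) .mul (.direct 1) (.direct 1),
   .compute (.direct 2) .mul (.direct 2) (.direct 1),
   .compute (.direct 2) .add (.direct 2) (.direct 1),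
   .compute (.direct 3) .sub (.direct 1) (.const (K + 1)),
   .compute (.direct 0) .add (.direct 2) (.const 0),
   .compute (.direct 2) .sub (.direct 3) (.const (K - 1))]

/-- `off` is the first cell behind the saved copies. `M` is cubic in `off` so that it has room for
cubically many arrays besides the first `off` cells. -/
theorem reach_layoutCode {n K : ℕ} (hK : 7 ≤ K) {m : ℕ → ℕ} (h0 : m 0 = n + 2 * K) {pc : ℕ}
    (hoff : n + 2 * K + 1 = off) (hM : off * off * off + off = M) (hMB : M ≤ Bd)
    (hm : ∀ b, m b ≤ Bd) (hcode : CodeAt prog pc (layoutCode K)) :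
    ∃ m', Reach prog Bd ⟨pc, m⟩ 7 ⟨pc + 7, m'⟩ ∧ m' 0 = M ∧ m' 1 = off ∧ m' 2 = n + 1 ∧
      m' 3 = n + K ∧ ∀ b, K ≤ b → m' b = m b := by
  have h1 : 1 ≤ off := by omega
  have h2 : off * off ≤ off * off * off := Nat.le_mul_of_pos_right _ h1
  obtain ⟨e1, e2, e3, e4, e5, e6, e7, -⟩ := hcode
  have r1 := reach_update (B := Bd) 1 off e1 hm rfl
    (by simp [BinOp.eval, Operand.eval, h0, hoff]) (by omega)
  have r2 := reach_update (B := Bd) 2 (off * off) e2 r1.bounded rfl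
    (by simp [BinOp.eval, Operand.eval]) (by omega)
  have r3 := reach_update (B := Bd) 2 (off * off * off) e3 r2.bounded rfl
    (by simp [BinOp.eval, Operand.eval]) (by omega)
  have r4 := reach_update (B := Bd) 2 M e4 r3.bounded rfl
    (by simp [BinOp.eval, Operand.eval, hM]) (by omega)
  have r5 := reach_update (B := Bd) 3 (n + K) e5 r4.bounded rfl
    (by simp [BinOp.eval, Operand.eval]; omega) (by omega)
  have r6 := reach_update (B := Bd) 0 M e6 r5.bounded rfl
    (by simp [BinOp.eval, Operand.eval]) (by omega)
  have r7 := reach_update (B := Bd) 2 (n + 1) e7 r6.bounded rfl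
    (by simp [BinOp.eval, Operand.eval]; omega) (by omega)
  refine ⟨_, (((((r1.trans r2).trans r3).trans r4).trans r5).trans r6).trans r7, by simp, by simp,
    by simp, by simp, fun b hb => ?_⟩
  simp [show b ≠ 0 by omega, show b ≠ 1 by omega, show b ≠ 2 by omega, show b ≠ 3 by omega]

/-- Copy the input to the array `0`, for the number of remaining cells in cell `2`. -/
def copyCode (K pc : ℕ) : List Instr :=
  [.jumpIfZero (.direct 2) (pc + 10),
   .compute (.direct 2) .sub (.direct 2) (.const 1),
   .compute (.direct 4) .mul (.direct 2) (.direct 0),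
   .compute (.direct 4) .add (.direct 4) (.direct 1),
   -- Source address without branching: `1 - (i - K)` is one for `i ≤ K`, where the saved copy at `n
   -- + K + i` must be read, and zero for `i > K`, where cell `i` is intact.
   .compute (.direct 5) .sub (.direct 2) (.const K),
   .compute (.direct 5) .sub (.const 1) (.direct 5),
   .compute (.direct 5) .mul (.direct 5) (.direct 3),
   .compute (.direct 5) .add (.direct 5) (.direct 2),
   .compute (.indirect 4) .add (.indirect 5) (.const 0),
   .jumpIfZero (.const 0) pc]

/-- The input from the index `i` on, in the array `0`. -/
def partialInputStore (x : List ℕ) (i : ℕ) : Store :=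
  fun c a => if c = 0 ∧ i ≤ a then inputMem x a else 0

/-- The input in the array `0`. -/
def inputStore (x : List ℕ) : Store := fun c a => if c = 0 then inputMem x a else 0

theorem partialInputStore_zero (x : List ℕ) : partialInputStore x 0 = inputStore x := by
  funext c a; simp [partialInputStore, inputStore]

theorem partialInputStore_set (x : List ℕ) (i : ℕ) :
    (partialInputStore x (i + 1)).set 0 i (inputMem x i) = partialInputStore x i := by
  funext c a
  by_cases hc : c = 0
  · subst hc
    by_cases ha : a = i
    · subst ha; simp [Store.set, partialInputStore]
    · simp only [Store.set, partialInputStore, Function.update_self, Function.update_of_ne ha]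
      congr 1
      simp only [eq_iff_iff, true_and]; omega
  · simp [Store.set, partialInputStore, hc]

/-- No unread word is destroyed: all sources lie from `K` up to `off - 1`, while writes go to
scratch cells below `K` or to array cells from `off` on. -/
theorem reach_copyCode (hL : Layout M off I B K Bd) (hI : 0 < I) (hK : 7 ≤ K) {x : List ℕ}
    (hoff : x.length + 2 * K + 1 = off) (hxB : wordRange x ≤ B) {pc : ℕ}
    (hcode : CodeAt prog pc (copyCode K pc)) {i : ℕ} {m : ℕ → ℕ}
    (hA : Represents M off I (partialInputStore x i) m) (h2 : m 2 = i) (h3 : m 3 = x.length + K)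
    (hi : i ≤ x.length + 1) (hs : ∀ b, K ≤ b → b < off → m b = savedMem x K K b)
    (hm : ∀ b, m b ≤ Bd) :
    ∃ m', Reach prog Bd ⟨pc, m⟩ (10 * i + 1) ⟨pc + 10, m'⟩ ∧
      Represents M off I (inputStore x) m' := by
  induction i generalizing m with
  | zero =>
    obtain ⟨e1, -⟩ := hcode
    have r1 := reach_jumpIfZero e1 hm
    simp only [Operand.eval, h2, if_true] at r1
    exact ⟨m, r1, partialInputStore_zero x ▸ hA⟩
  | succ i ih =>
    have hcode' := hcode
    obtain ⟨e1, e2, e3, e4, e5, e6, e7, e8, e9, e10, -⟩ := hcode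
    have hw := hL.width
    have hlen := length_le_wordRange x
    have hle := address_le hL (a := i) (by omega) hI
    have hMBd : M ≤ Bd := by
      have := hL.bound
      have h5 : 1 * M ≤ (B + 1) * M := Nat.mul_le_mul_right _ (by omega)
      omega
    have r1 := reach_jumpIfZero e1 hm
    simp only [Operand.eval, h2, Nat.succ_ne_zero, if_false] at r1
    have r2 := reach_update (B := Bd) 2 i e2 r1.bounded rfl
      (by simp [BinOp.eval, Operand.eval, h2]) (by omega)
    have r3 := reach_update (B := Bd) 4 (i * M) e3 r2.bounded rfl
      (by simp [BinOp.eval, Operand.eval, hA.zero]) (by omega)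
    have r4 := reach_update (B := Bd) 4 (i * M + off) e4 r3.bounded rfl
      (by simp [BinOp.eval, Operand.eval, hA.one]) (by omega)
    have r5 := reach_update (B := Bd) 5 (i - K) e5 r4.bounded rfl
      (by simp [BinOp.eval, Operand.eval]) (by omega)
    have r6 := reach_update (B := Bd) 5 (1 - (i - K)) e6 r5.bounded rfl
      (by simp [BinOp.eval, Operand.eval]) (by omega)
    have hsrc : (1 - (i - K)) * (x.length + K) = if i ≤ K then x.length + K else 0 := by
      split_ifs with h
      · rw [show 1 - (i - K) = 1 by omega, one_mul]
      · rw [show 1 - (i - K) = 0 by omega, zero_mul]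
    have hsrc' : (1 - (i - K)) * (x.length + K) ≤ x.length + K := by
      rw [hsrc]; split_ifs <;> omega
    have r7 := reach_update (B := Bd) 5 ((1 - (i - K)) * (x.length + K)) e7 r6.bounded rfl
      (by simp [BinOp.eval, Operand.eval, h3]) (by omega)
    have r8 := reach_update (B := Bd) 5 ((1 - (i - K)) * (x.length + K) + i) e8 r7.bounded rfl
      (by simp [BinOp.eval, Operand.eval]) (by split_ifs at hsrc <;> omega)
    -- The boundary value `K` occurs only for the empty input, whose saved cell `0` sits at address
    -- `K`.
    have hrange : K < (1 - (i - K)) * (x.length + K) + i ∧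
        (1 - (i - K)) * (x.length + K) + i < off ∨
        (1 - (i - K)) * (x.length + K) + i = K ∧ x.length = 0 := by
      rw [hsrc]; split_ifs <;> omega
    have hval : m ((1 - (i - K)) * (x.length + K) + i) = inputMem x i := by
      rw [hs _ (by omega) (by omega), savedMem, if_neg (by omega), hsrc]
      by_cases h : i ≤ K
      · rw [if_pos h, if_pos (by omega)]
        congr 1; omega
      · rw [if_neg h]
        by_cases h' : x.length + K ≤ 0 + i ∧ 0 + i ≤ x.length + K + K
        · omega
        · rw [if_neg h', zero_add]
    have r9 := reach_update (B := Bd) (i * M + off) (inputMem x i) e9 r8.bounded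
      (by simp [Dest.addr])
      (by
        simp only [BinOp.eval, Operand.eval, Function.update_self]
        have : 7 ≤ (1 - (i - K)) * (x.length + K) + i := by omega
        rw [Function.update_of_ne (by omega), Function.update_of_ne (by omega),
          Function.update_of_ne (by omega), Function.update_of_ne (by omega),
          Function.update_of_ne (by omega), Function.update_of_ne (by omega),
          Function.update_of_ne (by omega), hval, add_zero])
      (hL.le_bound hI ((inputMem_le _ _).trans hxB))
    have r10 := reach_jumpIfZero e10 r9.bounded
    simp only [Operand.eval, if_true] at r10
    have hoffK := hL.scratch
    have hbig : 7 ≤ i * M + off := by omega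
    obtain ⟨m', r, hA'⟩ := ih (m := Function.update (Function.update (Function.update
        (Function.update (Function.update (Function.update (Function.update (Function.update m
          2 i) 4 (i * M)) 4 (i * M + off)) 5 (i - K)) 5 (1 - (i - K))) 5
          ((1 - (i - K)) * (x.length + K))) 5 ((1 - (i - K)) * (x.length + K) + i))
          (i * M + off) (inputMem x i))
      (by
        rw [← partialInputStore_set]
        refine Represents.set (c := 0) hL (hA.congr hL.scratch (by simp) (by simp)
          fun b hb => ?_) (by omega) hI _
        simp [show b ≠ 2 by omega, show b ≠ 4 by omega, show b ≠ 5 by omega])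
      (by rw [Function.update_of_ne (by omega)]; simp)
      (by rw [Function.update_of_ne (by omega)]; simp [h3])
      (by omega)
      (fun b hb hb' => by
        rw [Function.update_of_ne (by omega), ← hs b hb hb']
        simp [show b ≠ 2 by omega, show b ≠ 4 by omega, show b ≠ 5 by omega])
      r10.bounded
    refine ⟨m', ?_, hA'⟩
    have r' := (((((((((r1.trans r2).trans r3).trans r4).trans r5).trans r6).trans r7).trans
      r8).trans r9).trans r10).trans r
    rwa [show 1 + 1 + 1 + 1 + 1 + 1 + 1 + 1 + 1 + 1 + (10 * i + 1) = 10 * (i + 1) + 1 by ring] at r'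

/-- Move the input out of the scratch cells into the array `0`. -/
def prelude (K : ℕ) : List Instr :=
  .compute (.direct 0) .add (.direct 0) (.const K) ::
  .compute (.indirect 0) .sub (.direct 0) (.const K) ::
  (saveCode 0 K ++ (layoutCode K ++ copyCode K (2 * K + 9)))

theorem prelude_length (K : ℕ) : (prelude K).length = 2 * K + 19 := by
  simp [prelude, saveCode_length, layoutCode, copyCode]

theorem reach_prelude (hK : 7 ≤ K) {x : List ℕ} (hoff : x.length + 2 * K + 1 = off)
    (hM : off * off * off + off = M) (hL : Layout M off I B K Bd) (hI : 0 < I)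
    (hxB : wordRange x ≤ B) (hcode : CodeAt prog 0 (prelude K)) :
    ∃ m', Reach prog Bd (initial x) (2 * K + 20 + 10 * x.length) ⟨2 * K + 19, m'⟩ ∧
      Represents M off I (inputStore x) m' := by
  simp only [prelude, codeAt_cons, codeAt_append, saveCode_length] at hcode
  obtain ⟨e1, e2, e3, e4, e5⟩ := hcode
  have hxBd : wordRange x ≤ Bd := hL.le_bound hI hxB
  have hMBd : M ≤ Bd := by
    have := hL.bound
    have h5 : 1 * M ≤ (B + 1) * M := Nat.mul_le_mul_right _ (by omega)
    omega
  have r1 := reach_update (B := Bd) 0 (x.length + K) e1 (m := inputMem x)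
    (fun b => (inputMem_le x b).trans hxBd) rfl (by simp [BinOp.eval, Operand.eval]) (by omega)
  -- Cell `0` is both the write pointer and a record of the input length, which is recovered by
  -- subtracting `K`.
  have r2 := reach_update (B := Bd) (x.length + K) x.length e2 r1.bounded (by simp [Dest.addr])
    (by simp [BinOp.eval, Operand.eval]) (by omega)
  have e : Function.update (Function.update (inputMem x) 0 (x.length + K)) (x.length + K)
      x.length = savedMem x K 0 := by
    funext b
    by_cases h1 : b = x.length + K
    · subst h1
      simp only [Function.update_self, savedMem]
      rw [if_neg (by omega), if_pos (by omega), Nat.sub_self, inputMem_zero]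
    · rw [Function.update_of_ne h1]
      by_cases h0 : b = 0
      · subst h0; simp [savedMem]
      · rw [Function.update_of_ne h0, savedMem, if_neg h0, if_neg (by omega)]
  simp only [] at r2
  rw [e] at r2
  have r3 := reach_saveCode x (by omega) hxBd (zero_add K) r2.bounded e3
  obtain ⟨m4, r4, z0, z1, z2, z3, zK⟩ := reach_layoutCode (n := x.length) hK
    (by simp [savedMem]; ring) hoff hM hMBd r3.bounded e4
  -- Everything behind the saved copies is still zero, so all arrays start out empty.
  have hx0 : ∀ b, off ≤ b → savedMem x K K b = 0 := fun b hb => by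
    rw [savedMem, if_neg (by omega), if_neg (by omega), inputMem_of_gt (by omega)]
  have hscr := hL.scratch
  have hrep : Represents M off I (partialInputStore x (x.length + 1)) m4 := by
    refine ⟨z0, z1, fun c hc a => ?_⟩
    rw [zK _ (by omega), partialInputStore]
    refine (hx0 _ (by omega)).trans ?_
    split_ifs with h
    · rw [inputMem_of_gt (by omega)]
    · rfl
  rw [show 0 + 1 + 1 + 2 * K + (layoutCode K).length = 2 * K + 9 by simp [layoutCode]; ring] at e5
  rw [show 0 + 1 + 1 + 2 * K + 7 = 2 * K + 9 by ring] at r4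
  obtain ⟨m5, r5, hA⟩ := reach_copyCode hL hI hK hoff hxB e5 hrep z2 z3 le_rfl
    (fun b hb _ => zK b hb) r4.bounded
  refine ⟨m5, ?_, hA⟩
  have r := (((r1.trans r2).trans r3).trans r4).trans r5
  rw [show 1 + 1 + 2 * K + 7 + (10 * (x.length + 1) + 1) = 2 * K + 20 + 10 * x.length by ring] at r
  exact r

end

/-- Turns constants that depend on a program only into powers of `n + 2`, the admissible form of a
word bound. -/
theorem le_pow_add_two (n c : ℕ) : c ≤ (n + 2) ^ c :=
  (Nat.lt_two_pow_self).le.trans (Nat.pow_le_pow_left (by omega) c)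

theorem length_le_inputSize (x : List ℕ) : x.length ≤ inputSize x := by
  induction x with
  | nil => simp [inputSize]
  | cons a x ih =>
    simp only [inputSize, List.map_cons, List.sum_cons, List.length_cons] at ih ⊢
    omega

/-- A problem is decidable in polynomial time if a statement of the structured language, followed
by the evaluation of an expression, decides it. -/
theorem polyTimeDecidable_of_exec {J : Type*} {enc : J → List ℕ} {P : J → Prop} (s : Stmt)
    (out : Expr) (time : Polynomial ℕ) (d : ℕ)
    (h : ∀ a, ∃ A' t B, Exec ((enc a).length + 5 |>.pow 3) B s (inputStore (enc a)) A' t ∧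
      out.Ok ((enc a).length + 5 |>.pow 3) B A' ∧ (P a → out.val A' = 1) ∧
      (¬ P a → out.val A' = 0) ∧ t ≤ time.eval (inputSize (enc a)) ∧
      wordRange (enc a) ≤ B ∧ B ≤ (wordRange (enc a) + 2) ^ d) :
    PolyTimeDecidable enc P := by
  obtain ⟨K, hK7, hKs, hKo⟩ : ∃ K, 7 ≤ K ∧ 2 + s.depth ≤ K ∧ 2 + out.depth ≤ K :=
    ⟨s.depth + out.depth + 9, by omega, by omega, by omega⟩
  set code : Program := prelude K ++ (s.code (2 * K + 19) ++ (out.code 2 ++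
    [.compute (.direct 0) .add (.direct 2) (.const 0)])) with hcode
  -- The prelude takes `2K + 20 + 10n` steps and the final move one. In the exponent, `d + 1`
  -- accounts for `B + 1` and `(2K + 3) * 3 + 1` for `M ≤ 2 * off ^ 3`.
  refine ⟨code, .C (2 * K + 21 + out.cost) + .C 10 * .X + time,
    (d + 1) + ((2 * K + 3) * 3 + 1), fun a => ?_⟩
  obtain ⟨A', t, B, hex, hok, hP, hnP, ht, hxB, hBd⟩ := h a
  set x := enc a
  set n := wordRange x
  have hn := length_le_wordRange x
  obtain ⟨off, hoff⟩ : ∃ off, x.length + 2 * K + 1 = off := ⟨_, rfl⟩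
  obtain ⟨M, hM⟩ : ∃ M, off * off * off + off = M := ⟨_, rfl⟩
  have hI : 0 < (x.length + 5).pow 3 := Nat.pow_pos (by omega)
  have hoffle : off ≤ (n + 2) ^ (2 * K + 3) := by
    calc off ≤ (2 * K + 2) * (n + 2) := by nlinarith
      _ ≤ (n + 2) ^ (2 * K + 2) * (n + 2) := Nat.mul_le_mul_right _ (le_pow_add_two _ _)
      _ = _ := by ring
  have hMle : M ≤ (n + 2) ^ ((2 * K + 3) * 3 + 1) := by
    have h1 : off ≤ off * off * off := by nlinarith [Nat.zero_le off, Nat.le_mul_self off]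
    calc M ≤ off ^ 3 * 2 := by rw [← hM]; linarith [show off ^ 3 = off * off * off by ring]
      _ ≤ ((n + 2) ^ (2 * K + 3)) ^ 3 * (n + 2) :=
        Nat.mul_le_mul (Nat.pow_le_pow_left hoffle 3) (by omega)
      _ = _ := by rw [← pow_mul, pow_succ]
  have hL : Layout M off ((x.length + 5).pow 3) B K ((n + 2) ^ ((d + 1) + ((2 * K + 3) * 3 + 1))) := by
    refine ⟨by omega, ?_, ?_⟩
    · have : (x.length + 5).pow 3 ≤ off ^ 3 := Nat.pow_le_pow_left (by omega) 3
      have h3 : off ^ 3 = off * off * off := by ring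
      omega
    · rw [pow_add]
      refine Nat.mul_le_mul ?_ hMle
      have h1 : 1 ≤ (n + 2) ^ d := Nat.pow_pos (by omega)
      rw [pow_succ]
      nlinarith
  have hc := codeAt_self code
  rw [hcode] at hc
  simp only [codeAt_append, prelude_length, Stmt.code_length, Expr.code_length, zero_add] at hc
  rw [← hcode] at hc
  obtain ⟨c1, c2, c3, c4, -⟩ := hc
  obtain ⟨m1, r1, hA1⟩ := reach_prelude hK7 hoff hM hL hI hxB c1
  obtain ⟨m2, r2, hA2⟩ := hex.reach hL hI (by omega) hKs hA1 r1.bounded c2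
  obtain ⟨m3, r3, v3, -⟩ := out.reach_code hL hI hA2 hok le_rfl hKo r2.bounded c3
  have r4 := reach_update _ _ c4 r3.bounded rfl rfl
    (by simpa [BinOp.eval, Operand.eval, v3] using hL.le_bound hI hok.val_le)
  have r := ((r1.trans r2).trans r3).trans r4
  have hv : (run code x (2 * K + 20 + 10 * x.length + t + out.cost + 1)).mem 0 = out.val A' := by
    rw [run, r.1]
    simp [Dest.addr, BinOp.eval, Operand.eval, v3]
  refine ⟨_, ?_, ?_, fun h => hv.trans (hP h), fun h => hv.trans (hnP h), fun s hs b => r.2 s hs b⟩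
  · have := length_le_inputSize x
    simp only [Polynomial.eval_add, Polynomial.eval_mul, Polynomial.eval_C, Polynomial.eval_X]
    omega
  · rw [run, r.1]
    simp [hcode, prelude_length, Stmt.code_length, Expr.code_length]
    omega

end RAM

namespace RAM

/-! ### Bounds for expressions -/

section

variable {I B : ℕ}

/-- Only arithmetic operations, and only constants up to `k`. -/
def Expr.Tame (k : ℕ) : Expr → Prop
  | .const n => n ≤ k
  | .bin .add x y | .bin .sub x y | .bin .mul x y | .bin .div x y | .bin .mod x y =>
      x.Tame k ∧ y.Tame k
  | .bin _ _ _ => False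
  | .load c a => c.Tame k ∧ a.Tame k

/-- All accessed arrays have numbers below `I`. -/
def Expr.ArraysLt (I : ℕ) (A : Store) : Expr → Prop
  | .const _ => True
  | .bin _ x y => x.ArraysLt I A ∧ y.ArraysLt I A
  | .load c a => c.ArraysLt I A ∧ a.ArraysLt I A ∧ c.val A < I

/-- The exponent in the bound on the values of an expression. -/
def Expr.width : Expr → ℕ
  | .const _ => 1
  | .bin _ x y => x.width + y.width
  | .load c a => max c.width a.width

theorem Expr.width_pos (e : Expr) : 1 ≤ e.width := by
  induction e with
  | const n => exact le_rfl
  | bin o x y hx hy => exact hx.trans (Nat.le_add_right _ _)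
  | load c a hc ha => exact hc.trans (le_max_left _ _)

/-- Exponents add under multiplication. The sum of two bounds is at most their product because both
are at least `2`, so the same exponent serves for all operations. It depends on the expression only,
not on the input. -/
theorem Expr.Tame.val_le {k V : ℕ} {A : Store} (hA : ∀ c a, A c a ≤ V) (hV : 2 ≤ V) (hk : k ≤ V)
    {e : Expr} (he : e.Tame k) : e.val A ≤ V ^ e.width := by
  induction e with
  | const n => simpa [val, width] using (show n ≤ k from he).trans hk
  | load c a hc ha => exact (hA _ _).trans (Nat.le_self_pow (Nat.ne_of_gt (width_pos (.load c a))) V)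
  | bin o x y hx hy =>
    have h1 : 2 ≤ V ^ x.width := hV.trans (Nat.le_self_pow (Nat.ne_of_gt x.width_pos) V)
    have h2 : 2 ≤ V ^ y.width := hV.trans (Nat.le_self_pow (Nat.ne_of_gt y.width_pos) V)
    simp only [val, width, pow_add]
    cases o with
    | add => have := hx he.1; have := hy he.2; simp only [BinOp.eval]; nlinarith
    | mul => exact Nat.mul_le_mul (hx he.1) (hy he.2)
    | sub => have := hx he.1; exact (Nat.sub_le _ _).trans (by nlinarith)
    | div => have := hx he.1; exact (Nat.div_le_self _ _).trans (by nlinarith)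
    | mod => have := hx he.1; exact (Nat.mod_le _ _).trans (by nlinarith)
    | land | lor | xor | shiftLeft | shiftRight => exact he.elim

theorem Expr.Tame.ok {k V : ℕ} {A : Store} (hA : ∀ c a, A c a ≤ V) (hV : 2 ≤ V) (hk : k ≤ V)
    {e : Expr} (he : e.Tame k) (hI : e.ArraysLt I A) (hB : V ^ e.width ≤ B) : e.Ok I B A := by
  have hV' : 1 ≤ V := by omega
  induction e with
  | const n => exact (he.val_le hA hV hk).trans hB
  | load c a hc ha =>
    exact ⟨hc he.1 hI.1 ((Nat.pow_le_pow_right hV' (le_max_left _ _)).trans hB),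
      ha he.2 hI.2.1 ((Nat.pow_le_pow_right hV' (le_max_right _ _)).trans hB), hI.2.2,
      (he.val_le hA hV hk).trans hB⟩
  | bin o x y hx hy =>
    have h1 := (Nat.pow_le_pow_right hV' (Nat.le_add_right x.width y.width)).trans hB
    have h2 := (Nat.pow_le_pow_right hV' (Nat.le_add_left y.width x.width)).trans hB
    refine ⟨?_, ?_, (he.val_le hA hV hk).trans hB⟩ <;>
    cases o <;> first | exact he.elim | exact hx he.1 hI.1 h1 | exact hy he.2 hI.2 h2

/-! ### Running times of statements without loops -/

/-- One simulated machine step is loop-free, so its time is bounded by its code length whatever the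
store is. -/
def Stmt.LoopFree : Stmt → Prop
  | .skip | .store _ _ _ => True
  | .seq s s' | .ifz _ s s' => s.LoopFree ∧ s'.LoopFree
  | .loop _ _ => False

theorem Exec.time_le {s : Stmt} {A A' : Store} {t : ℕ} (h : Exec I B s A A' t)
    (hs : s.LoopFree) : t ≤ s.size := by
  induction h with
  | skip | store => exact le_rfl
  | seq _ _ ih ih' => exact Nat.add_le_add (ih hs.1) (ih' hs.2)
  | ifz_zero _ _ _ ih => have := ih hs.1; simp only [Stmt.size]; omega
  | ifz_ne _ _ _ ih => have := ih hs.2; simp only [Stmt.size]; omega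
  | loop_zero | loop_ne => exact hs.elim

/-! ### Variables and loops that fill an array -/

/-- The variable number `r`, kept in the array `1`. -/
def Expr.var (r : ℕ) : Expr := .load (.const 1) (.const r)

/-- Assignment to a variable. -/
def Stmt.assign (r : ℕ) (e : Expr) : Stmt := .store (.const 1) (.const r) e

@[simp] theorem Expr.val_var (A : Store) (r : ℕ) : (Expr.var r).val A = A 1 r := rfl

theorem Expr.ok_var {A : Store} {r : ℕ} (hI : 1 < I) (hB : 1 ≤ B) (hr : r ≤ B)
    (h : A 1 r ≤ B) : (Expr.var r).Ok I B A := ⟨hB, hr, hI, h⟩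

theorem Exec.assign {A : Store} {r : ℕ} {e : Expr} (hI : 1 < I) (hB : 1 ≤ B) (hr : r ≤ B)
    (he : e.Ok I B A) :
    Exec I B (.assign r e) A (A.set 1 r (e.val A)) (e.cost + 6) := by
  have h := Exec.store (I := I) (B := B) (A := A) (c := .const 1) (a := .const r) (v := e)
    hB hr he hI
  simp only [Expr.cost, Expr.val] at h
  rwa [show 1 + 1 + e.cost + 4 = e.cost + 6 by ring] at h

/-- Let the variable `0` run from `0` to the value of `n` minus one, and write the value of `e` to
the array numbered by the value of `c`, at the index in the variable `0`. -/
def Stmt.fill (c n e : Expr) : Stmt :=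
  .seq (.assign 1 n) (.seq (.assign 0 (.const 0))
    (.loop (.bin .sub (.var 1) (.var 0))
      (.seq (.store c (.var 0) e) (.assign 0 (.bin .add (.var 0) (.const 1))))))

/-- The store `A'` results from `A` by writing the first `t` values of `f` to the array `c`, where
`t` and `n` are also kept in the variables `0` and `1`. -/
structure Filled (A : Store) (c : ℕ) (f : ℕ → ℕ) (n t : ℕ) (A' : Store) : Prop where
  counter : A' 1 0 = t
  count : A' 1 1 = n
  var : ∀ r, 2 ≤ r → A' 1 r = A 1 r
  lt : ∀ a < t, A' c a = f a
  ge : ∀ a, t ≤ a → A' c a = A c a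
  other : ∀ c', c' ≠ 1 → c' ≠ c → A' c' = A c'

theorem Filled.le {A A' : Store} {c n t V : ℕ} {f : ℕ → ℕ} (h : Filled A c f n t A')
    (ht : t ≤ n) (hn : n ≤ V) (hA : ∀ c a, A c a ≤ V) (hf : ∀ a < t, f a ≤ V) (c' a : ℕ) :
    A' c' a ≤ V := by
  by_cases hc : c' = c
  · subst hc
    rcases lt_or_ge a t with hat | hat
    · rw [h.lt a hat]; exact hf a hat
    · rw [h.ge a hat]; exact hA _ _
  by_cases h1 : c' = 1
  · subst h1
    match a with
    | 0 => rw [h.counter]; omega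
    | 1 => rw [h.count]; omega
    | r + 2 => rw [h.var _ (by omega)]; exact hA _ _
  · rw [h.other c' h1 hc]; exact hA _ _

theorem Store.set_same (A : Store) (c a v : ℕ) : A.set c a v c a = v := by simp [Store.set]

theorem Store.set_array_ne (A : Store) {c c' : ℕ} (a v : ℕ) (h : c' ≠ c) :
    A.set c a v c' = A c' := by simp [Store.set, h]

theorem Store.set_index_ne (A : Store) (c : ℕ) {a a' : ℕ} (v : ℕ) (h : a' ≠ a) :
    A.set c a v c a' = A c a' := by simp [Store.set, h]

theorem Store.set_le {A : Store} {V : ℕ} (h : ∀ c a, A c a ≤ V) (c a : ℕ) {v : ℕ} (hv : v ≤ V)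
    (c' a' : ℕ) : A.set c a v c' a' ≤ V := by
  unfold Store.set
  by_cases hc : c' = c
  · subst hc
    simpa using update_le (h c') a hv a'
  · simpa [hc] using h c' a'

/-- Induction on the number `k` of missing entries. The hypotheses on `cE` and `e` range over all
partially filled stores, so that `e` may read the entries written so far; `c ≠ 1` keeps the loop
from overwriting the variables. -/
theorem Exec.fill_loop {A : Store} {c : ℕ} {f : ℕ → ℕ} {n : ℕ} {cE e : Expr} (hI : 1 < I)
    (hnB : n + 1 ≤ B) (hcI : c < I) (hc1 : c ≠ 1)
    (hc : ∀ t < n, ∀ A', Filled A c f n t A' → cE.Ok I B A' ∧ cE.val A' = c)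
    (he : ∀ t < n, ∀ A', Filled A c f n t A' → e.Ok I B A' ∧ e.val A' = f t)
    {k t : ℕ} (hk : k + t = n) {A1 : Store} (hA1 : Filled A c f n t A1) :
    ∃ A', Exec I B (.loop (.bin .sub (.var 1) (.var 0))
      (.seq (.store cE (.var 0) e) (.assign 0 (.bin .add (.var 0) (.const 1))))) A1 A'
        (k * (cE.cost + e.cost + 39) + 14) ∧ Filled A c f n n A' := by
  have hguard : Expr.Ok I B A1 (.bin .sub (.var 1) (.var 0)) :=
    ⟨Expr.ok_var hI (by omega) (by omega) (by rw [hA1.count]; omega),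
      Expr.ok_var hI (by omega) (by omega) (by rw [hA1.counter]; omega),
      by simp only [BinOp.eval, Expr.val_var, hA1.count]; omega⟩
  have hgv : Expr.val A1 (.bin .sub (.var 1) (.var 0)) = k := by
    simp only [Expr.val, BinOp.eval, Expr.val_var, hA1.count, hA1.counter]; omega
  induction k generalizing t A1 with
  | zero =>
    obtain rfl : t = n := by omega
    refine ⟨A1, ?_, hA1⟩
    have h := Exec.loop_zero (s := (.seq (.store cE (.var 0) e)
      (.assign 0 (.bin .add (.var 0) (.const 1))))) hguard hgv
    simpa [Expr.cost, Expr.var] using h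
  | succ k ih =>
    obtain ⟨ok1, v1⟩ := hc t (by omega) A1 hA1
    obtain ⟨ok2, v2⟩ := he t (by omega) A1 hA1
    have x1 := Exec.store ok1 (Expr.ok_var (A := A1) (r := 0) hI (by omega) (by omega)
      (by rw [hA1.counter]; omega)) ok2 (by omega)
    rw [v1, v2, Expr.val_var, hA1.counter] at x1
    have e1 : A1.set c t (f t) 1 = A1 1 := Store.set_array_ne _ _ _ (Ne.symm hc1)
    have x2 := Exec.assign (I := I) (B := B) (A := A1.set c t (f t)) (r := 0)
      (e := .bin .add (.var 0) (.const 1)) hI (by omega) (by omega)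
      ⟨Expr.ok_var hI (by omega) (by omega) (by rw [e1, hA1.counter]; omega),
        show 1 ≤ B by omega, by simp only [BinOp.eval, Expr.val_var, e1, hA1.counter, Expr.val]; omega⟩
    simp only [Expr.val, BinOp.eval, Expr.val_var, e1, hA1.counter] at x2
    have hA2 : Filled A c f n (t + 1) ((A1.set c t (f t)).set 1 0 (t + 1)) := by
      refine ⟨Store.set_same _ _ _ _, ?_, fun r hr => ?_, fun a ha => ?_, fun a ha => ?_,
        fun c' h1 h2 => ?_⟩
      · rw [Store.set_index_ne _ _ _ (by omega), e1, hA1.count]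
      · rw [Store.set_index_ne _ _ _ (by omega), e1, hA1.var r hr]
      · rw [Store.set_array_ne _ _ _ hc1]
        by_cases hat : a = t
        · subst hat; rw [Store.set_same]
        · rw [Store.set_index_ne _ _ _ hat, hA1.lt a (by omega)]
      · rw [Store.set_array_ne _ _ _ hc1, Store.set_index_ne _ _ _ (by omega),
          hA1.ge a (by omega)]
      · rw [Store.set_array_ne _ _ _ h1, Store.set_array_ne _ _ _ h2, hA1.other c' h1 h2]
    obtain ⟨A', x3, hA'⟩ := ih (by omega) hA2
      ⟨Expr.ok_var hI (by omega) (by omega) (by rw [hA2.count]; omega),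
        Expr.ok_var hI (by omega) (by omega) (by rw [hA2.counter]; omega),
        by simp only [BinOp.eval, Expr.val_var, hA2.count]; omega⟩
      (by simp only [Expr.val, BinOp.eval, Expr.val_var, hA2.count, hA2.counter]; omega)
    refine ⟨A', ?_, hA'⟩
    have x := Exec.loop_ne hguard (by rw [hgv]; omega) (x1.seq x2) x3
    convert x using 1
    simp [Expr.cost, Expr.var]; ring

/-- Correctness of loops that fill an array: the value `f t` may depend on the earlier ones. -/
theorem Exec.fill {A : Store} {c : ℕ} {f : ℕ → ℕ} {n : ℕ} {cE nE e : Expr} (hI : 1 < I)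
    (hnB : n + 1 ≤ B) (hcI : c < I) (hc1 : c ≠ 1) (hn : nE.Ok I B A ∧ nE.val A = n)
    (hc : ∀ t < n, ∀ A', Filled A c f n t A' → cE.Ok I B A' ∧ cE.val A' = c)
    (he : ∀ t < n, ∀ A', Filled A c f n t A' → e.Ok I B A' ∧ e.val A' = f t) :
    ∃ A' t, Exec I B (.fill cE nE e) A A' t ∧ Filled A c f n n A' ∧
      t ≤ (n + 1) * (cE.cost + nE.cost + e.cost + 43) := by
  have x1 := Exec.assign (r := 1) hI (by omega) (by omega) hn.1
  rw [hn.2] at x1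
  have x2 := Exec.assign (I := I) (B := B) (A := A.set 1 1 n) (r := 0) (e := .const 0) hI
    (by omega) (by omega) (show 0 ≤ B by omega)
  have hA1 : Filled A c f n 0 ((A.set 1 1 n).set 1 0 0) := by
    refine ⟨Store.set_same _ _ _ _, ?_, fun r hr => ?_, fun a ha => by omega, fun a _ => ?_,
      fun c' h1 h2 => ?_⟩
    · rw [Store.set_index_ne _ _ _ (by omega), Store.set_same]
    · rw [Store.set_index_ne _ _ _ (by omega), Store.set_index_ne _ _ _ (by omega)]
    · rw [Store.set_array_ne _ _ _ hc1, Store.set_array_ne _ _ _ hc1]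
    · rw [Store.set_array_ne _ _ _ h1, Store.set_array_ne _ _ _ h1]
  obtain ⟨A', x3, hA'⟩ := Exec.fill_loop hI hnB hcI hc1 hc he (add_zero n) hA1
  refine ⟨A', _, x1.seq (x2.seq x3), hA', ?_⟩
  simp only [Expr.cost]
  nlinarith [Nat.zero_le (n * nE.cost)]

/-! ### Simulation of a program in one array -/

/-- Operands of a program that runs in the array whose number is in the variable `3`. -/
def Operand.expr : Operand → Expr
  | .const n => .const n
  | .direct a => .load (.var 3) (.const a)
  | .indirect a => .load (.var 3) (.load (.var 3) (.const a))

def Dest.expr : Dest → Expr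
  | .direct a => .const a
  | .indirect a => .load (.var 3) (.const a)

/-- An instruction of a program that runs in the array whose number is in the variable `3`, with
the instruction counter in the variable `2`. -/
def Instr.stmt : Instr → Stmt
  | .compute d o x y =>
      .seq (.store (.var 3) d.expr (.bin o x.expr y.expr))
        (.assign 2 (.bin .add (.var 2) (.const 1)))
  | .jumpIfZero x q =>
      .ifz x.expr (.assign 2 (.const q)) (.assign 2 (.bin .add (.var 2) (.const 1)))

/-- Execute the instruction whose number, counted from `k`, is in the variable `2`. -/
def dispatch : List Instr → ℕ → Stmt
  | [], _ => .skip
  | i :: l, k =>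
      .ifz (.bin .add (.bin .sub (.var 2) (.const k)) (.bin .sub (.const k) (.var 2))) i.stmt
        (dispatch l (k + 1))

/-- Simulation of a program. -/
def simulate (prog : Program) : Stmt :=
  .loop (.bin .sub (.const prog.length) (.var 2)) (dispatch prog 0)

/-- An upper bound for the numbers that occur in an operand. -/
def Operand.maxConst : Operand → ℕ
  | .const n => n
  | .direct a => a
  | .indirect a => a

def Dest.maxConst : Dest → ℕ
  | .direct a => a
  | .indirect a => a

def Instr.maxConst : Instr → ℕ
  | .compute d _ x y => d.maxConst + x.maxConst + y.maxConst
  | .jumpIfZero x q => x.maxConst + q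

/-- The store in which the array `c` is the memory of a configuration, whose instruction counter
is in the variable `2`. -/
def hostStore (A : Store) (c : ℕ) (cfg : Config) : Store :=
  Function.update (A.set 1 2 cfg.pc) c cfg.mem

variable {A : Store} {c : ℕ} {cfg : Config}

theorem hostStore_array : hostStore A c cfg c = cfg.mem := by simp [hostStore]

theorem hostStore_pc (hc : c ≠ 1) : hostStore A c cfg 1 2 = cfg.pc := by
  rw [hostStore, Function.update_of_ne (Ne.symm hc), Store.set_same]

theorem hostStore_var (hc : c ≠ 1) {r : ℕ} (hr : r ≠ 2) : hostStore A c cfg 1 r = A 1 r := by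
  rw [hostStore, Function.update_of_ne (Ne.symm hc), Store.set_index_ne _ _ _ hr]

theorem hostStore_other {c' : ℕ} (hc : c' ≠ c) (h1 : c' ≠ 1) : hostStore A c cfg c' = A c' := by
  rw [hostStore, Function.update_of_ne hc, Store.set_array_ne _ _ _ h1]

theorem hostStore_set_pc (hc : c ≠ 1) (q : ℕ) :
    (hostStore A c cfg).set 1 2 q = hostStore A c ⟨q, cfg.mem⟩ := by
  simp only [hostStore, Store.set]
  rw [Function.update_of_ne (Ne.symm hc), Function.update_comm hc]
  simp

theorem hostStore_set (a v : ℕ) :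
    (hostStore A c cfg).set c a v = hostStore A c ⟨cfg.pc, Function.update cfg.mem a v⟩ := by
  simp [hostStore, Store.set]

/-- The side conditions for the simulation: the array number is in the variable `3`. -/
structure HostOk (I B : ℕ) (A : Store) (c : ℕ) : Prop where
  var : A 1 3 = c
  ne : c ≠ 1
  lt : c < I
  one : 1 < I
  le : c ≤ B
  three : 3 ≤ B

theorem HostOk.ok_var (h : HostOk I B A c) :
    (Expr.var 3).Ok I B (hostStore A c cfg) ∧ (Expr.var 3).val (hostStore A c cfg) = c := by
  have h3 := h.three
  have e : hostStore A c cfg 1 3 = c := by rw [hostStore_var h.ne (by omega), h.var]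
  exact ⟨Expr.ok_var h.one (by omega) (by omega) (by rw [e]; exact h.le), e⟩

theorem HostOk.operand (h : HostOk I B A c) (hm : ∀ b, cfg.mem b ≤ B) {x : Operand}
    (hx : x.maxConst ≤ B) :
    x.expr.Ok I B (hostStore A c cfg) ∧ x.expr.val (hostStore A c cfg) = x.eval cfg.mem := by
  obtain ⟨h1, h2⟩ := h.ok_var (cfg := cfg)
  cases x with
  | const n => exact ⟨hx, rfl⟩
  | direct a =>
    have e : hostStore A c cfg c a = cfg.mem a := by rw [hostStore_array]
    refine ⟨⟨h1, hx, by rw [h2]; exact h.lt, ?_⟩, ?_⟩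
    · rw [h2]; simpa only [Expr.val, e] using hm a
    · simp only [Operand.expr, Expr.val, h2, e, Operand.eval]
  | indirect a =>
    have e : ∀ b, hostStore A c cfg c b = cfg.mem b := fun b => by rw [hostStore_array]
    refine ⟨⟨h1, ⟨h1, hx, by rw [h2]; exact h.lt, ?_⟩, by rw [h2]; exact h.lt, ?_⟩, ?_⟩
    · rw [h2]; simpa only [Expr.val, e] using hm a
    · rw [h2]; simpa only [Expr.val, e] using hm _
    · simp only [Operand.expr, Expr.val, h2, e, Operand.eval]

theorem HostOk.dest (h : HostOk I B A c) (hm : ∀ b, cfg.mem b ≤ B) {d : Dest}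
    (hd : d.maxConst ≤ B) :
    d.expr.Ok I B (hostStore A c cfg) ∧ d.expr.val (hostStore A c cfg) = d.addr cfg.mem := by
  cases d with
  | direct a => exact ⟨hd, rfl⟩
  | indirect a => exact h.operand hm (x := .direct a) hd

theorem HostOk.exec_incr (h : HostOk I B A c) (hpc : cfg.pc + 1 ≤ B) :
    ∃ t, Exec I B (.assign 2 (.bin .add (.var 2) (.const 1))) (hostStore A c cfg)
      (hostStore A c ⟨cfg.pc + 1, cfg.mem⟩) t := by
  have h3 := h.three
  have e : hostStore A c cfg 1 2 = cfg.pc := hostStore_pc h.ne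
  have x := Exec.assign (I := I) (B := B) (A := hostStore A c cfg) (r := 2)
    (e := .bin .add (.var 2) (.const 1)) h.one (by omega) (by omega)
    ⟨Expr.ok_var h.one (by omega) (by omega) (by rw [e]; omega), show 1 ≤ B by omega,
      by simpa only [BinOp.eval, Expr.val, Expr.val_var, e] using hpc⟩
  rw [hostStore_set_pc h.ne] at x
  simp only [Expr.val, Expr.val_var, e, BinOp.eval] at x
  exact ⟨_, x⟩

/-- The result of an operation is a cell content after the simulated step, so the bound on the
simulated run covers it. Hence shifts and bitwise operations need no separate estimate. -/
theorem HostOk.exec_instr (h : HostOk I B A c) {i : Instr} (hi : i.maxConst ≤ B)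
    (hm : ∀ b, cfg.mem b ≤ B) (hm' : ∀ b, (i.exec cfg).mem b ≤ B) (hpc : cfg.pc + 1 ≤ B) :
    ∃ t, Exec I B i.stmt (hostStore A c cfg) (hostStore A c (i.exec cfg)) t := by
  have h3 := h.three
  cases i with
  | compute d o x y =>
    simp only [Instr.maxConst] at hi
    obtain ⟨h1, h2⟩ := h.ok_var (cfg := cfg)
    obtain ⟨d1, d2⟩ := h.dest hm (d := d) (by omega)
    obtain ⟨x1, x2⟩ := h.operand hm (x := x) (by omega)
    obtain ⟨y1, y2⟩ := h.operand hm (x := y) (by omega)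
    have hv := hm' (d.addr cfg.mem)
    simp only [Instr.exec, Function.update_self] at hv
    have ex := Exec.store h1 d1 (v := .bin o x.expr y.expr) ⟨x1, y1, by rw [x2, y2]; exact hv⟩
      (by rw [h2]; exact h.lt)
    rw [h2, hostStore_set] at ex
    simp only [Expr.val, d2, x2, y2] at ex
    obtain ⟨t, ex'⟩ := h.exec_incr (cfg := ⟨cfg.pc, Function.update cfg.mem (d.addr cfg.mem)
      (o.eval (x.eval cfg.mem) (y.eval cfg.mem))⟩) hpc
    exact ⟨_, ex.seq ex'⟩
  | jumpIfZero x q =>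
    simp only [Instr.maxConst] at hi
    obtain ⟨x1, x2⟩ := h.operand hm (x := x) (by omega)
    by_cases hx : x.eval cfg.mem = 0
    · have ex := Exec.assign (I := I) (B := B) (A := hostStore A c cfg) (r := 2)
        (e := .const q) h.one (by omega) (by omega) (show q ≤ B by omega)
      rw [hostStore_set_pc h.ne] at ex
      have e : Instr.exec cfg (.jumpIfZero x q) = ⟨q, cfg.mem⟩ := by simp [Instr.exec, hx]
      exact ⟨_, e ▸ Exec.ifz_zero x1 (by rw [x2, hx]) ex⟩
    · obtain ⟨t, ex⟩ := h.exec_incr (cfg := cfg) hpc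
      have e : Instr.exec cfg (.jumpIfZero x q) = ⟨cfg.pc + 1, cfg.mem⟩ := by
        simp [Instr.exec, hx]
      exact ⟨_, e ▸ Exec.ifz_ne x1 (by rw [x2]; exact hx) ex⟩

theorem Instr.loopFree_stmt (i : Instr) : i.stmt.LoopFree := by
  cases i <;> exact ⟨trivial, trivial⟩

theorem loopFree_dispatch (l : List Instr) (k : ℕ) : (dispatch l k).LoopFree := by
  induction l generalizing k with
  | nil => trivial
  | cons i l ih => exact ⟨i.loopFree_stmt, ih _⟩

theorem HostOk.exec_dispatch (h : HostOk I B A c) {l : List Instr} {k : ℕ} {i : Instr}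
    (hk : k ≤ cfg.pc) (hi : l[cfg.pc - k]? = some i) (hc : i.maxConst ≤ B)
    (hm : ∀ b, cfg.mem b ≤ B) (hm' : ∀ b, (i.exec cfg).mem b ≤ B) (hpc : cfg.pc + 1 ≤ B) :
    ∃ t, Exec I B (dispatch l k) (hostStore A c cfg) (hostStore A c (i.exec cfg)) t := by
  have h3 := h.three
  have e : hostStore A c cfg 1 2 = cfg.pc := hostStore_pc h.ne
  induction l generalizing k with
  | nil => simp at hi
  | cons j l ih =>
    -- The two truncated differences add up to the distance of `pc` and `k`, which is `pc - k`
    -- because the search starts below `pc`.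
    have hv : Expr.val (hostStore A c cfg) (.bin .add (.bin .sub (.var 2) (.const k))
        (.bin .sub (.const k) (.var 2))) = cfg.pc - k := by
      simp only [Expr.val, Expr.val_var, BinOp.eval, e]; omega
    have hvar : (Expr.var 2).Ok I B (hostStore A c cfg) :=
      Expr.ok_var h.one (by omega) (by omega) (by rw [e]; omega)
    have hok : Expr.Ok I B (hostStore A c cfg) (.bin .add (.bin .sub (.var 2) (.const k))
        (.bin .sub (.const k) (.var 2))) := by
      refine ⟨⟨hvar, show k ≤ B by omega, ?_⟩, ⟨show k ≤ B by omega, hvar, ?_⟩, ?_⟩ <;>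
      simp only [Expr.val, Expr.val_var, BinOp.eval, e] <;> omega
    by_cases hpk : cfg.pc = k
    · rw [hpk, Nat.sub_self, List.getElem?_cons_zero, Option.some_inj] at hi
      subst hi
      obtain ⟨t, ex⟩ := h.exec_instr hc hm hm' hpc
      exact ⟨_, Exec.ifz_zero hok (by rw [hv]; omega) ex⟩
    · rw [show cfg.pc - k = (cfg.pc - (k + 1)) + 1 by omega, List.getElem?_cons_succ] at hi
      obtain ⟨t, ex⟩ := ih (by omega) hi
      exact ⟨_, Exec.ifz_ne hok (by rw [hv]; omega) ex⟩

/-- The time for the simulation of one step. -/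
def simulationCost (prog : Program) : ℕ := (dispatch prog 0).size + 10

/-- `T` need not be the first halting time: after halting, machine steps are idle, and the
simulating loop just ends earlier. -/
theorem HostOk.exec_simulate (h : HostOk I B A c) {prog : Program} (hlen : prog.length ≤ B)
    (hconst : ∀ i ∈ prog, i.maxConst ≤ B) {T : ℕ}
    (hT : prog.length ≤ ((step prog)^[T] cfg).pc)
    (hm : ∀ s ≤ T, ∀ b, ((step prog)^[s] cfg).mem b ≤ B) (hpc : cfg.pc ≤ B) :
    ∃ t, Exec I B (simulate prog) (hostStore A c cfg)
      (hostStore A c ((step prog)^[T] cfg)) t ∧ t ≤ (T + 1) * simulationCost prog := by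
  have h3 := h.three
  induction T generalizing cfg with
  | zero =>
    have e : hostStore A c cfg 1 2 = cfg.pc := hostStore_pc h.ne
    have x := Exec.loop_zero (I := I) (B := B) (A := hostStore A c cfg)
      (e := .bin .sub (.const prog.length) (.var 2)) (s := dispatch prog 0)
      ⟨hlen, Expr.ok_var h.one (by omega) (by omega) (by rw [e]; omega),
        by simp only [Expr.val, Expr.val_var, BinOp.eval, e]; omega⟩
      (by
        simp only [Function.iterate_zero, id] at hT
        simp only [Expr.val, Expr.val_var, BinOp.eval, e]; omega)
    refine ⟨_, x, ?_⟩
    simp only [Expr.cost, Expr.var, simulationCost]; omega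
  | succ T ih =>
    have e : hostStore A c cfg 1 2 = cfg.pc := hostStore_pc h.ne
    have hT' := hT
    rw [Function.iterate_succ_apply] at hT'
    have hm' : ∀ s ≤ T, ∀ b, ((step prog)^[s] (step prog cfg)).mem b ≤ B := fun s hs b => by
      rw [← Function.iterate_succ_apply]; exact hm (s + 1) (by omega) b
    rw [Function.iterate_succ_apply]
    by_cases hlt : cfg.pc < prog.length
    · have hstep : step prog cfg = prog[cfg.pc].exec cfg := by simp [step, hlt]
      have hci := hconst _ (List.getElem_mem hlt)
      obtain ⟨t1, x1⟩ := h.exec_dispatch (cfg := cfg) (l := prog) (k := 0) (i := prog[cfg.pc])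
        (by omega) (by simp [hlt]) hci (hm 0 (by omega))
        (fun b => by rw [← hstep]; exact hm 1 (by omega) b) (by omega)
      have hpc' : (step prog cfg).pc ≤ B := by
        rw [hstep]
        cases hi : prog[cfg.pc] with
        | compute d o x y => simp only [Instr.exec]; omega
        | jumpIfZero x q =>
          rw [hi] at hci
          simp only [Instr.maxConst] at hci
          simp only [Instr.exec]
          split_ifs <;> omega
      obtain ⟨t2, x2, ht2⟩ := ih hT' hm' hpc'
      rw [← hstep] at x1
      have x := Exec.loop_ne (I := I) (B := B) (A := hostStore A c cfg)
        (e := .bin .sub (.const prog.length) (.var 2)) (s := dispatch prog 0)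
        ⟨hlen, Expr.ok_var h.one (by omega) (by omega) (by rw [e]; omega),
          by simp only [Expr.val, Expr.val_var, BinOp.eval, e]; omega⟩
        (by simp only [Expr.val, Expr.val_var, BinOp.eval, e]; omega) x1 x2
      refine ⟨_, x, ?_⟩
      have := x1.time_le (loopFree_dispatch _ _)
      simp only [Expr.cost, Expr.var]
      rw [show T + 1 + 1 = (T + 1) + 1 from rfl, add_mul (T + 1), one_mul]
      have hs : simulationCost prog = (dispatch prog 0).size + 10 := rfl
      omega
    · have hstep : step prog cfg = cfg := by simp [step, hlt]
      rw [hstep] at hT' hm' ⊢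
      obtain ⟨t, x, ht⟩ := ih hT' hm' hpc
      exact ⟨t, x, ht.trans (Nat.mul_le_mul_right _ (by omega))⟩

end

end RAM

/-! ### Counting pairs of embeddings modulo small numbers -/

section PathSums

variable {V R : Type*} [Fintype V] [CommRing R]

/-- Sums of the weights of all walks with a given last vertex. -/
def pathSum (f : V → R) (T : ℕ → V → V → R) : ℕ → V → R
  | 0, v => f v
  | j + 1, v => ∑ u, T j u v * pathSum f T j u

/-- Transfer-matrix argument. With `F` arbitrary, the last step of the walk can be absorbed into it,
replacing `F` by `u ↦ ∑ v, F v * T l u v`; on the side of walks this removes the last vertex. -/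
theorem sum_mul_pathSum (f : V → R) (T : ℕ → V → V → R) (l : ℕ) (F : V → R) :
    ∑ v, F v * pathSum f T l v =
      ∑ e : Fin (l + 1) → V,
        F (e (Fin.last l)) * (f (e 0) * ∏ j : Fin l, T j (e j.castSucc) (e j.succ)) := by
  induction l generalizing F with
  | zero =>
    refine (Fintype.sum_equiv (Equiv.funUnique (Fin 1) V) _ _ fun e => ?_).symm
    simp [pathSum, Fin.last]
  | succ l ih =>
    calc ∑ v, F v * pathSum f T (l + 1) v
        = ∑ u, (∑ v, F v * T l u v) * pathSum f T l u := by
          simp only [pathSum, Finset.mul_sum, Finset.sum_mul]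
          rw [Finset.sum_comm]
          exact Finset.sum_congr rfl fun u _ => Finset.sum_congr rfl fun v _ => by ring
      _ = _ := by
          rw [ih]
          rw [← Fintype.sum_equiv (Fin.snocEquiv fun _ : Fin (l + 2) => V)
            (fun p => F p.1 * (f (p.2 0) * ((∏ j : Fin l, T j (p.2 j.castSucc) (p.2 j.succ)) *
              T l (p.2 (Fin.last l)) p.1))) _ fun p => ?_]
          · rw [Fintype.sum_prod_type_right]
            refine Finset.sum_congr rfl fun e _ => ?_
            rw [Finset.sum_mul]
            exact Finset.sum_congr rfl fun v _ => by ring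
          · have h0 : (Fin.snoc p.2 p.1 : Fin (l + 2) → V) 0 = p.2 0 := by
              rw [← Fin.castSucc_zero, Fin.snoc_castSucc]
            have h1 : ∀ j : Fin l, (Fin.snoc p.2 p.1 : Fin (l + 2) → V) j.castSucc.succ =
                p.2 j.succ := fun j => by
              rw [Fin.succ_castSucc, Fin.snoc_castSucc]
            simp only [Fin.snocEquiv, Equiv.coe_fn_mk, Fin.snoc_last, Fin.prod_univ_castSucc,
              Fin.snoc_castSucc, h0, h1, Fin.succ_last, Fin.val_last, Fin.val_castSucc]

/-- A sum of products over pairs in the fibres of `σ` is a sum of squares. -/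
theorem sum_fiber_pairs_eq_zero_iff {E P : Type*} [Fintype E] [DecidableEq P] (σ : E → P)
    (g : E → ℤ) :
    ∑ e, ∑ e', (if σ e = σ e' then g e * g e' else 0) = 0 ↔
      ∀ p, ∑ e, (if σ e = p then g e else 0) = 0 := by
  have h : ∑ e, ∑ e', (if σ e = σ e' then g e * g e' else 0) =
      ∑ p ∈ Finset.univ.image σ, (∑ e, (if σ e = p then g e else 0)) ^ 2 := by
    have h1 : ∀ p, (∑ e, (if σ e = p then g e else 0)) ^ 2 =
        ∑ e, if σ e = p then ∑ e', (if σ e = σ e' then g e * g e' else 0) else 0 := by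
      intro p
      rw [sq, Finset.sum_mul]
      refine Finset.sum_congr rfl fun e _ => ?_
      split_ifs with hp
      · rw [Finset.mul_sum]
        refine Finset.sum_congr rfl fun e' _ => ?_
        by_cases h' : σ e' = p
        · rw [if_pos h', if_pos (hp.trans h'.symm)]
        · rw [if_neg h', if_neg (fun h => h' (h.symm.trans hp)), mul_zero]
      · rw [zero_mul]
    simp only [h1]
    rw [eq_comm, Finset.sum_comm]
    refine Finset.sum_congr rfl fun e _ => ?_
    rw [Finset.sum_ite_eq]
    simp
  rw [h, Finset.sum_eq_zero_iff_of_nonneg fun _ _ => sq_nonneg _]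
  constructor
  · intro hp p
    by_cases hm : p ∈ Finset.univ.image σ
    · exact pow_eq_zero_iff two_ne_zero |>.1 (hp p hm)
    · refine Finset.sum_eq_zero fun e _ => if_neg fun he => hm ?_
      exact Finset.mem_image.2 ⟨e, Finset.mem_univ _, he⟩
  · intro hp p _
    rw [hp p]; rfl

end PathSums

/-- A small number that is divisible by many consecutive numbers is zero. -/
theorem eq_zero_of_forall_dvd {X k : ℕ} (hX : X ≤ 4 ^ k)
    (h : ∀ m, 0 < m → m ≤ 4 * k + 8 → m ∣ X) : X = 0 := by
  -- A prime power dividing `n.centralBinom` is at most `2 * n = 4 * k + 8`, so it divides `X`;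
  -- hence the whole coefficient does. But `4 ^ n < n * n.centralBinom` and `n ≤ 4 ^ (k + 4)`, and
  -- `n` is chosen such that `4 ^ (k + 4) * 4 ^ k = 4 ^ n`.
  set n := 2 * k + 4 with hn
  by_contra hX0
  have hdvd : n.centralBinom ∣ X := by
    rw [Nat.dvd_iff_prime_pow_dvd_dvd]
    intro p e hp hpe
    refine h _ (pow_pos hp.pos e) ?_
    have h1 : e ≤ (n.centralBinom).factorization p :=
      (hp.pow_dvd_iff_le_factorization (Nat.centralBinom_ne_zero n)).1 hpe
    calc p ^ e ≤ p ^ (n.centralBinom).factorization p := Nat.pow_le_pow_right hp.pos h1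
      _ ≤ 2 * n := Nat.pow_factorization_choose_le (by omega)
      _ = 4 * k + 8 := by omega
  have h1 := Nat.le_of_dvd (Nat.pos_of_ne_zero hX0) hdvd
  have h2 := Nat.four_pow_lt_mul_centralBinom n (by omega)
  have h3 : n ≤ 4 ^ (k + 4) := by
    have : k + 4 < 2 ^ (k + 4) := Nat.lt_two_pow_self
    calc n ≤ 2 * (k + 4) := by omega
      _ ≤ 2 ^ (k + 4) * 2 ^ (k + 4) := Nat.mul_le_mul (by omega) this.le
      _ = 4 ^ (k + 4) := by rw [← mul_pow]; norm_num
  have h4 : n * n.centralBinom ≤ 4 ^ (k + 4) * 4 ^ k := Nat.mul_le_mul h3 (h1.trans hX)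
  rw [← pow_add, show k + 4 + k = n by omega] at h4
  omega

/-! ### Signed counts of pairs of embeddings, over the integers and modulo small numbers -/

namespace GapSubseq

open Classical in
/-- Whether the positions `a` and `b` of `z` may follow each other: they lie on the same side of
the position `s`, and their gap satisfies the constraint `c`. -/
noncomputable def link (z : List ℕ) (s : ℕ) (c : Language ℕ) (a b : ℕ) : ℕ :=
  -- Both inequalities with `s` are weak, so the separator itself cannot be an end of a link either.
  if a < b ∧ ¬ (a ≤ s ∧ s ≤ b) ∧ (z.take b).drop (a + 1) ∈ c then 1 else 0

/-- Whether the letters at two positions are equal. -/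
def sameLetter (z : List ℕ) (a b : ℕ) : ℕ := if z.getD a 0 = z.getD b 0 then 1 else 0

/-- The sign of a position modulo `m + 1`. -/
def posSign (s m a : ℕ) : ℕ := if a < s then 1 else if s < a then m else 0

/-- The signed number of pairs of partial embeddings with given last positions, which are encoded
as one number, modulo `m + 1`. -/
noncomputable def table (z : List ℕ) (s : ℕ) (c : ℕ → Language ℕ) (m : ℕ) : ℕ → ℕ → ℕ
  | 0, i => (sameLetter z (i / z.length) (i % z.length) * (posSign s m (i / z.length) *
      posSign s m (i % z.length))) % (m + 1)
  | j + 1, i => (∑ x ∈ Finset.range (z.length * z.length),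
      sameLetter z (i / z.length) (i % z.length) *
        (link z s (c j) (x / z.length) (i / z.length) *
          link z s (c j) (x % z.length) (i % z.length)) * table z s c m j x) % (m + 1)

/-- The signed number of pairs of embeddings modulo `m + 1`. -/
noncomputable def tableSum (z : List ℕ) (s : ℕ) (c : ℕ → Language ℕ) (l m : ℕ) : ℕ :=
  (∑ x ∈ Finset.range (z.length * z.length), table z s c m l x) % (m + 1)

/-- The integral sign of a position. -/
def intSign (s a : ℕ) : ℤ := if a < s then 1 else if s < a then -1 else 0

/-- The integers of which `table` keeps the residues. They may be exponentially large and occur only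
in the correctness proof. -/
noncomputable def pairSum (z : List ℕ) (s : ℕ) (c : ℕ → Language ℕ) :
    ℕ → Fin z.length × Fin z.length → ℤ :=
  pathSum (fun v => (sameLetter z v.1 v.2 : ℤ) * (intSign s v.1 * intSign s v.2))
    (fun j u v => (sameLetter z v.1 v.2 : ℤ) * (link z s (c j) u.1 v.1 * link z s (c j) u.2 v.2))

/-- Words are natural numbers, so `-1` is represented by `m` modulo `m + 1`. -/
theorem cast_posSign (s m a : ℕ) : ((posSign s m a : ℕ) : ZMod (m + 1)) = intSign s a := by
  unfold posSign intSign
  split_ifs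
  · simp
  · rw [Int.cast_neg, Int.cast_one, eq_neg_iff_add_eq_zero]
    exact_mod_cast ZMod.natCast_self (m + 1)
  · simp

theorem cast_table (z : List ℕ) (s : ℕ) (c : ℕ → Language ℕ) (m j : ℕ)
    (p : Fin z.length × Fin z.length) {i : ℕ} (h1 : i / z.length = p.1) (h2 : i % z.length = p.2) :
    ((table z s c m j i : ℕ) : ZMod (m + 1)) = (pairSum z s c j p : ℤ) := by
  induction j generalizing p i with
  | zero =>
    simp only [table, pairSum, pathSum, ZMod.natCast_mod, h1, h2]
    push_cast
    rw [cast_posSign, cast_posSign]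
  | succ j ih =>
    simp only [table, pairSum, pathSum, ZMod.natCast_mod, h1, h2]
    rw [Finset.sum_range, Nat.cast_sum, Int.cast_sum]
    refine Fintype.sum_equiv finProdFinEquiv.symm _ _ fun x => ?_
    have e1 : (x : ℕ) / z.length = (finProdFinEquiv.symm x).1 := by
      simp [finProdFinEquiv, Fin.divNat]
    have e2 : (x : ℕ) % z.length = (finProdFinEquiv.symm x).2 := by
      simp [finProdFinEquiv, Fin.modNat]
    rw [Nat.cast_mul, ih _ e1 e2, e1, e2]
    push_cast
    rfl

theorem tableSum_eq_zero_iff (z : List ℕ) (s : ℕ) (c : ℕ → Language ℕ) (l m : ℕ) :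
    tableSum z s c l m = 0 ↔ ((m + 1 : ℕ) : ℤ) ∣ ∑ p, pairSum z s c l p := by
  rw [tableSum, ← Nat.dvd_iff_mod_eq_zero, ← ZMod.natCast_eq_zero_iff,
    ← ZMod.intCast_zmod_eq_zero_iff_dvd]
  rw [Finset.sum_range, Nat.cast_sum, Int.cast_sum]
  refine Eq.congr_left (Fintype.sum_equiv finProdFinEquiv.symm _ _ fun x => ?_)
  exact cast_table _ _ _ _ _ _ (by simp [finProdFinEquiv, Fin.divNat])
    (by simp [finProdFinEquiv, Fin.modNat])

/-- The signed weight of a sequence of positions. -/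
noncomputable def weight (z : List ℕ) (s : ℕ) (c : ℕ → Language ℕ) {l : ℕ}
    (e : Fin (l + 1) → Fin z.length) : ℤ :=
  intSign s (e 0) * ∏ j : Fin l, (link z s (c j) (e j.castSucc) (e j.succ) : ℤ)

/-- A walk on pairs is a pair of walks, and the product of the letter indicators along it says that
the two walks induce the same string. The rest of its weight splits into the weights of the two
walks. -/
theorem sum_pairSum (z : List ℕ) (s : ℕ) (c : ℕ → Language ℕ) (l : ℕ) :
    ∑ p, pairSum z s c l p = ∑ e : Fin (l + 1) → Fin z.length, ∑ e' : Fin (l + 1) → Fin z.length,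
      if (fun i => z.get (e i)) = (fun i => z.get (e' i)) then weight z s c e * weight z s c e'
      else 0 := by
  have h := sum_mul_pathSum (V := Fin z.length × Fin z.length)
    (fun v => (sameLetter z v.1 v.2 : ℤ) * (intSign s v.1 * intSign s v.2))
    (fun j u v => (sameLetter z v.1 v.2 : ℤ) * (link z s (c j) u.1 v.1 * link z s (c j) u.2 v.2))
    l (fun _ => 1)
  simp only [one_mul] at h
  rw [pairSum, h, ← Fintype.sum_prod_type']
  refine Fintype.sum_equiv (Equiv.arrowProdEquivProdArrow _ _ _) _ _ fun e => ?_
  have hs : (∏ i : Fin (l + 1), (sameLetter z (e i).1 (e i).2 : ℤ)) =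
      if (fun i => z.get (e i).1) = (fun i => z.get (e i).2) then 1 else 0 := by
    have h1 : ∀ i, (sameLetter z (e i).1 (e i).2 : ℤ) =
        if z.get (e i).1 = z.get (e i).2 then 1 else 0 := fun i => by
      simp [sameLetter]
    simp only [h1, Finset.prod_ite_zero, Finset.prod_const_one, Finset.mem_univ, true_imp_iff,
      funext_iff]
  rw [Fin.prod_univ_succ] at hs
  simp only [weight, Equiv.arrowProdEquivProdArrow, Equiv.coe_fn_mk, Finset.prod_mul_distrib]
  calc _ = ((sameLetter z (e 0).1 (e 0).2 : ℤ) *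
        ∏ i : Fin l, (sameLetter z (e i.succ).1 (e i.succ).2 : ℤ)) *
        ((intSign s (e 0).1 * ∏ j : Fin l, (link z s (c j) (e j.castSucc).1 (e j.succ).1 : ℤ)) *
        (intSign s (e 0).2 * ∏ j : Fin l, (link z s (c j) (e j.castSucc).2 (e j.succ).2 : ℤ))) := by
        ring
    _ = _ := by rw [hs, ite_mul, one_mul, zero_mul]; congr

theorem abs_weight_le (z : List ℕ) (s : ℕ) (c : ℕ → Language ℕ) {l : ℕ}
    (e : Fin (l + 1) → Fin z.length) : |weight z s c e| ≤ 1 := by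
  rw [weight, abs_mul, Finset.abs_prod]
  refine mul_le_one₀ ?_ (Finset.prod_nonneg fun _ _ => abs_nonneg _)
    (Finset.prod_le_one (fun _ _ => abs_nonneg _) fun j _ => ?_)
  · unfold intSign; split_ifs <;> simp
  · unfold link; split_ifs <;> simp

/-- There are `|z| ^ (2 * (l + 1))` pairs, each contributing at most one in absolute value, and `|z|
≤ 2 ^ |z|`. This is crude, but only a polynomial exponent is needed. -/
theorem natAbs_sum_pairSum_le (z : List ℕ) (s : ℕ) (c : ℕ → Language ℕ) (l : ℕ) :
    (∑ p, pairSum z s c l p).natAbs ≤ 4 ^ (z.length * (l + 1)) := by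
  have h : |∑ p, pairSum z s c l p| ≤ ((z.length ^ (l + 1) * z.length ^ (l + 1) : ℕ) : ℤ) := by
    rw [sum_pairSum]
    calc _ ≤ ∑ e : Fin (l + 1) → Fin z.length, ∑ e' : Fin (l + 1) → Fin z.length, (1 : ℤ) := by
          refine (Finset.abs_sum_le_sum_abs _ _).trans (Finset.sum_le_sum fun e _ =>
            (Finset.abs_sum_le_sum_abs _ _).trans (Finset.sum_le_sum fun e' _ => ?_))
          split_ifs
          · rw [abs_mul]
            exact mul_le_one₀ (abs_weight_le z s c e) (abs_nonneg _) (abs_weight_le z s c e')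
          · simp
      _ = _ := by simp
  have h2 : z.length ≤ 2 ^ z.length := Nat.lt_two_pow_self.le
  have h3 : z.length ^ (l + 1) ≤ 2 ^ (z.length * (l + 1)) := by
    rw [pow_mul]; exact Nat.pow_le_pow_left h2 _
  have h4 : z.length ^ (l + 1) * z.length ^ (l + 1) ≤ 4 ^ (z.length * (l + 1)) := by
    refine (Nat.mul_le_mul h3 h3).trans_eq ?_
    rw [← mul_pow]; norm_num
  zify
  exact h.trans (by exact_mod_cast h4)

theorem forall_tableSum_eq_zero_iff (z : List ℕ) (s : ℕ) (c : ℕ → Language ℕ) (l : ℕ) :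
    (∀ m < 4 * (z.length * (l + 1)) + 8, tableSum z s c l m = 0) ↔
      ∀ p : Fin (l + 1) → ℕ, ∑ e : Fin (l + 1) → Fin z.length,
        (if (fun i => z.get (e i)) = p then weight z s c e else 0) = 0 := by
  classical
  rw [← sum_fiber_pairs_eq_zero_iff, ← sum_pairSum]
  simp only [tableSum_eq_zero_iff]
  constructor
  · intro h
    rw [← Int.natAbs_eq_zero]
    -- The number `4 * k + 8` of moduli comes from here, with `k = |z| * (l + 1)`; index `m` stands
    -- for the modulus `m + 1`.
    refine eq_zero_of_forall_dvd (natAbs_sum_pairSum_le z s c l) fun m hm hm' => ?_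
    obtain ⟨m, rfl⟩ := Nat.exists_eq_succ_of_ne_zero hm.ne'
    exact Int.natCast_dvd.1 (h m (by omega))
  · intro h m _
    rw [h]; exact dvd_zero _

/-- The number of embeddings into a factor `w` of `z`, counted in `z`. -/
theorem embeddingCount_eq_card {l : ℕ} (gc : Fin l → Language ℕ) (w z : List ℕ)
    (f : Fin w.length → Fin z.length) (hf : StrictMono f) (hget : ∀ a, z.get (f a) = w.get a)
    (hgap : ∀ a b : Fin w.length, a < b →
      (z.take (f b)).drop (f a + 1) = (w.take b).drop (a + 1)) (p : Fin (l + 1) → ℕ) :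
    embeddingCount gc w p = Nat.card {e : Fin (l + 1) → Fin z.length //
      (∀ i, e i ∈ Set.range f) ∧ IsGapEmbedding gc z e ∧ ∀ i, z.get (e i) = p i} := by
  have key : ∀ e : Fin (l + 1) → Fin w.length,
      IsGapEmbedding gc z (f ∘ e) ↔ IsGapEmbedding gc w e := fun e => by
    unfold IsGapEmbedding
    have hm : StrictMono (f ∘ e) ↔ StrictMono e :=
      ⟨fun h a b hab => hf.lt_iff_lt.1 (h hab), fun h => hf.comp h⟩
    rw [hm]
    refine and_congr_right fun he => forall_congr' fun j => ?_
    rw [gap, gap, Function.comp_apply, Function.comp_apply, hgap _ _ (he (Fin.castSucc_lt_succ))]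
  refine Nat.card_congr (Equiv.ofBijective (fun e => ⟨f ∘ e.1, fun i => ⟨e.1 i, rfl⟩,
    (key e.1).2 e.2.1, fun i => (hget _).trans (e.2.2 i)⟩) ⟨?_, ?_⟩)
  · intro e e' h
    refine Subtype.ext (funext fun i => hf.injective ?_)
    exact congrFun (congrArg Subtype.val h) i
  · rintro ⟨e, h1, h2, h3⟩
    obtain ⟨e', rfl⟩ : ∃ e', f ∘ e' = e := ⟨fun i => (h1 i).choose,
      funext fun i => (h1 i).choose_spec⟩
    exact ⟨⟨e', (key e').1 h2, fun i => (hget _).symm.trans (h3 i)⟩, rfl⟩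

-- No link touches or crosses the separator, so an embedding of nonzero weight stays on the side of
-- its first position, and the sign of that position is the weight. For `l = 0` there are no links,
-- and the separator is excluded by its sign `0`.
open Classical in
theorem weight_eq {z : List ℕ} {s : ℕ} {c : ℕ → Language ℕ} {l : ℕ}
    (e : Fin (l + 1) → Fin z.length) :
    weight z s c e =
      (if (∀ i, (e i : ℕ) < s) ∧ IsGapEmbedding (fun j : Fin l => c j) z e then 1 else 0) -
      (if (∀ i, s < (e i : ℕ)) ∧ IsGapEmbedding (fun j : Fin l => c j) z e then 1 else 0) := by
  have hprod : (∏ j : Fin l, (link z s (c j) (e j.castSucc) (e j.succ) : ℤ)) =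
      if ∀ j : Fin l, (e j.castSucc : ℕ) < e j.succ ∧
        ¬ ((e j.castSucc : ℕ) ≤ s ∧ s ≤ (e j.succ : ℕ)) ∧ gap z e j ∈ c j then 1 else 0 := by
    simp only [link, gap, Nat.cast_ite, Nat.cast_one, Nat.cast_zero, Finset.prod_ite_zero,
      Finset.prod_const_one, Finset.mem_univ, true_imp_iff]
    congr
  rw [weight, hprod]
  by_cases hE : IsGapEmbedding (fun j : Fin l => c j) z e
  · simp only [hE, and_true]
    have hlt : ∀ j : Fin l, (e j.castSucc : ℕ) < e j.succ := fun j =>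
      hE.1 Fin.castSucc_lt_succ
    have h0 : ∀ i, (e 0 : ℕ) ≤ e i := fun i => hE.1.monotone (Fin.zero_le i)
    by_cases hc : ∀ j : Fin l, ¬ ((e j.castSucc : ℕ) ≤ s ∧ s ≤ (e j.succ : ℕ))
    · rw [if_pos fun j => ⟨hlt j, hc j, hE.2 j⟩, mul_one]
      have hall : (e 0 : ℕ) < s → ∀ i, (e i : ℕ) < s := fun h i => by
        induction i using Fin.induction with
        | zero => exact h
        | succ j ih => have := hc j; omega
      unfold intSign
      by_cases h1 : (e 0 : ℕ) < s
      · have n2 : ¬ ∀ i, s < (e i : ℕ) := fun h => by have := h 0; omega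
        rw [if_pos h1, if_pos (hall h1), if_neg n2]; rfl
      · have n1 : ¬ ∀ i, (e i : ℕ) < s := fun h => h1 (h 0)
        by_cases h2 : s < (e 0 : ℕ)
        · rw [if_neg h1, if_pos h2, if_neg n1, if_pos fun i => h2.trans_le (h0 i)]; rfl
        · rw [if_neg h1, if_neg h2, if_neg n1, if_neg fun h => h2 (h 0)]; rfl
    · rw [if_neg fun h => hc fun j => (h j).2.1]
      push Not at hc
      obtain ⟨j, hj1, hj2⟩ := hc
      have n1 : ¬ ∀ i, (e i : ℕ) < s := fun h => by have := h j.succ; omega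
      have n2 : ¬ ∀ i, s < (e i : ℕ) := fun h => by have := h j.castSucc; omega
      rw [if_neg n1, if_neg n2]
      simp
  · have n : ¬ ∀ j : Fin l, (e j.castSucc : ℕ) < e j.succ ∧
        ¬ ((e j.castSucc : ℕ) ≤ s ∧ s ≤ (e j.succ : ℕ)) ∧ gap z e j ∈ c j := fun h =>
      hE ⟨Fin.strictMono_iff_lt_succ.2 fun j => (h j).1, fun j => (h j).2.2⟩
    rw [if_neg n]
    simp [hE]

theorem card_subtype_eq_sum {E : Type*} [Fintype E] (Q : E → Prop) [DecidablePred Q] :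
    (Nat.card {e // Q e} : ℤ) = ∑ e, if Q e then 1 else 0 := by
  rw [Nat.card_eq_fintype_card, Fintype.card_subtype]
  simp

/-- The two strings are factors of `z`, shifted by `0` and by `|w| + 1`; gaps inside a factor are
the same strings in `z`. The separating letter never matters. -/
theorem sum_weight_eq {l : ℕ} (c : ℕ → Language ℕ) (w w' : List ℕ) (p : Fin (l + 1) → ℕ) :
    ∑ e : Fin (l + 1) → Fin (w ++ w'.length :: w').length,
        (if (fun i => (w ++ w'.length :: w').get (e i)) = p then
          weight (w ++ w'.length :: w') w.length c e else 0) =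
      (embeddingCount (fun j : Fin l => c j) w p : ℤ) -
        embeddingCount (fun j : Fin l => c j) w' p := by
  classical
  set z := w ++ w'.length :: w' with hz
  have hlen : z.length = w.length + (w'.length + 1) := by simp [hz]
  have h1 := embeddingCount_eq_card (fun j : Fin l => c j) w z
    (fun a => ⟨a, by omega⟩) (fun a b h => h) (fun a => by simp [hz])
    (fun a b _ => by
      simp only [hz]
      rw [List.take_append_of_le_length b.2.le]) p
  have h2 := embeddingCount_eq_card (fun j : Fin l => c j) w' z
    (fun a => ⟨w.length + 1 + a, by omega⟩)
    (fun a b h => Nat.add_lt_add_left (Fin.lt_def.1 h) _)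
    (fun a => by
      simp only [hz, List.get_eq_getElem]
      rw [List.getElem_append_right (by omega)]
      simp [show w.length + 1 + (a : ℕ) - w.length = a + 1 by omega])
    (fun a b _ => by
      simp only [hz]
      rw [show w.length + 1 + (b : ℕ) = w.length + (b + 1) by omega, List.take_length_add_append,
        show w.length + 1 + (a : ℕ) + 1 = w.length + (a + 2) by omega, List.drop_length_add_append]
      simp) p
  rw [h1, h2, card_subtype_eq_sum, card_subtype_eq_sum, ← Finset.sum_sub_distrib]
  refine Finset.sum_congr rfl fun e _ => ?_
  have r1 : (∀ i, e i ∈ Set.range fun a : Fin w.length => (⟨a, by omega⟩ : Fin z.length)) ↔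
      ∀ i, (e i : ℕ) < w.length := by
    refine forall_congr' fun i => ⟨?_, fun h => ⟨⟨e i, h⟩, rfl⟩⟩
    rintro ⟨a, ha⟩
    rw [← ha]; exact a.2
  have r2 : (∀ i, e i ∈ Set.range fun a : Fin w'.length =>
      (⟨w.length + 1 + a, by omega⟩ : Fin z.length)) ↔ ∀ i, w.length < (e i : ℕ) := by
    refine forall_congr' fun i => ⟨?_, fun h => ⟨⟨e i - (w.length + 1), by omega⟩, ?_⟩⟩
    · rintro ⟨a, ha⟩
      rw [← ha]; simp only; omega
    · ext; simp only; omega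
  simp only [r1, r2, weight_eq]
  have hp : (fun i => z.get (e i)) = p ↔ ∀ i, z.get (e i) = p i := funext_iff
  by_cases h : ∀ i, z.get (e i) = p i
  · rw [if_pos (hp.2 h)]
    simp only [h, implies_true, and_true]
  · rw [if_neg (fun h' => h (hp.1 h'))]
    simp only [h, and_false, if_false, sub_self]

/-- Equivalence with multiplicities is expressed by finitely many small numbers. -/
theorem equivWithMultiplicities_iff {l : ℕ} (c : ℕ → Language ℕ) (w w' : List ℕ) :
    EquivWithMultiplicities (fun j : Fin l => c j) w w' ↔
      ∀ m < 4 * ((w ++ w'.length :: w').length * (l + 1)) + 8,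
        tableSum (w ++ w'.length :: w') w.length c l m = 0 := by
  rw [forall_tableSum_eq_zero_iff]
  refine forall_congr' fun p => ?_
  rw [sum_weight_eq, sub_eq_zero]
  norm_cast

end GapSubseq

namespace RAM

/-! ### Composite expressions -/

section

variable {I B V : ℕ} {A : Store}

instance : Add Expr := ⟨.bin .add⟩
instance : Sub Expr := ⟨.bin .sub⟩
instance : Mul Expr := ⟨.bin .mul⟩
instance : Div Expr := ⟨.bin .div⟩
instance : Mod Expr := ⟨.bin .mod⟩

theorem Expr.val_const (n : ℕ) : (Expr.const n).val A = n := rfl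
theorem Expr.val_load (c a : Expr) : (Expr.load c a).val A = A (c.val A) (a.val A) := rfl
theorem Expr.val_add (x y : Expr) : (x + y).val A = x.val A + y.val A := rfl
theorem Expr.val_sub (x y : Expr) : (x - y).val A = x.val A - y.val A := rfl
theorem Expr.val_mul (x y : Expr) : (x * y).val A = x.val A * y.val A := rfl
theorem Expr.val_div (x y : Expr) : (x / y).val A = x.val A / y.val A := rfl
theorem Expr.val_mod (x y : Expr) : (x % y).val A = x.val A % y.val A := rfl

/-- One if the value of `e` is positive, and zero otherwise. -/
def Expr.pos (e : Expr) : Expr := .const 1 - (.const 1 - e)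

/-- The value of `x` if the value of `e` is zero, and the value of `y` otherwise. -/
def Expr.cond (e x y : Expr) : Expr := (.const 1 - e) * x + e.pos * y

theorem Expr.val_pos (e : Expr) : e.pos.val A = if e.val A = 0 then 0 else 1 := by
  simp only [pos, val_sub, val_const]
  split_ifs <;> omega

theorem Expr.val_cond (e x y : Expr) :
    (e.cond x y).val A = if e.val A = 0 then x.val A else y.val A := by
  simp only [cond, val_add, val_mul, val_pos, val_sub, val_const]
  split_ifs with h
  · simp [h]
  · rw [show 1 - e.val A = 0 by omega]; ring

theorem Expr.arraysLt_var (r : ℕ) : (Expr.var r).ArraysLt I A ↔ 1 < I := by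
  simp [var, ArraysLt, val]
theorem Expr.arraysLt_const (n : ℕ) : (Expr.const n).ArraysLt I A ↔ True := Iff.rfl
theorem Expr.arraysLt_load (c a : Expr) : (Expr.load c a).ArraysLt I A ↔
    c.ArraysLt I A ∧ a.ArraysLt I A ∧ c.val A < I := Iff.rfl
theorem Expr.arraysLt_add (x y : Expr) :
    (x + y).ArraysLt I A ↔ x.ArraysLt I A ∧ y.ArraysLt I A := Iff.rfl
theorem Expr.arraysLt_sub (x y : Expr) :
    (x - y).ArraysLt I A ↔ x.ArraysLt I A ∧ y.ArraysLt I A := Iff.rfl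
theorem Expr.arraysLt_mul (x y : Expr) :
    (x * y).ArraysLt I A ↔ x.ArraysLt I A ∧ y.ArraysLt I A := Iff.rfl
theorem Expr.arraysLt_div (x y : Expr) :
    (x / y).ArraysLt I A ↔ x.ArraysLt I A ∧ y.ArraysLt I A := Iff.rfl
theorem Expr.arraysLt_mod (x y : Expr) :
    (x % y).ArraysLt I A ↔ x.ArraysLt I A ∧ y.ArraysLt I A := Iff.rfl
theorem Expr.arraysLt_pos (e : Expr) : e.pos.ArraysLt I A ↔ e.ArraysLt I A := by
  simp only [pos, arraysLt_sub, arraysLt_const, true_and]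
-- A conditional is arithmetic and evaluates both branches, so array accesses in the discarded
-- branch must be legal as well.
theorem Expr.arraysLt_cond (e x y : Expr) :
    (e.cond x y).ArraysLt I A ↔ e.ArraysLt I A ∧ x.ArraysLt I A ∧ y.ArraysLt I A := by
  simp only [cond, arraysLt_add, arraysLt_mul, arraysLt_sub, arraysLt_const, arraysLt_pos]
  tauto

/-- Lets `decide` prove tameness of the concrete expressions of the program. -/
def Expr.decidableTame (k : ℕ) : (e : Expr) → Decidable (e.Tame k)
  | .const n => Nat.decLe n k
  | .bin .add x y | .bin .sub x y | .bin .mul x y | .bin .div x y | .bin .mod x y =>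
      @instDecidableAnd _ _ (decidableTame k x) (decidableTame k y)
  | .bin .land _ _ | .bin .lor _ _ | .bin .xor _ _ | .bin .shiftLeft _ _
  | .bin .shiftRight _ _ => instDecidableFalse
  | .load c a => @instDecidableAnd _ _ (decidableTame k c) (decidableTame k a)

instance (k : ℕ) (e : Expr) : Decidable (e.Tame k) := e.decidableTame k

/-- Bounds for the values in a store, for the constants of expressions, and for the values of
expressions whose width is at most `W`. -/
structure Bounds (I B V W : ℕ) : Prop where
  arrays : 5 ≤ I
  const : 16 ≤ V
  pow : V ^ W ≤ B
  width : 2 ≤ W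

variable {W : ℕ}

theorem Bounds.le (h : Bounds I B V W) : V ≤ B :=
  (Nat.le_self_pow (by have := h.width; omega) V).trans h.pow

theorem Bounds.lt (h : Bounds I B V W) : V < B := by
  have h1 := h.const
  have h2 : V ^ 2 ≤ V ^ W := Nat.pow_le_pow_right (by omega) h.width
  have h3 := h2.trans h.pow
  nlinarith

theorem Bounds.ok (h : Bounds I B V W) (hA : ∀ c a, A c a ≤ V) {e : Expr} (he : e.Tame 16)
    (hw : e.width ≤ W) (hI : e.ArraysLt I A) : e.Ok I B A :=
  he.ok hA (by have := h.const; omega) h.const hI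
    ((Nat.pow_le_pow_right (by have := h.const; omega) hw).trans h.pow)

theorem Bounds.assign (h : Bounds I B V W) (hA : ∀ c a, A c a ≤ V) {r : ℕ} (hr : r ≤ 16)
    {e : Expr} (he : e.Tame 16) (hw : e.width ≤ W) (hI : e.ArraysLt I A) {v : ℕ}
    (hv : e.val A = v) :
    Exec I B (.assign r e) A (A.set 1 r v) (e.cost + 6) := by
  have h1 := h.arrays
  have h2 := h.const
  have h3 := h.le
  subst hv
  exact Exec.assign (by omega) (by omega) (by omega) (h.ok hA he hw hI)

theorem Store.set_var (A : Store) (r v r' : ℕ) :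
    A.set 1 r v 1 r' = if r' = r then v else A 1 r' := by
  by_cases h : r' = r
  · subst h; simp [Store.set]
  · simp [Store.set, h]

end

end RAM

namespace GapSubseq

open RAM

/-! ### The program -/

/-- Content of an input cell. -/
def inputE (e : Expr) : Expr := .load (.const 0) e

/-- The first name is behind the input length and the number of constraints, at address `2`; a block
at `p` with `L` words is followed by the next one at `p + L + 1`. -/
def pointerE : Expr :=
  .cond (.var 0) (.const 2)
    (.load (.const 2) (.var 0 - .const 1) +
      inputE (.load (.const 2) (.var 0 - .const 1)) + .const 1)

/-- Compute the number of constraints (variable 8), the addresses of their names (array 2), the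
address of the block of the first string (variable 6), the length of the two strings with a
separator (variable 5), its square (variable 7), and the length of the first string (variable 9). -/
def setupS : Stmt :=
  .seq (.assign 8 (inputE (.const 1))) <|
  .seq (.fill (.const 2) (.var 8 + .const 1) pointerE) <|
  .seq (.assign 6 (.load (.const 2) (.var 8))) <|
  .seq (.assign 5 (inputE (.const 0) - .var 6)) <|
  .seq (.assign 7 (.var 5 * .var 5)) <|
  .assign 9 (inputE (.var 6))

/-- The initial memory of the decider, cell by cell: total length, block of the name (address in
variable 10, length in 11), length of the gap (13), and the gap, which begins right after the
position in variable 12. -/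
def queryE : Expr :=
  .cond (.var 0) (.var 11 + .var 13 + .const 2) <|
  .cond (.var 0 - (.var 11 + .const 1)) (inputE (.var 10 + .var 0 - .const 1)) <|
  .cond (.var 0 - (.var 11 + .const 2)) (.var 13) <|
  inputE (.var 6 + .const 1 + .var 12 + (.var 0 - (.var 11 + .const 2)))

/-- Ask the question whose number is in the variable 4, in a fresh array. -/
def queryS (prog : Program) : Stmt :=
  .seq (.assign 3 (.const 5 + .var 4)) <|
  .seq (.assign 10 (.load (.const 2) (.var 4 / .var 7))) <|
  .seq (.assign 11 (inputE (.var 10))) <|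
  .seq (.assign 12 (.var 4 / .var 5 % .var 5)) <|
  .seq (.assign 13 (.var 4 % .var 5 - (.var 12 + .const 1))) <|
  .seq (.fill (.var 3) (.var 11 + .var 13 + .const 3) queryE) <|
  .seq (simulate prog) <|
  .seq (.assign 2 (.const 0)) <|
  .assign 4 (.var 4 + .const 1)

def queriesS (prog : Program) : Stmt := .loop (.var 8 * .var 7 - .var 4) (queryS prog)

/-- An index of the array `3` is a mixed-radix number with the digits modulus, layer (base `l + 2`),
target pair and source pair (both base `|z|^2`). A pair is a two-digit number in base `|z|`. -/
def layerE : Expr := .var 0 / .var 7 / .var 7 % (.var 8 + .const 2)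

def modulusE : Expr := .var 0 / .var 7 / .var 7 / (.var 8 + .const 2)

def targetE : Expr := .var 0 / .var 7 % .var 7

def sourceE : Expr := .var 0 % .var 7

def letterE (a : Expr) : Expr := inputE (.var 6 + .const 1 + a)

def sameLetterE (a b : Expr) : Expr :=
  .const 1 - ((letterE a - letterE b) + (letterE b - letterE a))

def posSignE (a : Expr) : Expr := (.var 9 - a).pos + modulusE * (a - .var 9).pos

def answerE (a b : Expr) : Expr :=
  .load (.const 5 + (((layerE - .const 1) * .var 5 + a) * .var 5 + b)) (.const 0)

def linkE (a b : Expr) : Expr :=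
  (b - a).pos * (.const 1 - (.const 1 - (a - .var 9)) * (.const 1 - (.var 9 - b))) * answerE a b

/-- The finished entry of the preceding layer whose target is the current source: its partial sum
has run up to the last source, `|z|^2 - 1`. -/
def previousE : Expr :=
  .load (.const 3) (((.var 0 / .var 7 / .var 7 - .const 1) * .var 7 + sourceE) * .var 7 +
    (.var 7 - .const 1))

def firstE : Expr :=
  sameLetterE (targetE / .var 5) (targetE % .var 5) *
    (posSignE (targetE / .var 5) * posSignE (targetE % .var 5))

def coefficientE : Expr :=
  sameLetterE (targetE / .var 5) (targetE % .var 5) *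
    (linkE (sourceE / .var 5) (targetE / .var 5) * linkE (sourceE % .var 5) (targetE % .var 5))

def termE : Expr :=
  .cond layerE (.cond sourceE firstE (.const 0))
    (.cond (layerE - .var 8) (coefficientE * previousE) previousE)

def tableE : Expr :=
  (.cond sourceE (.const 0) (.load (.const 3) (.var 0 - .const 1)) + termE) %
    (modulusE + .const 1)

def moduliE : Expr := .const 4 * (.var 5 * (.var 8 + .const 1)) + .const 8

def tableSizeE : Expr := moduliE * (.var 8 + .const 2) * .var 7 * .var 7

/-- Residues are nonnegative, so their running sum ends at zero exactly if all of them vanish. -/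
def resultE : Expr :=
  .cond (.var 0) (.const 0)
    (.load (.const 4) (.var 0 - .const 1) + .load (.const 3)
      (((.var 0 - .const 1) * (.var 8 + .const 2) + (.var 8 + .const 1)) * .var 7 * .var 7 +
        (.var 7 - .const 1)))

def decideS (prog : Program) : Stmt :=
  .seq setupS <|
  .seq (queriesS prog) <|
  .seq (.fill (.const 3) tableSizeE tableE) <|
  .fill (.const 4) (moduliE + .const 1) resultE

def outputE : Expr := .cond (.load (.const 4) moduliE) (.const 1) (.const 0)

/-- A common bound for the widths of all expressions. -/
def maxWidth : ℕ := pointerE.width + queryE.width + tableE.width + tableSizeE.width +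
  resultE.width + outputE.width + 16

/-! ### The tables -/

section

variable (z : List ℕ) (s : ℕ) (c : ℕ → Language ℕ) (l m : ℕ)

/-- Layers `0, …, l` produce `table`; the additional layer `l + 1` has all coefficients one and
produces `tableSum` by the same loop. Layer `0` puts its value into the single term `x = 0`, and `j
- l = 0` means `j ≤ l`. -/
noncomputable def layerTerm (j i x : ℕ) : ℕ :=
  if j = 0 then
    if x = 0 then sameLetter z (i / z.length) (i % z.length) * (posSign s m (i / z.length) *
      posSign s m (i % z.length)) else 0
  else if j - l = 0 then
    sameLetter z (i / z.length) (i % z.length) *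
        (link z s (c (j - 1)) (x / z.length) (i / z.length) *
          link z s (c (j - 1)) (x % z.length) (i % z.length)) * table z s c m (j - 1) x
  else table z s c m (j - 1) x

/-- Partial sums get entries of their own, so that every entry needs boundedly many operations and a
single loop without nesting suffices. -/
noncomputable def layerSum (j i k : ℕ) : ℕ :=
  (∑ x ∈ Finset.range (k + 1), layerTerm z s c l m j i x) % (m + 1)

theorem layerSum_rec (j i k : ℕ) :
    ((if k = 0 then 0 else layerSum z s c l m j i (k - 1)) + layerTerm z s c l m j i k) % (m + 1) =
      layerSum z s c l m j i k := by
  cases k with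
  | zero => simp [layerSum]
  | succ k =>
    rw [if_neg (Nat.succ_ne_zero k), Nat.add_sub_cancel]
    simp only [layerSum]
    rw [Finset.sum_range_succ _ (k + 1), Nat.mod_add_mod]

variable {z}

theorem layerSum_last (hz : 0 < z.length) {j : ℕ} (hj : j ≤ l) (i : ℕ) :
    layerSum z s c l m j i (z.length * z.length - 1) = table z s c m j i := by
  have hQ : z.length * z.length - 1 + 1 = z.length * z.length :=
    Nat.sub_add_cancel (Nat.mul_pos hz hz)
  cases j with
  | zero =>
    rw [layerSum, hQ, table]
    simp only [layerTerm, if_true]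
    rw [Finset.sum_ite_eq' , if_pos (Finset.mem_range.2 (Nat.mul_pos hz hz))]
  | succ j =>
    rw [layerSum, hQ, table]
    simp only [layerTerm, Nat.succ_ne_zero, if_false, Nat.add_sub_cancel,
      show j + 1 - l = 0 by omega, if_true]

theorem layerSum_top (hz : 0 < z.length) (i : ℕ) :
    layerSum z s c l m (l + 1) i (z.length * z.length - 1) = tableSum z s c l m := by
  have hQ : z.length * z.length - 1 + 1 = z.length * z.length :=
    Nat.sub_add_cancel (Nat.mul_pos hz hz)
  rw [layerSum, hQ, tableSum]
  simp only [layerTerm, Nat.succ_ne_zero, if_false, Nat.add_sub_cancel,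
      show l + 1 - l = 1 by omega, one_ne_zero]

variable (z) in
/-- The content of the array `3`. -/
noncomputable def flatTable (u : ℕ) : ℕ :=
  layerSum z s c l (u / (z.length * z.length) / (z.length * z.length) / (l + 2))
    (u / (z.length * z.length) / (z.length * z.length) % (l + 2))
    (u / (z.length * z.length) % (z.length * z.length)) (u % (z.length * z.length))

theorem flatTable_eq {w i k : ℕ} (hi : i < z.length * z.length) (hk : k < z.length * z.length) :
    flatTable z s c l ((w * (z.length * z.length) + i) * (z.length * z.length) + k) =
      layerSum z s c l (w / (l + 2)) (w % (l + 2)) i k := by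
  unfold flatTable
  generalize z.length * z.length = Q at *
  have h1 : ((w * Q + i) * Q + k) / Q = w * Q + i := by
    rw [mul_comm, Nat.mul_add_div (by omega), Nat.div_eq_of_lt hk, add_zero]
  have h2 : (w * Q + i) / Q = w := by
    rw [mul_comm, Nat.mul_add_div (by omega), Nat.div_eq_of_lt hi, add_zero]
  have h3 : ((w * Q + i) * Q + k) % Q = k := by
    rw [mul_comm, Nat.mul_add_mod, Nat.mod_eq_of_lt hk]
  have h4 : (w * Q + i) % Q = i := by
    rw [mul_comm, Nat.mul_add_mod, Nat.mod_eq_of_lt hi]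
  rw [h1, h2, h3, h4]

/-- If the last digit is nonzero, subtracting one changes no other digit. -/
theorem flatTable_pred {u : ℕ} (hz : 0 < z.length) (hu : u % (z.length * z.length) ≠ 0) :
    flatTable z s c l (u - 1) =
      layerSum z s c l (u / (z.length * z.length) / (z.length * z.length) / (l + 2))
        (u / (z.length * z.length) / (z.length * z.length) % (l + 2))
        (u / (z.length * z.length) % (z.length * z.length)) (u % (z.length * z.length) - 1) := by
  have hQ : 0 < z.length * z.length := Nat.mul_pos hz hz
  rw [← flatTable_eq _ _ _ (Nat.mod_lt _ hQ) ((Nat.sub_le _ _).trans_lt (Nat.mod_lt u hQ))]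
  congr 1
  generalize z.length * z.length = Q at *
  rw [Nat.div_add_mod', ← Nat.add_sub_assoc (by omega), Nat.div_add_mod']

theorem flatTable_le {u n : ℕ} (h : u < n * (l + 2) * (z.length * z.length) *
    (z.length * z.length)) : flatTable z s c l u < n := by
  have h1 : u / (z.length * z.length) / (z.length * z.length) / (l + 2) < n := by
    refine Nat.div_lt_of_lt_mul (Nat.div_lt_of_lt_mul (Nat.div_lt_of_lt_mul ?_))
    refine h.trans_eq ?_
    ring
  have h2 : flatTable z s c l u < u / (z.length * z.length) / (z.length * z.length) / (l + 2) + 1 :=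
    Nat.mod_lt _ (Nat.succ_pos _)
  omega

end

end GapSubseq

namespace GapSubseq

open RAM

/-! ### Correctness of the preparation -/

/-- The layout of the input: the number `l` of constraints, the addresses `ptr` of their names,
the two strings `z` with a separator at the position `s`. -/
structure InputData (x : List ℕ) (l : ℕ) (ptr : ℕ → ℕ) (z : List ℕ) (s : ℕ) : Prop where
  count : inputMem x 1 = l
  ptr_zero : ptr 0 = 2
  ptr_succ : ∀ j < l, ptr (j + 1) = ptr j + inputMem x (ptr j) + 1
  length : x.length = ptr l + z.length
  sep : inputMem x (ptr l) = s
  letter : ∀ a, inputMem x (ptr l + 1 + a) = z.getD a 0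
  pos : 0 < z.length

/-- A bound for all values in the store. -/
structure Large (x : List ℕ) (l L V : ℕ) : Prop where
  word : wordRange x ≤ V
  square : (x.length + 3) * (x.length + 3) ≤ V
  queries : 5 + l * (L * L) ≤ V
  table : (4 * (L * (l + 1)) + 8) * (l + 2) * (L * L) * (L * L) ≤ V
  moduli : (4 * (L * (l + 1)) + 9) * (4 * (L * (l + 1)) + 9) ≤ V

variable {x : List ℕ} {l : ℕ} {ptr : ℕ → ℕ} {z : List ℕ} {s : ℕ} {I B V : ℕ}

theorem InputData.le_ptr (h : InputData x l ptr z s) {j : ℕ} (hj : j ≤ l) : j + 2 ≤ ptr j := by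
  induction j with
  | zero => rw [h.ptr_zero]
  | succ j ih =>
    have := ih (by omega)
    rw [h.ptr_succ j (by omega)]; omega

theorem InputData.ptr_le (h : InputData x l ptr z s) {j k : ℕ} (hjk : j ≤ k) (hk : k ≤ l) :
    ptr j ≤ ptr k := by
  induction k with
  | zero => obtain rfl : j = 0 := by omega
            exact le_rfl
  | succ k ih =>
    rcases Nat.eq_or_lt_of_le hjk with rfl | hjk
    · exact le_rfl
    · have := ih (by omega) (by omega)
      rw [h.ptr_succ k (by omega)]; omega

/-- The state of the store after the preparation. -/
structure Ready (x : List ℕ) (l : ℕ) (ptr : ℕ → ℕ) (z : List ℕ) (s V : ℕ) (A : Store) : Prop where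
  input : A 0 = inputMem x
  names : ∀ j ≤ l, A 2 j = ptr j
  width : A 1 5 = z.length
  start : A 1 6 = ptr l
  square : A 1 7 = z.length * z.length
  count : A 1 8 = l
  sep : A 1 9 = s
  le : ∀ c a, A c a ≤ V

theorem Ready.filled {A A' : Store} {c n t : ℕ} {f : ℕ → ℕ} (h : Ready x l ptr z s V A)
    (hc : 3 ≤ c) (hA : Filled A c f n t A') (ht : t ≤ n) (hn : n ≤ V) (hf : ∀ a < t, f a ≤ V) :
    Ready x l ptr z s V A' where
  input := by rw [hA.other 0 (by omega) (by omega), h.input]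
  names j hj := by rw [hA.other 2 (by omega) (by omega), h.names j hj]
  width := by rw [hA.var _ (by omega), h.width]
  start := by rw [hA.var _ (by omega), h.start]
  square := by rw [hA.var _ (by omega), h.square]
  count := by rw [hA.var _ (by omega), h.count]
  sep := by rw [hA.var _ (by omega), h.sep]
  le := hA.le ht hn h.le hf

theorem Ready.set {A : Store} {r v : ℕ} (h : Ready x l ptr z s V A) (hr : r < 5 ∨ 9 < r)
    (hv : v ≤ V) : Ready x l ptr z s V (A.set 1 r v) where
  input := by rw [Store.set_array_ne _ _ _ (by omega), h.input]
  names j hj := by rw [Store.set_array_ne _ _ _ (by omega), h.names j hj]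
  width := by rw [Store.set_index_ne _ _ _ (by omega), h.width]
  start := by rw [Store.set_index_ne _ _ _ (by omega), h.start]
  square := by rw [Store.set_index_ne _ _ _ (by omega), h.square]
  count := by rw [Store.set_index_ne _ _ _ (by omega), h.count]
  sep := by rw [Store.set_index_ne _ _ _ (by omega), h.sep]
  le := Store.set_le h.le _ _ hv

theorem Ready.hostStore {A : Store} {c : ℕ} {cfg : Config} (h : Ready x l ptr z s V A)
    (hc : 3 ≤ c) (hpc : cfg.pc ≤ V) (hm : ∀ b, cfg.mem b ≤ V) :
    Ready x l ptr z s V (hostStore A c cfg) where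
  input := by rw [hostStore_other (by omega) (by omega), h.input]
  names j hj := by rw [hostStore_other (by omega) (by omega), h.names j hj]
  width := by rw [hostStore_var (by omega) (by omega), h.width]
  start := by rw [hostStore_var (by omega) (by omega), h.start]
  square := by rw [hostStore_var (by omega) (by omega), h.square]
  count := by rw [hostStore_var (by omega) (by omega), h.count]
  sep := by rw [hostStore_var (by omega) (by omega), h.sep]
  le c' a := by
    by_cases h1 : c' = c
    · subst h1; rw [hostStore_array]; exact hm a
    · by_cases h2 : c' = 1
      · subst h2
        by_cases h3 : a = 2
        · subst h3; rw [hostStore_pc (by omega)]; exact hpc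
        · rw [hostStore_var (by omega) h3]; exact h.le _ _
      · rw [hostStore_other h1 h2]; exact h.le _ _

theorem small_width {w : ℕ} (h : w ≤ 16) : w ≤ maxWidth := by unfold maxWidth; omega

theorem exec_setup (hx : InputData x l ptr z s) (hB : Bounds I B V maxWidth)
    (hV : Large x l z.length V) :
    ∃ A t, Exec I B setupS (inputStore x) A t ∧ Ready x l ptr z s V A ∧ A 1 2 = 0 ∧ A 1 4 = 0 ∧
      (∀ c, 3 ≤ c → A c = fun _ => 0) ∧ t ≤ (l + 2) * 1000 := by
  have hI := hB.arrays
  have hB1 := hB.lt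
  have hV1 := hV.word
  have hV2 := hV.square
  have hlen := hx.length
  have hl2 := hx.le_ptr le_rfl
  have hpos := hx.pos
  have hLL : z.length * z.length ≤ (x.length + 3) * (x.length + 3) :=
    Nat.mul_le_mul (by omega) (by omega)
  have hself : x.length + 3 ≤ (x.length + 3) * (x.length + 3) :=
    Nat.le_mul_of_pos_left _ (by omega)
  have hA0 : ∀ c a, inputStore x c a ≤ V := fun c a => by
    unfold inputStore
    split_ifs
    · exact (inputMem_le x a).trans hV1
    · exact Nat.zero_le _
  have x1 := hB.assign hA0 (r := 8) (e := inputE (.const 1)) (v := l) (by decide) (by decide)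
    (small_width (by decide))
    (by simp only [true_and, inputE, Expr.arraysLt_load, Expr.arraysLt_const, Expr.val_const]; omega)
    (by simp [inputE, Expr.val_load, Expr.val_const, inputStore, hx.count])
  have hA1 := Store.set_le hA0 1 8 (show l ≤ V by omega)
  obtain ⟨A2, t2, x2, f2, ht2⟩ := Exec.fill (I := I) (B := B) (A := (inputStore x).set 1 8 l)
    (c := 2) (f := ptr) (n := l + 1) (cE := .const 2) (nE := .var 8 + .const 1) (e := pointerE)
    (by omega) (by omega) (by omega) (by omega)
    ⟨hB.ok hA1 (by decide) (small_width (by decide))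
      (by simp only [and_true, Expr.arraysLt_add, Expr.arraysLt_var, Expr.arraysLt_const]; omega),
      by simp [Expr.val_add, Expr.val_const, Store.set_var]⟩
    (fun t ht A' hA' => ⟨show 2 ≤ B by omega, rfl⟩)
    (fun t ht A' hA' => by
      have hle : ∀ a < t, ptr a ≤ V := fun a ha => by
        have := hx.ptr_le (j := a) (k := l) (by omega) le_rfl; omega
      refine ⟨hB.ok (hA'.le (by omega) (by omega) hA1 hle) (by decide)
        (by unfold maxWidth; omega) ?_, ?_⟩
      · simp only [pointerE, inputE, Expr.arraysLt_cond, Expr.arraysLt_add, Expr.arraysLt_sub,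
          Expr.arraysLt_var, Expr.arraysLt_const, Expr.arraysLt_load, Expr.val_const, true_and,
          and_true]
        omega
      · have h0 : A' 0 = inputMem x := by
          rw [hA'.other 0 (by omega) (by omega), Store.set_array_ne _ _ _ (by omega)]
          funext a; simp [inputStore]
        simp only [pointerE, inputE, Expr.val_cond, Expr.val_var, Expr.val_const, Expr.val_add,
          Expr.val_load, Expr.val_sub, hA'.counter, h0]
        split_ifs with ht0
        · rw [ht0, hx.ptr_zero]
        · rw [hA'.lt _ (by omega), ← hx.ptr_succ _ (by omega), Nat.sub_add_cancel (by omega)])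
  have hA2 := f2.le le_rfl (by omega : l + 1 ≤ V) hA1 (fun a ha => by
    have := hx.ptr_le (j := a) (k := l) (by omega) le_rfl; omega)
  have v8 : A2 1 8 = l := by rw [f2.var _ (by omega), Store.set_same]
  have v0 : A2 0 = inputMem x := by
    rw [f2.other 0 (by omega) (by omega), Store.set_array_ne _ _ _ (by omega)]
    funext a; simp [inputStore]
  have x3 := hB.assign hA2 (r := 6) (e := .load (.const 2) (.var 8)) (v := ptr l) (by decide)
    (by decide) (small_width (by decide))
    (by simp only [true_and, Expr.arraysLt_load, Expr.arraysLt_const, Expr.val_const, Expr.arraysLt_var]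
        omega)
    (by simp only [Expr.val_load, Expr.val_const, Expr.val_var, v8]; exact f2.lt l (by omega))
  have hA3 := Store.set_le hA2 1 6 (show ptr l ≤ V by omega)
  have x4 := hB.assign hA3 (r := 5) (e := inputE (.const 0) - .var 6) (v := z.length) (by decide)
    (by decide) (small_width (by decide))
    (by simp only [true_and, inputE, Expr.arraysLt_sub, Expr.arraysLt_load, Expr.arraysLt_const,
          Expr.val_const, Expr.arraysLt_var]
        omega)
    (by
      simp only [inputE, Expr.val_load, Expr.val_const, Expr.val_var, Expr.val_sub,
        Store.set_array_ne A2 6 (ptr l) (show 0 ≠ 1 by omega), Store.set_same, v0, inputMem_zero]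
      omega)
  have hA4 := Store.set_le hA3 1 5 (show z.length ≤ V by omega)
  have x5 := hB.assign hA4 (r := 7) (e := .var 5 * .var 5) (v := z.length * z.length) (by decide)
    (by decide) (small_width (by decide))
    (by simp only [Expr.arraysLt_mul, Expr.arraysLt_var]; omega)
    (by simp only [Expr.val_mul, Expr.val_var, Store.set_same])
  have hA5 := Store.set_le hA4 1 7 (show z.length * z.length ≤ V by omega)
  have x6 := hB.assign hA5 (r := 9) (e := inputE (.var 6)) (v := s) (by decide)
    (by decide) (small_width (by decide))
    (by simp only [true_and, inputE, Expr.arraysLt_load, Expr.arraysLt_const, Expr.val_const,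
          Expr.arraysLt_var]
        omega)
    (by
      simp only [inputE, Expr.val_load, Expr.val_const, Expr.val_var, Store.set_var,
        Store.set_array_ne _ _ _ (show 0 ≠ 1 by omega), v0]
      simpa using hx.sep)
  have hs : s ≤ V := by rw [← hx.sep]; exact (inputMem_le _ _).trans hV1
  have hA6 := Store.set_le hA5 1 9 hs
  refine ⟨_, _, x1.seq (x2.seq (x3.seq (x4.seq (x5.seq x6)))),
    ⟨?_, fun j hj => ?_, ?_, ?_, ?_, ?_, ?_, hA6⟩, ?_, ?_, fun c hc => ?_, ?_⟩
  · simp only [Store.set_array_ne _ _ _ (show 0 ≠ 1 by omega), v0]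
  · simp only [Store.set_array_ne _ _ _ (show 2 ≠ 1 by omega)]
    exact f2.lt j (by omega)
  · simp [Store.set_var]
  · simp [Store.set_var]
  · simp [Store.set_var]
  · simp [Store.set_var, v8]
  · simp [Store.set_var]
  · simp only [Store.set_var]
    simp [f2.var 2 le_rfl, Store.set_var, inputStore]
  · simp only [Store.set_var]
    simp [f2.var 4 (by omega), Store.set_var, inputStore]
  · simp only [Store.set_array_ne _ _ _ (show c ≠ 1 by omega)]
    rw [f2.other c (by omega) (by omega), Store.set_array_ne _ _ _ (by omega)]
    funext a
    simp [inputStore, show c ≠ 0 by omega]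
  · have e1 : (inputE (.const 1)).cost = 6 := rfl
    have e2 : (.const 2 : Expr).cost + (.var 8 + .const 1 : Expr).cost + pointerE.cost + 43 ≤ 500 := by
      decide
    have e3 : (.load (.const 2) (.var 8) : Expr).cost +
      (inputE (.const 0) - .var 6 : Expr).cost + (.var 5 * .var 5 : Expr).cost +
      (inputE (.var 6)).cost ≤ 100 := by decide
    have := ht2.trans (Nat.mul_le_mul_left _ e2)
    omega

end GapSubseq

namespace GapSubseq

open RAM

/-! ### Correctness of the queries -/

variable {x : List ℕ} {l : ℕ} {ptr : ℕ → ℕ} {z : List ℕ} {s : ℕ} {I B V Tmax : ℕ} {prog : Program}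

/-- The program answers `ans` on an input that consists of the block at the address `p` of `x`
and of a string of length `u` after the address `q` of `x`. -/
def Answers (prog : Program) (x : List ℕ) (V Tmax p q u ans : ℕ) : Prop :=
  ∃ y T, y.length = inputMem x p + u + 2 ∧ y.length ≤ x.length ∧
    (∀ i, 0 < i → i ≤ inputMem x p + 1 → inputMem y i = inputMem x (p + i - 1)) ∧
    inputMem y (inputMem x p + 2) = u ∧
    (∀ i, inputMem x p + 2 < i → i ≤ inputMem x p + 2 + u →
      inputMem y i = inputMem x (q + (i - (inputMem x p + 2)))) ∧
    T ≤ Tmax ∧ prog.length ≤ (run prog y T).pc ∧ (run prog y T).mem 0 = ans ∧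
    ∀ t ≤ T, ∀ b, (run prog y t).mem b ≤ V

theorem hostStore_eq_self {A : Store} {c : ℕ} {cfg : Config} (hpc : A 1 2 = cfg.pc)
    (hm : A c = cfg.mem) : hostStore A c cfg = A := by
  unfold hostStore Store.set
  rw [← hpc, ← hm, Function.update_eq_self, Function.update_eq_self, Function.update_eq_self]

/-- The state of the store before the query with number `t`. -/
structure Queried (x : List ℕ) (l : ℕ) (ptr : ℕ → ℕ) (z : List ℕ) (s V : ℕ) (ans : ℕ → ℕ) (t : ℕ)
    (A : Store) : Prop where
  ready : Ready x l ptr z s V A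
  pc : A 1 2 = 0
  counter : A 1 4 = t
  fresh : ∀ k, t ≤ k → A (5 + k) = fun _ => 0
  done : ∀ k < t, A (5 + k) 0 = ans k

/-- An upper bound for the time of one query. -/
def queryCost (prog : Program) (n T : ℕ) : ℕ :=
  (n + 2) * 1000 + (T + 1) * simulationCost prog + 1000

/-- Each query uses a fresh array because the simulated program relies on zeros behind its input. -/
theorem exec_query (hx : InputData x l ptr z s) (hB : Bounds I B V maxWidth)
    (hV : Large x l z.length V) (hI : 5 + l * (z.length * z.length) ≤ I)
    (hlen : prog.length ≤ V) (hconst : ∀ i ∈ prog, i.maxConst ≤ V) {ans : ℕ → ℕ} {t : ℕ}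
    (ht : t < l * (z.length * z.length))
    (hans : Answers prog x V Tmax (ptr (t / (z.length * z.length)))
      (ptr l + 1 + t / z.length % z.length) (t % z.length - (t / z.length % z.length + 1)) (ans t))
    {A : Store} (hA : Queried x l ptr z s V ans t A) :
    ∃ A' τ, Exec I B (queryS prog) A A' τ ∧ Queried x l ptr z s V ans (t + 1) A' ∧
      τ ≤ queryCost prog x.length Tmax := by
  have hI5 := hB.arrays
  have hB1 := hB.lt
  have hV1 := hV.word
  have hV2 := hV.square
  have hV3 := hV.queries
  have hV4 := hB.const
  have hself : x.length + 3 ≤ (x.length + 3) * (x.length + 3) :=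
    Nat.le_mul_of_pos_left _ (by omega)
  have hxl := hx.length
  have hj : t / (z.length * z.length) < l := Nat.div_lt_of_lt_mul (by rwa [mul_comm])
  have hpj := hx.ptr_le hj.le le_rfl
  have hla : t / z.length % z.length < z.length := Nat.mod_lt _ hx.pos
  have hlb : t % z.length < z.length := Nat.mod_lt _ hx.pos
  generalize hP : ptr (t / (z.length * z.length)) = P at *
  generalize hav : t / z.length % z.length = a at *
  generalize huv : t % z.length - (a + 1) = u at *
  obtain ⟨y, T, y1, y2, y3, y4, y5, y6, y7, y8, y9⟩ := hans
  have hnm : inputMem x P ≤ V := (inputMem_le _ _).trans hV1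
  have h0 := hA.ready
  have x1 := hB.assign h0.le (r := 3) (e := .const 5 + .var 4) (v := 5 + t) (by decide)
    (by decide) (small_width (by decide))
    (by simp only [Expr.arraysLt_add, Expr.arraysLt_const, Expr.arraysLt_var, true_and]; omega)
    (by simp only [Expr.val_add, Expr.val_const, Expr.val_var, hA.counter])
  have h1 := h0.set (r := 3) (v := 5 + t) (by omega) (by omega)
  have x2 := hB.assign h1.le (r := 10) (e := .load (.const 2) (.var 4 / .var 7)) (v := P)
    (by decide) (by decide) (small_width (by decide))
    (by
      simp only [Expr.arraysLt_load, Expr.arraysLt_const, Expr.arraysLt_var, true_and,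
        Expr.arraysLt_div, Expr.val_const]
      omega)
    (by
      simp only [Expr.val_load, Expr.val_const, Expr.val_div, Expr.val_var, h1.square]
      rw [Store.set_index_ne _ _ _ (by omega), hA.counter, h1.names _ hj.le, hP])
  have h2 := h1.set (r := 10) (v := P) (by omega) (by omega)
  have x3 := hB.assign h2.le (r := 11) (e := inputE (.var 10)) (v := inputMem x P)
    (by decide) (by decide) (small_width (by decide))
    (by
      simp only [inputE, Expr.arraysLt_load, Expr.arraysLt_const, Expr.arraysLt_var, true_and,
        Expr.val_const]
      omega)
    (by simp only [inputE, Expr.val_load, Expr.val_const, Expr.val_var, h2.input, Store.set_same])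
  have h3 := h2.set (r := 11) (v := inputMem x P) (by omega) hnm
  have x4 := hB.assign h3.le (r := 12) (e := .var 4 / .var 5 % .var 5) (v := a)
    (by decide) (by decide) (small_width (by decide))
    (by simp only [Expr.arraysLt_mod, Expr.arraysLt_div, Expr.arraysLt_var]; omega)
    (by
      simp only [Expr.val_mod, Expr.val_div, Expr.val_var, h3.width]
      simp [Store.set_var, hA.counter, hav])
  have h4 := h3.set (r := 12) (v := a) (by omega) (by omega)
  have x5 := hB.assign h4.le (r := 13) (e := .var 4 % .var 5 - (.var 12 + .const 1)) (v := u)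
    (by decide) (by decide) (small_width (by decide))
    (by
      simp only [Expr.arraysLt_mod, Expr.arraysLt_sub, Expr.arraysLt_add, Expr.arraysLt_var,
        Expr.arraysLt_const, and_true]
      omega)
    (by
      simp only [Expr.val_mod, Expr.val_sub, Expr.val_add, Expr.val_const, Expr.val_var, h4.width]
      simp [Store.set_var, hA.counter, huv])
  have h5 := h4.set (r := 13) (v := u) (by omega) (by omega)
  set A5 := ((((A.set 1 3 (5 + t)).set 1 10 P).set 1 11 (inputMem x P)).set 1 12 a).set 1 13 u
    with hA5
  have v3 : A5 1 3 = 5 + t := by simp [hA5, Store.set_var]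
  have v2 : A5 1 2 = 0 := by simp [hA5, Store.set_var, hA.pc]
  have v4 : A5 1 4 = t := by simp [hA5, Store.set_var, hA.counter]
  have v10 : A5 1 10 = P := by simp [hA5, Store.set_var]
  have v11 : A5 1 11 = inputMem x P := by simp [hA5, Store.set_var]
  have v12 : A5 1 12 = a := by simp [hA5, Store.set_var]
  have v13 : A5 1 13 = u := by simp [hA5, Store.set_var]
  have vo : ∀ c, c ≠ 1 → A5 c = A c := fun c hc => by
    simp only [hA5, Store.set_array_ne _ _ _ hc]
  -- At time `0` the memory of the run is the input itself.
  have hy : ∀ i, inputMem y i ≤ V := fun i => y9 0 (Nat.zero_le _) i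
  obtain ⟨A6, t6, x6, f6, ht6⟩ := Exec.fill (I := I) (B := B) (A := A5)
    (c := 5 + t) (f := inputMem y) (n := y.length + 1) (cE := .var 3)
    (nE := .var 11 + .var 13 + .const 3) (e := queryE)
    (by omega) (by omega) (by omega) (by omega)
    ⟨hB.ok h5.le (by decide) (small_width (by decide))
      (by
        simp only [Expr.arraysLt_add, Expr.arraysLt_var, Expr.arraysLt_const, and_true]; omega),
      by simp only [Expr.val_add, Expr.val_const, Expr.val_var, v11, v13]; omega⟩
    (fun i hi A' hA' => by
      have e3 : A' 1 3 = 5 + t := by rw [hA'.var _ (by omega), v3]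
      exact ⟨Expr.ok_var (by omega) (by omega) (by omega) (by omega), e3⟩)
    (fun i hi A' hA' => by
      have h6 := h5.filled (by omega) hA' hi.le (by omega) fun i _ => hy i
      refine ⟨hB.ok h6.le (by decide) (by unfold maxWidth; omega) ?_, ?_⟩
      · simp only [queryE, inputE, Expr.arraysLt_cond, Expr.arraysLt_add, Expr.arraysLt_sub,
          Expr.arraysLt_var, Expr.arraysLt_const, Expr.arraysLt_load, Expr.val_const, true_and,
          and_true]
        omega
      · simp only [queryE, inputE, Expr.val_cond, Expr.val_var, Expr.val_const, Expr.val_add,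
          Expr.val_load, Expr.val_sub, hA'.counter, h6.input, h6.start, hA'.var 10 (by omega),
          hA'.var 11 (by omega), hA'.var 12 (by omega), hA'.var 13 (by omega), v10, v11, v12, v13]
        split_ifs with c1 c2 c3
        · rw [c1, inputMem_zero, y1]
        · exact (y3 i (by omega) (by omega)).symm
        · rw [show i = inputMem x P + 2 by omega, y4]
        · exact (y5 i (by omega) (by omega)).symm)
  have h6 := h5.filled (by omega) f6 le_rfl (by omega) fun i _ => hy i
  have w2 : A6 1 2 = 0 := by rw [f6.var _ (by omega), v2]
  have w3 : A6 1 3 = 5 + t := by rw [f6.var _ (by omega), v3]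
  have w4 : A6 1 4 = t := by rw [f6.var _ (by omega), v4]
  -- Equality on all cells, not only the written ones: the others are zero since the array is fresh.
  have wc : A6 (5 + t) = inputMem y := by
    funext i
    rcases lt_or_ge i (y.length + 1) with hi | hi
    · exact f6.lt i hi
    · rw [f6.ge i hi, vo _ (by omega), hA.fresh t le_rfl, inputMem_of_gt (by omega)]
  have hhost : HostOk I B A6 (5 + t) := ⟨w3, by omega, by omega, by omega, by omega, by omega⟩
  obtain ⟨t7, x7, ht7⟩ := hhost.exec_simulate (cfg := initial y) (by omega : prog.length ≤ B)
    (fun i hi => (hconst i hi).trans hB1.le) y7 (fun r hr b => (y9 r hr b).trans hB1.le)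
    (Nat.zero_le _)
  rw [hostStore_eq_self (c := 5 + t) (cfg := initial y) w2 wc] at x7
  have x8 := Exec.assign (I := I) (B := B)
    (A := RAM.hostStore A6 (5 + t) ((step prog)^[T] (initial y)))
    (r := 2) (e := .const 0) (by omega) (by omega) (by omega) (show 0 ≤ B by omega)
  rw [hostStore_set_pc (by omega)] at x8
  have h8 := h6.hostStore (c := 5 + t) (cfg := ⟨0, ((step prog)^[T] (initial y)).mem⟩)
    (by omega) (Nat.zero_le _) (y9 T le_rfl)
  have u4 : RAM.hostStore A6 (5 + t) ⟨0, ((step prog)^[T] (initial y)).mem⟩ 1 4 = t := by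
    rw [hostStore_var (by omega) (by omega), w4]
  have x9 := hB.assign h8.le (r := 4) (e := .var 4 + .const 1) (v := t + 1) (by decide)
    (by decide) (small_width (by decide))
    (by simp only [Expr.arraysLt_add, Expr.arraysLt_const, Expr.arraysLt_var, and_true]; omega)
    (by simp only [Expr.val_add, Expr.val_const, Expr.val_var, u4])
  refine ⟨_, _, x1.seq (x2.seq (x3.seq (x4.seq (x5.seq (x6.seq (x7.seq (x8.seq x9))))))),
    ⟨h8.set (by omega) (by omega), ?_, ?_, fun k hk => ?_, fun k hk => ?_⟩, ?_⟩
  · rw [Store.set_index_ne _ _ _ (by omega), hostStore_pc (by omega)]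
  · rw [Store.set_same]
  · rw [Store.set_array_ne _ _ _ (by omega), hostStore_other (by omega) (by omega),
      f6.other _ (by omega) (by omega), vo _ (by omega), hA.fresh k (by omega)]
  · rw [Store.set_array_ne _ _ _ (by omega)]
    by_cases hkt : k = t
    · subst hkt
      rw [hostStore_array]; exact y8
    · rw [hostStore_other (by omega) (by omega),
        f6.other _ (by omega) (by omega), vo _ (by omega), hA.done k (by omega)]
  · have e1 : (.const 5 + .var 4 : Expr).cost + (.load (.const 2) (.var 4 / .var 7) : Expr).cost +
        (inputE (.var 10)).cost + (.var 4 / .var 5 % .var 5 : Expr).cost +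
        (.var 4 % .var 5 - (.var 12 + .const 1) : Expr).cost + (.const 0 : Expr).cost +
        (.var 4 + .const 1 : Expr).cost ≤ 500 := by decide
    have e2 : (.var 3 : Expr).cost + (.var 11 + .var 13 + .const 3 : Expr).cost + queryE.cost +
        43 ≤ 1000 := by decide
    have e3 := ht6.trans (Nat.mul_le_mul (show y.length + 1 + 1 ≤ x.length + 2 by omega) e2)
    have e4 := ht7.trans (Nat.mul_le_mul_right _ (show T + 1 ≤ Tmax + 1 by omega))
    unfold queryCost
    omega

theorem exec_queries_loop (hx : InputData x l ptr z s) (hB : Bounds I B V maxWidth)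
    (hV : Large x l z.length V) (hI : 5 + l * (z.length * z.length) ≤ I)
    (hlen : prog.length ≤ V) (hconst : ∀ i ∈ prog, i.maxConst ≤ V) {ans : ℕ → ℕ}
    (hans : ∀ t < l * (z.length * z.length), Answers prog x V Tmax
      (ptr (t / (z.length * z.length))) (ptr l + 1 + t / z.length % z.length)
      (t % z.length - (t / z.length % z.length + 1)) (ans t))
    {k t : ℕ} (hk : k + t = l * (z.length * z.length)) {A : Store}
    (hA : Queried x l ptr z s V ans t A) :
    ∃ A' τ, Exec I B (queriesS prog) A A' τ ∧
      Queried x l ptr z s V ans (l * (z.length * z.length)) A' ∧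
      τ ≤ k * (queryCost prog x.length Tmax + 100) + 100 := by
  have hI5 := hB.arrays
  have hok : (.var 8 * .var 7 - .var 4 : Expr).Ok I B A :=
    hB.ok hA.ready.le (by decide) (small_width (by decide))
      (by simp only [Expr.arraysLt_sub, Expr.arraysLt_mul, Expr.arraysLt_var]; omega)
  have hval : (.var 8 * .var 7 - .var 4 : Expr).val A = k := by
    simp only [Expr.val_sub, Expr.val_mul, Expr.val_var, hA.ready.count, hA.ready.square,
      hA.counter]
    omega
  have hcost : (.var 8 * .var 7 - .var 4 : Expr).cost + 5 ≤ 100 := by decide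
  induction k generalizing t A with
  | zero =>
    obtain rfl : t = l * (z.length * z.length) := by omega
    exact ⟨A, _, Exec.loop_zero hok hval, hA, by omega⟩
  | succ k ih =>
    obtain ⟨A1, t1, x1, h1, ht1⟩ := exec_query hx hB hV hI hlen hconst (by omega)
      (hans t (by omega)) hA
    obtain ⟨A2, t2, x2, h2, ht2⟩ := ih (by omega) h1
      (hB.ok h1.ready.le (by decide) (small_width (by decide))
        (by simp only [Expr.arraysLt_sub, Expr.arraysLt_mul, Expr.arraysLt_var]; omega))
      (by
        simp only [Expr.val_sub, Expr.val_mul, Expr.val_var, h1.ready.count, h1.ready.square,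
          h1.counter]
        omega)
    refine ⟨A2, _, Exec.loop_ne hok (by rw [hval]; omega) x1 x2, h2, ?_⟩
    rw [add_mul k 1, one_mul]
    omega

end GapSubseq

namespace GapSubseq

open RAM

/-! ### Correctness of the tables -/

variable {x : List ℕ} {l : ℕ} {ptr : ℕ → ℕ} {z : List ℕ} {s : ℕ} {I B V : ℕ}
  {c : ℕ → Language ℕ} {A : Store}

theorem Ready.val_layerE (h : Ready x l ptr z s V A) : layerE.val A =
    A 1 0 / (z.length * z.length) / (z.length * z.length) % (l + 2) := by
  simp only [layerE, Expr.val_mod, Expr.val_div, Expr.val_add, Expr.val_var, Expr.val_const,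
    h.square, h.count]

theorem Ready.val_modulusE (h : Ready x l ptr z s V A) : modulusE.val A =
    A 1 0 / (z.length * z.length) / (z.length * z.length) / (l + 2) := by
  simp only [modulusE, Expr.val_div, Expr.val_add, Expr.val_var, Expr.val_const,
    h.square, h.count]

theorem Ready.val_targetE (h : Ready x l ptr z s V A) : targetE.val A =
    A 1 0 / (z.length * z.length) % (z.length * z.length) := by
  simp only [targetE, Expr.val_mod, Expr.val_div, Expr.val_var, h.square]

theorem Ready.val_sourceE (h : Ready x l ptr z s V A) : sourceE.val A =
    A 1 0 % (z.length * z.length) := by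
  simp only [sourceE, Expr.val_mod, Expr.val_var, h.square]

theorem Ready.val_sameLetterE (h : Ready x l ptr z s V A) (hx : InputData x l ptr z s)
    (a b : Expr) : (sameLetterE a b).val A = sameLetter z (a.val A) (b.val A) := by
  simp only [sameLetterE, letterE, inputE, Expr.val_sub, Expr.val_add, Expr.val_const,
    Expr.val_load, Expr.val_var, h.input, h.start, hx.letter, sameLetter]
  split_ifs <;> omega

theorem Ready.val_posSignE (h : Ready x l ptr z s V A) (a : Expr) :
    (posSignE a).val A = posSign s (modulusE.val A) (a.val A) := by
  simp only [posSignE, Expr.val_sub, Expr.val_add, Expr.val_mul, Expr.val_pos, Expr.val_var, h.sep,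
    posSign]
  split_ifs <;> omega

open Classical in
/-- The arrays from the array `5` on contain the answers to the queries. -/
def HasAnswers (z : List ℕ) (c : ℕ → Language ℕ) (l : ℕ) (A : Store) : Prop :=
  ∀ j < l, ∀ a < z.length, ∀ b < z.length, A (5 + ((j * z.length + a) * z.length + b)) 0 =
    if (z.take b).drop (a + 1) ∈ c j then 1 else 0

theorem Ready.val_linkE (h : Ready x l ptr z s V A) (hA : HasAnswers z c l A)
    {a b : Expr} (ha : a.val A < z.length) (hb : b.val A < z.length) (h0 : layerE.val A ≠ 0)
    (hl : layerE.val A ≤ l) :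
    (linkE a b).val A = link z s (c (layerE.val A - 1)) (a.val A) (b.val A) := by
  classical
  simp only [linkE, answerE, Expr.val_sub, Expr.val_add, Expr.val_mul, Expr.val_pos, Expr.val_var,
    Expr.val_const, Expr.val_load, h.sep, h.width, hA _ (show layerE.val A - 1 < l by omega) _ ha _ hb,
    link]
  by_cases h1 : a.val A < b.val A
  · have e1 : b.val A - a.val A ≠ 0 := by omega
    by_cases h2 : a.val A ≤ s ∧ s ≤ b.val A
    · rw [show a.val A - s = 0 by omega, show s - b.val A = 0 by omega]
      simp [h2]
    · have h3 : (1 - (a.val A - s)) * (1 - (s - b.val A)) = 0 := by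
        rw [mul_eq_zero]; omega
      rw [h3]
      simp [h1, h2, e1]
  · have e1 : b.val A - a.val A = 0 := by omega
    simp [h1, e1]

/-- Answers are addressed even where they are discarded, in particular in layer `l + 1`, which would
belong to a constraint number `l`. Hence `l + 1` instead of `l` in the hypothesis on `I`. -/
theorem Ready.arraysLt_tableE (h : Ready x l ptr z s V A) (hz : 0 < z.length)
    (hI : 5 + (l + 1) * (z.length * z.length) ≤ I) : tableE.ArraysLt I A := by
  have hQ : 0 < z.length * z.length := Nat.mul_pos hz hz
  have key : ∀ a b, a < z.length → b < z.length →
      5 + (((layerE.val A - 1) * z.length + a) * z.length + b) < I := fun a b ha hb => by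
    have h1 : layerE.val A - 1 ≤ l := by
      rw [h.val_layerE]
      have := Nat.mod_lt (A 1 0 / (z.length * z.length) / (z.length * z.length))
        (show 0 < l + 2 by omega)
      omega
    have h2 : (layerE.val A - 1) * z.length + a + 1 ≤ (l + 1) * z.length := by
      have := Nat.mul_le_mul_right z.length h1
      rw [add_mul, one_mul]; omega
    have h3 := Nat.mul_le_mul_right z.length h2
    rw [add_mul _ 1, one_mul, mul_assoc] at h3
    omega
  have hs1 : sourceE.val A / z.length < z.length := Nat.div_lt_of_lt_mul (by
    rw [h.val_sourceE]; exact Nat.mod_lt _ hQ)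
  have ht1 : targetE.val A / z.length < z.length := Nat.div_lt_of_lt_mul (by
    rw [h.val_targetE]; exact Nat.mod_lt _ hQ)
  have k1 := key _ _ hs1 ht1
  have k2 := key _ _ (Nat.mod_lt (sourceE.val A) hz) (Nat.mod_lt (targetE.val A) hz)
  have l1 : layerE.ArraysLt I A := by
    simp only [layerE, Expr.arraysLt_mod, Expr.arraysLt_div, Expr.arraysLt_add, Expr.arraysLt_var,
      Expr.arraysLt_const, and_true]; omega
  have l2 : modulusE.ArraysLt I A := by
    simp only [modulusE, Expr.arraysLt_div, Expr.arraysLt_add, Expr.arraysLt_var,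
      Expr.arraysLt_const, and_true]; omega
  have l3 : targetE.ArraysLt I A := by
    simp only [targetE, Expr.arraysLt_mod, Expr.arraysLt_div, Expr.arraysLt_var]; omega
  have l4 : sourceE.ArraysLt I A := by
    simp only [sourceE, Expr.arraysLt_mod, Expr.arraysLt_var]; omega
  have i1 : 1 < I := by omega
  have i0 : 0 < I := by omega
  have hQI : z.length * z.length ≤ (l + 1) * (z.length * z.length) :=
    Nat.le_mul_of_pos_left _ (by omega)
  have i3 : 3 < I := by omega
  simp only [tableE, termE, firstE, coefficientE, previousE, sameLetterE, letterE, posSignE, linkE,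
    answerE, inputE, Expr.arraysLt_cond, Expr.arraysLt_mod, Expr.arraysLt_div, Expr.arraysLt_add,
    Expr.arraysLt_mul, Expr.arraysLt_sub, Expr.arraysLt_pos, Expr.arraysLt_var,
    Expr.arraysLt_const, Expr.arraysLt_load, Expr.val_const, Expr.val_add, Expr.val_mul,
    Expr.val_sub, Expr.val_div, Expr.val_mod, Expr.val_var, h.width, l1, l2, l3, l4, i0, i1, i3, k1,
    k2, and_true]

theorem Ready.val_tableE (h : Ready x l ptr z s V A) (hx : InputData x l ptr z s)
    (hA : HasAnswers z c l A) {u : ℕ} (hu : A 1 0 = u)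
    (hlt : ∀ a < u, A 3 a = flatTable z s c l a) : tableE.val A = flatTable z s c l u := by
  have hz := hx.pos
  have hQ : 0 < z.length * z.length := Nat.mul_pos hz hz
  have hs1 : sourceE.val A / z.length < z.length := Nat.div_lt_of_lt_mul (by
    rw [h.val_sourceE]; exact Nat.mod_lt _ hQ)
  have ht1 : targetE.val A / z.length < z.length := Nat.div_lt_of_lt_mul (by
    rw [h.val_targetE]; exact Nat.mod_lt _ hQ)
  have hs2 : sourceE.val A % z.length < z.length := Nat.mod_lt _ hz
  have ht2 : targetE.val A % z.length < z.length := Nat.mod_lt _ hz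
  have d5 : ∀ e : Expr, (e / .var 5).val A = e.val A / z.length := fun e => by
    rw [Expr.val_div, Expr.val_var, h.width]
  have m5 : ∀ e : Expr, (e % .var 5).val A = e.val A % z.length := fun e => by
    rw [Expr.val_mod, Expr.val_var, h.width]
  have e1 : (Expr.cond sourceE (.const 0) (.load (.const 3) (.var 0 - .const 1))).val A =
      if sourceE.val A = 0 then 0 else layerSum z s c l (modulusE.val A) (layerE.val A)
        (targetE.val A) (sourceE.val A - 1) := by
    rw [Expr.val_cond]
    split_ifs with h0
    · rfl
    · rw [h.val_sourceE, hu] at h0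
      have hu0 : u ≠ 0 := by rintro rfl; simp at h0
      simp only [Expr.val_load, Expr.val_const, Expr.val_sub, Expr.val_var, hu]
      rw [hlt _ (by omega), flatTable_pred _ _ _ hz h0, h.val_modulusE, h.val_layerE,
        h.val_targetE, h.val_sourceE, hu]
  have e2 : layerE.val A ≠ 0 → previousE.val A = table z s c (modulusE.val A) (layerE.val A - 1)
      (sourceE.val A) := fun h0 => by
    have hl : layerE.val A < l + 2 := by rw [h.val_layerE]; exact Nat.mod_lt _ (by omega)
    simp only [previousE, Expr.val_load, Expr.val_const, Expr.val_add, Expr.val_mul, Expr.val_sub,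
      Expr.val_div, Expr.val_var, h.square, hu, h.val_sourceE, h.val_modulusE]
    rw [h.val_layerE, hu] at h0 hl ⊢
    have hw : u / (z.length * z.length) / (z.length * z.length) ≠ 0 := by
      intro h1; rw [h1] at h0; simp at h0
    rw [hlt, flatTable_eq _ _ _ (Nat.mod_lt _ hQ) (by omega)]
    · generalize u / (z.length * z.length) / (z.length * z.length) = w at *
      -- The layer digit is nonzero, so decreasing it does not borrow from the modulus digit.
      have hw1 : w - 1 = (l + 2) * (w / (l + 2)) + (w % (l + 2) - 1) := by
        have := Nat.div_add_mod w (l + 2)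
        omega
      have hdiv : (w - 1) / (l + 2) = w / (l + 2) := by
        rw [hw1, Nat.mul_add_div (by omega),
          Nat.div_eq_of_lt (show w % (l + 2) - 1 < l + 2 by omega), add_zero]
      have hmod : (w - 1) % (l + 2) = w % (l + 2) - 1 := by
        rw [hw1, Nat.mul_add_mod, Nat.mod_eq_of_lt (show w % (l + 2) - 1 < l + 2 by omega)]
      rw [hdiv, hmod, layerSum_last _ _ _ _ hz (by omega)]
    -- The entry that is read has an index below `u`, so it is already filled.
    · generalize z.length * z.length = Q at *
      have a1 := Nat.div_mul_le_self u Q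
      have a2 := Nat.div_mul_le_self (u / Q) Q
      have a3 := Nat.mod_lt u hQ
      have a4 : (u / Q / Q - 1) * Q + u % Q + 1 ≤ u / Q := by
        have : (u / Q / Q - 1) * Q + Q = u / Q / Q * Q := by
          rw [← add_one_mul, Nat.sub_add_cancel (Nat.one_le_iff_ne_zero.2 hw)]
        omega
      have a5 := Nat.mul_le_mul_right Q a4
      rw [add_mul _ 1, one_mul] at a5
      omega
  have e3 : termE.val A = layerTerm z s c l (modulusE.val A) (layerE.val A)
      (targetE.val A) (sourceE.val A) := by
    simp only [termE, Expr.val_cond, Expr.val_sub, Expr.val_var, h.count, layerTerm, Expr.val_const]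
    split_ifs with h0 h1 h2
    · simp only [firstE, Expr.val_mul, h.val_sameLetterE hx, h.val_posSignE, d5, m5]
    · rfl
    · simp only [coefficientE, Expr.val_mul, h.val_sameLetterE hx]
      rw [h.val_linkE hA (by rwa [d5]) (by rwa [d5]) h0 (by omega),
        h.val_linkE hA (by rwa [m5]) (by rwa [m5]) h0 (by omega), e2 h0]
      simp only [d5, m5]
    · exact e2 h0
  rw [tableE, Expr.val_mod, Expr.val_add, e1, e3, Expr.val_add, Expr.val_const, layerSum_rec,
    h.val_modulusE, h.val_layerE, h.val_targetE, h.val_sourceE, hu]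
  rfl

theorem Ready.val_moduliE (h : Ready x l ptr z s V A) :
    moduliE.val A = 4 * (z.length * (l + 1)) + 8 := by
  simp only [moduliE, Expr.val_add, Expr.val_mul, Expr.val_const, Expr.val_var, h.width, h.count]

theorem exec_table (hx : InputData x l ptr z s) (hB : Bounds I B V maxWidth)
    (hV : Large x l z.length V) (hI : 5 + (l + 1) * (z.length * z.length) ≤ I)
    (h : Ready x l ptr z s V A) (hA : HasAnswers z c l A) {n : ℕ}
    (hn : (4 * (z.length * (l + 1)) + 8) * (l + 2) * (z.length * z.length) *
      (z.length * z.length) = n) :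
    ∃ A' t, Exec I B (.fill (.const 3) tableSizeE tableE) A A' t ∧ Ready x l ptr z s V A' ∧
      (∀ a < n, A' 3 a = flatTable z s c l a) ∧ t ≤ (n + 1) * 10000 := by
  have hI5 := hB.arrays
  have hB1 := hB.lt
  have hV3 := hV.table
  have hV4 := hB.const
  have hV5 := hV.moduli
  have hself := Nat.le_mul_of_pos_left (4 * (z.length * (l + 1)) + 9)
    (show 0 < 4 * (z.length * (l + 1)) + 9 by omega)
  have hf : ∀ a < n, flatTable z s c l a ≤ V := fun a ha => by
    have := flatTable_le s c l (z := z) (ha.trans_eq hn.symm)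
    omega
  obtain ⟨A', t, x1, f1, ht⟩ := Exec.fill (I := I) (B := B) (A := A)
    (c := 3) (f := flatTable z s c l) (n := n) (cE := .const 3) (nE := tableSizeE) (e := tableE)
    (by omega) (by omega) (by omega) (by omega)
    ⟨hB.ok h.le (by decide) (by unfold maxWidth; omega)
      (by
        simp only [tableSizeE, moduliE, Expr.arraysLt_mul, Expr.arraysLt_add, Expr.arraysLt_var,
          Expr.arraysLt_const, and_true, true_and]
        omega), by
      simp only [tableSizeE, Expr.val_mul, Expr.val_add, Expr.val_const, Expr.val_var,
        h.val_moduliE, h.count, h.square]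
      exact hn⟩
    (fun t ht A' hA' => ⟨show 3 ≤ B by omega, rfl⟩)
    (fun t ht A' hA' => by
      have h' := h.filled le_rfl hA' ht.le (by omega) fun a ha => hf a (by omega)
      refine ⟨hB.ok h'.le (by decide) (by unfold maxWidth; omega)
        (h'.arraysLt_tableE hx.pos hI), h'.val_tableE hx ?_ hA'.counter hA'.lt⟩
      intro j hj a ha b hb
      rw [hA'.other _ (by omega) (by omega)]
      exact hA j hj a ha b hb)
  refine ⟨A', t, x1, h.filled le_rfl f1 le_rfl (by omega) hf, f1.lt, ht.trans ?_⟩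
  exact Nat.mul_le_mul_left _ (by decide)

theorem exec_result (hx : InputData x l ptr z s) (hB : Bounds I B V maxWidth)
    (hV : Large x l z.length V) (h : Ready x l ptr z s V A)
    (hA : ∀ a < (4 * (z.length * (l + 1)) + 8) * (l + 2) * (z.length * z.length) *
      (z.length * z.length), A 3 a = flatTable z s c l a) :
    ∃ A' t, Exec I B (.fill (.const 4) (moduliE + .const 1) resultE) A A' t ∧
      Ready x l ptr z s V A' ∧
      A' 4 (4 * (z.length * (l + 1)) + 8) =
        ∑ m ∈ Finset.range (4 * (z.length * (l + 1)) + 8), tableSum z s c l m ∧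
      t ≤ (4 * (z.length * (l + 1)) + 10) * 10000 := by
  have hI5 := hB.arrays
  have hB1 := hB.lt
  have hV4 := hB.const
  have hV5 := hV.moduli
  have hz := hx.pos
  have hQ : 0 < z.length * z.length := Nat.mul_pos hz hz
  obtain ⟨N, hN⟩ : ∃ N, N = 4 * (z.length * (l + 1)) + 8 := ⟨_, rfl⟩
  rw [show 4 * (z.length * (l + 1)) + 9 = N + 1 by omega] at hV5
  have hself := Nat.le_mul_of_pos_left (N + 1) (show 0 < N + 1 by omega)
  rw [← hN] at hA ⊢
  have hidx : ∀ m < N, A 3 ((m * (l + 2) + (l + 1)) * (z.length * z.length) *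
      (z.length * z.length) + (z.length * z.length - 1)) = tableSum z s c l m := fun m hm => by
    rw [hA, show (m * (l + 2) + (l + 1)) * (z.length * z.length) *
      (z.length * z.length) + (z.length * z.length - 1) = ((m * (l + 2) + (l + 1)) *
        (z.length * z.length) + 0) * (z.length * z.length) + (z.length * z.length - 1) by ring,
      flatTable_eq _ _ _ hQ (by omega)]
    · have h1 : (m * (l + 2) + (l + 1)) / (l + 2) = m := by
        rw [mul_comm, Nat.mul_add_div (by omega), Nat.div_eq_of_lt (by omega), add_zero]
      have h2 : (m * (l + 2) + (l + 1)) % (l + 2) = l + 1 := by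
        rw [mul_comm, Nat.mul_add_mod, Nat.mod_eq_of_lt (by omega)]
      rw [h1, h2, layerSum_top _ _ _ _ hz]
    · generalize z.length * z.length = Q at *
      have a1 : m * (l + 2) + (l + 1) + 1 ≤ N * (l + 2) := by
        have := Nat.mul_le_mul_right (l + 2) (show m + 1 ≤ N by omega)
        rw [add_mul, one_mul] at this; omega
      have a2 := Nat.mul_le_mul_right Q a1
      have a3 := Nat.mul_le_mul_right Q (show (m * (l + 2) + (l + 1)) * Q + 1 ≤ N * (l + 2) * Q by
        rw [add_mul _ 1] at a2; omega)
      rw [add_mul _ 1 Q, one_mul] at a3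
      omega
  -- At most `N` residues below `N + 1` are added, so the running sum still fits into a word.
  have hf : ∀ a < N + 1, ∑ m ∈ Finset.range a, tableSum z s c l m ≤ V := fun a ha => by
    refine le_trans (Finset.sum_le_card_nsmul _ _ (N + 1) fun m hm => ?_) ?_
    · have h1 : tableSum z s c l m < m + 1 := Nat.mod_lt _ (Nat.succ_pos m)
      have h2 := Finset.mem_range.1 hm
      omega
    · rw [Finset.card_range, smul_eq_mul]
      exact (Nat.mul_le_mul_right _ (by omega)).trans hV5
  obtain ⟨A', t, x1, f1, ht⟩ := Exec.fill (I := I) (B := B) (A := A)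
    (c := 4) (f := fun a => ∑ m ∈ Finset.range a, tableSum z s c l m) (n := N + 1)
    (cE := .const 4) (nE := moduliE + .const 1) (e := resultE)
    (by omega) (by omega) (by omega) (by omega)
    ⟨hB.ok h.le (by decide) (small_width (by decide))
      (by
        simp only [moduliE, Expr.arraysLt_mul, Expr.arraysLt_add, Expr.arraysLt_var,
          Expr.arraysLt_const, and_true, true_and]
        omega), by
      simp only [Expr.val_add, Expr.val_const, h.val_moduliE]; omega⟩
    (fun t ht A' hA' => ⟨show 4 ≤ B by omega, rfl⟩)
    (fun t ht A' hA' => by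
      have h' := h.filled (by omega) hA' ht.le (by omega) fun a ha => hf a (by omega)
      refine ⟨hB.ok h'.le (by decide) (by unfold maxWidth; omega) ?_, ?_⟩
      · simp only [resultE, Expr.arraysLt_cond, Expr.arraysLt_mul, Expr.arraysLt_add,
          Expr.arraysLt_sub, Expr.arraysLt_var, Expr.arraysLt_const, Expr.arraysLt_load,
          Expr.val_const, and_true, true_and]
        omega
      · simp only [resultE, Expr.val_cond, Expr.val_mul, Expr.val_add, Expr.val_sub, Expr.val_var,
          Expr.val_load, Expr.val_const, hA'.counter, h'.count, h'.square]
        split_ifs with ht0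
        · simp [ht0]
        · rw [hA'.lt _ (by omega), hA'.other 3 (by omega) (by omega), hidx _ (by omega),
            ← Finset.sum_range_succ, Nat.sub_add_cancel (by omega)])
  refine ⟨A', t, x1, h.filled (by omega) f1 le_rfl (by omega) hf, f1.lt N (by omega), ht.trans ?_⟩
  exact Nat.mul_le_mul (by omega) (by decide)

end GapSubseq

namespace GapSubseq

open RAM

/-! ### The input of the equivalence problem -/

theorem polynomial_eval_mono (p : Polynomial ℕ) {a b : ℕ} (h : a ≤ b) : p.eval a ≤ p.eval b := by
  induction p using Polynomial.induction_on' with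
  | add p q hp hq => simpa using Nat.add_le_add hp hq
  | monomial n c => simpa using Nat.mul_le_mul_left c (Nat.pow_le_pow_left h n)

theorem inputMem_append (pre rest : List ℕ) (i : ℕ) :
    inputMem (pre ++ rest) (pre.length + 1 + i) = rest.getD i 0 := by
  rw [inputMem, show pre.length + 1 + i = pre.length + i + 1 by ring, List.getD_cons_succ,
    List.getD_append_right _ _ _ _ (by omega), Nat.add_sub_cancel_left]

theorem inputSize_append (x y : List ℕ) : inputSize (x ++ y) = inputSize x + inputSize y := by
  simp [inputSize]

theorem inputSize_le_of_sublist {x y : List ℕ} (h : x.Sublist y) : inputSize x ≤ inputSize y := by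
  induction h with
  | slnil => exact le_rfl
  | cons a _ ih => simp only [inputSize, List.map_cons, List.sum_cons] at ih ⊢; omega
  | cons_cons a _ ih => simp only [inputSize, List.map_cons, List.sum_cons] at ih ⊢; omega

theorem wordRange_le {x : List ℕ} {n : ℕ} (hl : x.length ≤ n) (h : ∀ a ∈ x, a ≤ n) :
    wordRange x ≤ n := by
  refine max_le hl ?_
  clear hl
  induction x with
  | nil => exact Nat.zero_le _
  | cons a x ih =>
    exact max_le (h a (by simp)) (ih fun b hb => h b (by simp [hb]))

section

variable {ι : Type*} (name : ι → List ℕ) (gcs : List ι) (w w' : List ℕ)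

/-- The input of the equivalence problem. -/
def encoding : List ℕ :=
  gcs.length :: (gcs.flatMap fun i => block (name i)) ++ block w ++ block w'

/-- The address of the name with the number `j`. -/
def pointer (j : ℕ) : ℕ := 2 + ((gcs.take j).flatMap fun i => block (name i)).length

/-- The block of `w'` starts with its length, which serves as the separator: `z` stands contiguously
in the input and need not be assembled. -/
theorem encoding_eq : encoding name gcs w w' =
    (gcs.length :: gcs.flatMap fun i => block (name i)) ++
      (w.length :: (w ++ w'.length :: w')) := by
  simp [encoding, block]

theorem encoding_eq_of_lt {j : ℕ} (hj : j < gcs.length) : encoding name gcs w w' =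
    (gcs.length :: (gcs.take j).flatMap fun i => block (name i)) ++ (block (name gcs[j]) ++
      (((gcs.drop (j + 1)).flatMap fun i => block (name i)) ++
        (w.length :: (w ++ w'.length :: w')))) := by
  have h : gcs = gcs.take j ++ gcs[j] :: gcs.drop (j + 1) := by simp
  have hflat : (gcs.flatMap fun i => block (name i)) =
      ((gcs.take j).flatMap fun i => block (name i)) ++ (block (name gcs[j]) ++
        (gcs.drop (j + 1)).flatMap fun i => block (name i)) := by
    conv_lhs => rw [h]
    rw [List.flatMap_append, List.flatMap_cons]
  rw [encoding_eq, hflat]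
  simp only [List.cons_append, List.append_assoc]

theorem inputMem_pointer {j : ℕ} (hj : j < gcs.length) (i : ℕ) (hi : i ≤ (name gcs[j]).length) :
    inputMem (encoding name gcs w w') (pointer name gcs j + i) =
      (block (name gcs[j])).getD i 0 := by
  rw [encoding_eq_of_lt _ _ _ _ hj, pointer,
    show 2 + ((gcs.take j).flatMap fun i => block (name i)).length + i =
      (gcs.length :: (gcs.take j).flatMap fun i => block (name i)).length + 1 + i by
        simp only [List.length_cons]; ring, inputMem_append, List.getD_append]
  simp [block]; omega

theorem inputMem_pointer_end (i : ℕ) :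
    inputMem (encoding name gcs w w') (pointer name gcs gcs.length + i) =
      (w.length :: (w ++ w'.length :: w')).getD i 0 := by
  rw [encoding_eq, pointer, List.take_length,
    show 2 + (gcs.flatMap fun i => block (name i)).length + i =
      (gcs.length :: gcs.flatMap fun i => block (name i)).length + 1 + i by
        simp only [List.length_cons]; ring, inputMem_append]

theorem inputData_encoding : InputData (encoding name gcs w w') gcs.length (pointer name gcs)
    (w ++ w'.length :: w') w.length where
  count := by simp [encoding, inputMem]
  ptr_zero := by simp [pointer]
  ptr_succ j hj := by
    have h := inputMem_pointer name gcs w w' hj 0 (Nat.zero_le _)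
    rw [add_zero] at h
    rw [h, pointer, pointer, List.take_succ_eq_append_getElem hj, List.flatMap_append,
      List.length_append]
    simp only [List.flatMap_cons, List.flatMap_nil, List.append_nil, block, List.length_cons,
      List.getD_cons_zero]
    ring
  length := by
    rw [encoding_eq, pointer, List.take_length]
    simp only [List.length_append, List.length_cons]; ring
  sep := by simpa using inputMem_pointer_end name gcs w w' 0
  letter a := by
    rw [show pointer name gcs gcs.length + 1 + a = pointer name gcs gcs.length + (a + 1) by ring,
      inputMem_pointer_end, List.getD_cons_succ]
  pos := by simp

/-- The query about the constraint with the number `j` and the gap between two positions. -/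
theorem answers_encoding {C : ι → Language ℕ} {prog : Program} {time : Polynomial ℕ} {d V : ℕ}
    (hrun : ∀ a : ι × List ℕ, ∃ t ≤ time.eval (inputSize (block (name a.1) ++ block a.2)),
      prog.length ≤ (run prog (block (name a.1) ++ block a.2) t).pc ∧
      (a.2 ∈ C a.1 → (run prog (block (name a.1) ++ block a.2) t).mem 0 = 1) ∧
      (a.2 ∉ C a.1 → (run prog (block (name a.1) ++ block a.2) t).mem 0 = 0) ∧
      ∀ s ≤ t, ∀ b, (run prog (block (name a.1) ++ block a.2) s).mem b ≤
        (wordRange (block (name a.1) ++ block a.2) + 2) ^ d)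
    (hV : (wordRange (encoding name gcs w w') + 2) ^ d ≤ V) {j a b : ℕ} (hj : j < gcs.length)
    (hb : b < (w ++ w'.length :: w').length) [Decidable
      (((w ++ w'.length :: w').take b).drop (a + 1) ∈ C gcs[j])] :
    Answers prog (encoding name gcs w w') V
      (time.eval (2 * inputSize (encoding name gcs w w'))) (pointer name gcs j)
      (pointer name gcs gcs.length + 1 + a) (b - (a + 1))
      (if ((w ++ w'.length :: w').take b).drop (a + 1) ∈ C gcs[j] then 1 else 0) := by
  set z := w ++ w'.length :: w' with hz
  set u := (z.take b).drop (a + 1) with hu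
  set x := encoding name gcs w w' with hx
  have hxd : InputData x gcs.length (pointer name gcs) z w.length := inputData_encoding name gcs w w'
  have hul : u.length = b - (a + 1) := by simp [hu]; omega
  have huz : u.Sublist z := (List.drop_sublist _ _).trans (List.take_sublist _ _)
  -- Gaps across the separator are queried too, although their answers have no effect. Every word of
  -- a query except the length of the gap is a word of `x`, which bounds its word range and size.
  have hsub : (block (name gcs[j]) ++ u).Sublist x := by
    rw [hx, encoding_eq_of_lt _ _ _ _ hj]
    refine List.Sublist.trans ?_ (List.sublist_append_right _ _)
    refine List.Sublist.append (List.Sublist.refl _) ?_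
    exact ((huz.trans (List.sublist_cons_self _ _))).trans (List.sublist_append_right _ _)
  have hP := inputMem_pointer name gcs w w' hj
  have hnm : inputMem x (pointer name gcs j) = (name gcs[j]).length := by
    simpa [block] using hP 0 (Nat.zero_le _)
  have hylen : (block (name gcs[j]) ++ block u).length = (name gcs[j]).length + u.length + 2 := by
    simp [block]; ring
  have hyx : (block (name gcs[j]) ++ block u).length ≤ x.length := by
    have h1 := hxd.length
    have h2 := hxd.ptr_succ j hj
    have h3 := hxd.ptr_le (j := j + 1) (k := gcs.length) hj le_rfl
    have h4 := hxd.le_ptr hj.le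
    omega
  have hwr : wordRange (block (name gcs[j]) ++ block u) ≤ wordRange x := by
    refine wordRange_le (hyx.trans (length_le_wordRange x)) fun k hk => ?_
    have h1 : k ∈ block (name gcs[j]) ++ u ∨ k = u.length := by
      simp only [block, List.mem_append, List.mem_cons] at hk ⊢
      tauto
    rcases h1 with h1 | h1
    · exact le_wordRange (hsub.subset h1)
    · have := length_le_wordRange x
      omega
  have hsize : inputSize (block (name gcs[j]) ++ block u) ≤ 2 * inputSize x := by
    have h1 := inputSize_le_of_sublist hsub
    have h2 := length_le_inputSize x
    have h3 : Nat.size u.length ≤ u.length := Nat.size_le.2 Nat.lt_two_pow_self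
    rw [inputSize_append] at h1 ⊢
    have h4 : inputSize (block u) = Nat.size u.length + 1 + inputSize u := by
      simp [inputSize, block]
    omega
  obtain ⟨T, hT, h1, h2, h3, h4⟩ := hrun (gcs[j], u)
  refine ⟨block (name gcs[j]) ++ block u, T, by rw [hylen, hnm, hul], hyx, fun i hi hi' => ?_, ?_,
    fun i hi hi' => ?_, hT.trans (polynomial_eval_mono _ hsize), h1, ?_,
    fun t ht b => (h4 t ht b).trans ((Nat.pow_le_pow_left (by simpa using hwr) d).trans hV)⟩
  · rw [hnm] at hi'
    obtain ⟨i, rfl⟩ := Nat.exists_eq_succ_of_ne_zero hi.ne'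
    rw [Nat.succ_eq_add_one, ← Nat.add_assoc, Nat.add_sub_cancel, hP i (by omega), inputMem,
      List.getD_cons_succ, List.getD_append _ _ _ _ (by simp [block]; omega)]
  · rw [hnm, show (name gcs[j]).length + 2 = (block (name gcs[j])).length + 1 + 0 by
      simp [block], inputMem_append, ← hul]
    rfl
  · rw [hnm] at hi hi' ⊢
    obtain ⟨k, rfl⟩ := Nat.exists_eq_add_of_lt hi
    rw [show (name gcs[j]).length + 2 + k + 1 = (block (name gcs[j])).length + 1 + (k + 1) by
      simp [block]; ring, inputMem_append, block, List.getD_cons_succ]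
    rw [show (block (name gcs[j])).length + 1 + (k + 1) - ((name gcs[j]).length + 2) = k + 1 by
      simp [block], Nat.add_assoc, hxd.letter]
    rw [hu, List.getD_eq_getElem _ _ (by rw [← hu]; omega), List.getElem_drop, List.getElem_take,
      List.getD_eq_getElem _ _ (by omega)]
    congr 1
    omega
  · split_ifs with hmem
    · exact h2 hmem
    · exact h3 hmem

end

/-! ### Resource bounds and assembly of the decision procedure -/

/-- The exponent in the bound on the values that are stored by the program. -/
def storeExponent (prog : Program) (d : ℕ) : ℕ :=
  d + prog.length + (prog.map Instr.maxConst).sum + 20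

theorem large_of_le {x : List ℕ} {l L m D : ℕ} (hm : m = wordRange x + 2) (hl : l + 1 ≤ x.length)
    (hL : L ≤ x.length) (hD : 20 ≤ D) : Large x l L (m ^ D) := by
  have hxm : x.length + 2 ≤ m := by have := length_le_wordRange x; omega
  have h2 : 2 ≤ m := by omega
  have hpow : ∀ k ≤ 20, m ^ k ≤ m ^ D := fun k hk => Nat.pow_le_pow_right (by omega) (by omega)
  have p2 : ∀ k, 2 ^ k ≤ m ^ k := fun k => Nat.pow_le_pow_left h2 k
  have hdouble : ∀ k, m ^ k + m ^ k ≤ m ^ (k + 1) := fun k => by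
    rw [pow_succ]; nlinarith [Nat.zero_le (m ^ k)]
  have hL1 : L ≤ m := by omega
  have hl1 : l + 1 ≤ m := by omega
  have hLL : L * L ≤ m ^ 2 := by rw [sq]; exact Nat.mul_le_mul hL1 hL1
  have hN : 4 * (L * (l + 1)) + 9 ≤ m ^ 5 := by
    have h1 : 4 * (L * (l + 1)) ≤ m ^ 4 := by
      calc 4 * (L * (l + 1)) ≤ m ^ 2 * (m * m) :=
            Nat.mul_le_mul (p2 2) (Nat.mul_le_mul hL1 hl1)
        _ = m ^ 4 := by ring
    have h3 := p2 4
    have h4 : m ^ 4 + m ^ 4 ≤ m ^ 5 := hdouble 4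
    omega
  refine ⟨?_, ?_, ?_, ?_, ?_⟩
  · exact (show wordRange x ≤ m ^ 1 by rw [pow_one]; omega).trans (hpow 1 (by omega))
  · refine le_trans ?_ (hpow 4 (by omega))
    have h1 : x.length + 3 ≤ m ^ 2 := by nlinarith
    calc _ ≤ m ^ 2 * m ^ 2 := Nat.mul_le_mul h1 h1
      _ = m ^ 4 := by ring
  · refine le_trans ?_ (hpow 4 (by omega))
    have h1 : l * (L * L) ≤ m ^ 3 := by
      calc l * (L * L) ≤ m * m ^ 2 := Nat.mul_le_mul (by omega) hLL
        _ = m ^ 3 := by ring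
    have h3 := p2 3
    have h4 : m ^ 3 + m ^ 3 ≤ m ^ 4 := hdouble 3
    omega
  · refine le_trans ?_ (hpow 10 (by omega))
    calc _ ≤ m ^ 5 * m * m ^ 2 * m ^ 2 :=
          Nat.mul_le_mul (Nat.mul_le_mul (Nat.mul_le_mul (by omega) (by omega)) hLL) hLL
      _ = m ^ 10 := by ring
  · refine le_trans ?_ (hpow 10 (by omega))
    calc _ ≤ m ^ 5 * m ^ 5 := Nat.mul_le_mul hN hN
      _ = m ^ 10 := by ring

/-- An upper bound for the running time. -/
noncomputable def timeBound (prog : Program) (time : Polynomial ℕ) : Polynomial ℕ :=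
  (.X + 2) * 1000 +
  (.X * (.X * .X) * ((.X + 2) * 1000 + (time.comp (2 * .X) + 1) * .C (simulationCost prog) + 1000 +
    100) + 100) +
  ((4 * (.X * (.X + 1)) + 8) * (.X + 2) * (.X * .X) * (.X * .X) + 1) * 10000 +
  (4 * (.X * (.X + 1)) + 10) * 10000

theorem equivalenceInPolyTime {ι : Type*} (C : ι → Language ℕ) (name : ι → List ℕ)
    (h : ConstraintsInPolyTime C name) : EquivalenceInPolyTime C name := by
  classical
  obtain ⟨prog, time, d, hrun⟩ := h
  refine polyTimeDecidable_of_exec (decideS prog) outputE (timeBound prog time)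
    (storeExponent prog d * maxWidth) fun a => ?_
  obtain ⟨gcs, w, w'⟩ := a
  change ∃ A' t B, Exec ((encoding name gcs w w').length + 5 |>.pow 3) B (decideS prog)
    (inputStore (encoding name gcs w w')) A' t ∧
      outputE.Ok ((encoding name gcs w w').length + 5 |>.pow 3) B A' ∧ _ ∧ _ ∧
      t ≤ (timeBound prog time).eval (inputSize (encoding name gcs w w')) ∧
      wordRange (encoding name gcs w w') ≤ B ∧
      B ≤ (wordRange (encoding name gcs w w') + 2) ^ (storeExponent prog d * maxWidth)
  have hx := inputData_encoding name gcs w w'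
  have hans := fun (j a b : ℕ) (hj : j < gcs.length)
    (hb : b < (w ++ w'.length :: w').length) => answers_encoding name gcs w w' (C := C)
      (V := (wordRange (encoding name gcs w w') + 2) ^ storeExponent prog d) hrun
      (Nat.pow_le_pow_right (by omega) (by unfold storeExponent; omega)) (a := a) hj hb
  set x := encoding name gcs w w'
  set z := w ++ w'.length :: w' with hz
  -- The value beyond the last constraint is irrelevant, since only `c j` with `j < gcs.length`
  -- enters.
  set c : ℕ → Language ℕ := fun j => if h : j < gcs.length then C gcs[j] else 0 with hc
  set V := (wordRange x + 2) ^ storeExponent prog d with hVdef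
  have hcj : ∀ j (hj : j < gcs.length), c j = C gcs[j] := fun j hj => by simp [hc, hj]
  have hiff := equivWithMultiplicities_iff (l := gcs.length) c w w'
  rw [show (fun j : Fin gcs.length => c j) = fun j => C (gcs.get j) from
    funext fun j => hcj j j.2, ← hz] at hiff
  have hlen := hx.length
  have hl := hx.le_ptr le_rfl
  have hpos := hx.pos
  have hV : Large x gcs.length z.length V :=
    large_of_le rfl (by omega) (by omega) (by unfold storeExponent; omega)
  have hI : 5 + (gcs.length + 1) * (z.length * z.length) ≤ (x.length + 5).pow 3 := by
    have h1 : (gcs.length + 1) * (z.length * z.length) ≤ x.length * (x.length * x.length) :=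
      Nat.mul_le_mul (by omega) (Nat.mul_le_mul (by omega) (by omega))
    have h2 : (x.length + 5) ^ 3 = x.length * (x.length * x.length) +
      (15 * x.length ^ 2 + 75 * x.length + 125) := by ring
    change _ ≤ (x.length + 5) ^ 3
    omega
  have hI' : 5 + gcs.length * (z.length * z.length) ≤ (x.length + 5).pow 3 :=
    le_trans (Nat.add_le_add_left (Nat.mul_le_mul_right _ (by omega)) _) hI
  -- Stored values are at most `V`; intermediate values of expressions need the power `V ^
  -- maxWidth`.
  have hB : Bounds ((x.length + 5).pow 3) (V ^ maxWidth) V maxWidth := by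
    refine ⟨by omega, ?_, le_rfl, by unfold maxWidth; omega⟩
    calc 16 = 2 ^ 4 := rfl
      _ ≤ (wordRange x + 2) ^ 4 := Nat.pow_le_pow_left (by omega) 4
      _ ≤ V := Nat.pow_le_pow_right (by omega) (by unfold storeExponent; omega)
  have hself : ∀ k ≤ storeExponent prog d, k ≤ V := fun k hk =>
    (le_pow_add_two (wordRange x) k).trans (Nat.pow_le_pow_right (by omega) hk)
  have hplen : prog.length ≤ V := hself _ (by unfold storeExponent; omega)
  have hconst : ∀ i ∈ prog, i.maxConst ≤ V := fun i hi => hself _ (by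
    have := List.single_le_sum (l := prog.map Instr.maxConst) (fun _ _ => Nat.zero_le _) _
      (List.mem_map_of_mem hi)
    unfold storeExponent; omega)
  set Tm := time.eval (2 * inputSize x) with hTm
  obtain ⟨A1, t1, x1, r1, p1, p4, z1, ht1⟩ := exec_setup hx hB hV
  have q1 : Queried x gcs.length (pointer name gcs) z w.length V (fun t =>
      if (z.take (t % z.length)).drop (t / z.length % z.length + 1) ∈
        c (t / (z.length * z.length)) then 1 else 0) 0 A1 :=
    ⟨r1, p1, p4, fun k _ => z1 _ (by omega), fun k hk => absurd hk (Nat.not_lt_zero k)⟩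
  obtain ⟨A2, t2, x2, q2, ht2⟩ := exec_queries_loop (prog := prog) (Tmax := Tm) hx hB hV hI' hplen
    hconst (fun t ht => by
      have hj : t / (z.length * z.length) < gcs.length :=
        Nat.div_lt_of_lt_mul (by rwa [mul_comm])
      have := hans _ (t / z.length % z.length) (t % z.length) hj (Nat.mod_lt _ hpos)
      rw [← hcj _ hj] at this
      convert this) (add_zero _) q1
  have hA : HasAnswers z c gcs.length A2 := fun j hj a ha b hb => by
    have e1 : ((j * z.length + a) * z.length + b) / z.length = j * z.length + a := by
      rw [mul_comm, Nat.mul_add_div hpos, Nat.div_eq_of_lt hb, add_zero]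
    have e2 : (j * z.length + a) / z.length = j := by
      rw [mul_comm, Nat.mul_add_div hpos, Nat.div_eq_of_lt ha, add_zero]
    have hlt : (j * z.length + a) * z.length + b < gcs.length * (z.length * z.length) := by
      have h1 : j * z.length + a + 1 ≤ gcs.length * z.length := by
        have := Nat.mul_le_mul_right z.length (show j + 1 ≤ gcs.length by omega)
        rw [add_mul, one_mul] at this; omega
      have h2 := Nat.mul_le_mul_right z.length h1
      rw [add_mul _ 1, one_mul, mul_assoc gcs.length] at h2
      omega
    rw [q2.done _ hlt, ← Nat.div_div_eq_div_mul, e1, e2]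
    have e3 : ((j * z.length + a) * z.length + b) % z.length = b := by
      rw [mul_comm, Nat.mul_add_mod, Nat.mod_eq_of_lt hb]
    have e4 : (j * z.length + a) % z.length = a := by
      rw [mul_comm, Nat.mul_add_mod, Nat.mod_eq_of_lt ha]
    rw [e3, e4]
  obtain ⟨A3, t3, x3, r3, hA3, ht3⟩ := exec_table hx hB hV hI q2.ready hA rfl
  obtain ⟨A4, t4, x4, r4, hA4, ht4⟩ := exec_result hx hB hV r3 hA3
  have hout : outputE.val A4 = if (∀ m < 4 * (z.length * (gcs.length + 1)) + 8,
      tableSum z w.length c gcs.length m = 0) then 1 else 0 := by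
    simp only [outputE, Expr.val_cond, Expr.val_load, Expr.val_const, r4.val_moduliE, hA4,
      Finset.sum_eq_zero_iff, Finset.mem_range]
  refine ⟨A4, _, V ^ maxWidth, x1.seq (x2.seq (x3.seq x4)), ?_, fun hP => ?_, fun hP => ?_, ?_, ?_,
    ?_⟩
  · refine hB.ok r4.le (by decide) (by unfold maxWidth; omega) ?_
    have hI5 := hB.arrays
    simp only [outputE, moduliE, Expr.arraysLt_cond, Expr.arraysLt_load, Expr.arraysLt_add,
      Expr.arraysLt_mul, Expr.arraysLt_const, Expr.arraysLt_var, Expr.val_const, and_true, true_and]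
    omega
  · rw [hout, if_pos (hiff.1 hP)]
  · rw [hout, if_neg fun hall => hP (hiff.2 hall)]
  · have hS := length_le_inputSize x
    generalize hSS : inputSize x = S at *
    have b1 : gcs.length ≤ S := by omega
    have b2 : z.length ≤ S := by omega
    have b3 : x.length ≤ S := hS
    have b4 : gcs.length + 2 ≤ S + 2 := by omega
    simp only [timeBound, Polynomial.eval_add, Polynomial.eval_mul, Polynomial.eval_X,
      Polynomial.eval_C, Polynomial.eval_comp, Polynomial.eval_one, Polynomial.eval_ofNat]
    refine le_trans (Nat.add_le_add ht1 (Nat.add_le_add ht2 (Nat.add_le_add ht3 ht4))) ?_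
    rw [← Nat.add_assoc, ← Nat.add_assoc]
    unfold queryCost
    gcongr
    exact hTm.le
  · exact hV.word.trans hB.le
  · rw [hVdef, ← pow_mul]

end GapSubseq

theorem mainTheorem10 {ι : Type*} (C : ι → Language ℕ) (name : ι → List ℕ)
    (h : GapSubseq.ConstraintsInPolyTime C name) :
    GapSubseq.EquivalenceInPolyTime C name :=
  GapSubseq.equivalenceInPolyTime C name h
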